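/- Let $\lambda,\mu$ be nonzero real numbers. For $\rho\in\mathbb R$ let $\mathfrak s_3(\rho)$ be the real Lie algebra with basis $e_0,e_1,e_2$ and $[e_0,e_1]=\rho e_1-e_2$, $[e_0,e_2]=e_1+\rho e_2$, $[e_1,e_2]=0$. Let $\mathfrak g=\mathfrak s_3(\mu)$ with basis $x^0,x^1,x^2$, made a Lie bialgebra by the cobracket $\delta$ for which the dual Lie algebra $\mathfrak g^*$, with dual basis $X_0,X_1,X_2$, has brackets $$[X_0,X_1]=-\tfrac{\lambda}{\mu}X_1+\lambda X_2,\qquad [X_0,X_2]=-\lambda X_1-\tfrac{\lambda}{\mu}X_2,\qquad [X_1,X_2]=0 .$$ Let $D=\mathfrak g\oplus\mathfrak g^*$ be its Drinfel'd double: if $[x^i,x^j]=f^{ij}_kx^k$ and $[X_i,X_j]=c^k_{ij}X_k$, then $[x^i,X_j]=c^i_{jk}x^k-f^{ik}_jX_k$; equip $D$ with the cobracket $\delta_{DD}(Y)=[Y\otimes1+1\otimes Y,\sum_i x^i\otimes X_i]$. Then: 1. The subspaces $\langle x^i\rangle$ and $\langle X_i\rangle$ of $D$ are subalgebras isomorphic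 to $\mathfrak s_3(\mu)$ and $\mathfrak s_3(1/\mu)$, and $D\cong\mathfrak{so}(1,3)$ as real Lie algebras. If $\mu=1$, the Lie bialgebra $\mathfrak g$ is isomorphic to its dual Lie bialgebra. 2. The Lie bialgebra $(D,\delta_{DD})$ has a Hopf algebra quantization $A$ of the following form. $A$ is a topological Hopf algebra over $\mathbb R[[z]]$ (with coproduct $\Delta:A\to A\hat\otimes A$ into the $z$-adically completed tensor square), $z$-adically complete and separated and $z$-torsion-free. It has an $\mathbb R$-linear map $D\to A$ (written $Y\mapsto Y$) and an algebra isomorphism $A/zA\cong U(D)$ that sends the class of $Y$ to $Y$, and $\Delta(Y)=1\otimes Y+Y\otimes 1+z\,\delta_{DD}(Y)+O(z^2)$ for all $Y\in D$. The coproduct is given by $$\Delta(x^0)=1\otimes x^0+x^0\otimes1,\qquad \Delta(X_0)=1\otimes X_0+X_0\otimes 1,$$ $$\begin{aligned} \Delta(x^1)={}&e^{-\frac\lambda\mu zx^0}\cos(z\lambda x^0)\otimes x^1+x^1\otimes e^{\frac\lambda\mu zx^0}\cos(z\lambda x^0)\\&-e^{-\frac\lambda\mu zx^0}\sin(z\lambda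 x^0)\otimes x^2+x^2\otimes e^{\frac\lambda\mu zx^0}\sin(z\lambda x^0),\\ \Delta(x^2)={}&e^{-\frac\lambda\mu zx^0}\cos(z\lambda x^0)\otimes x^2+x^2\otimes e^{\frac\lambda\mu zx^0}\cos(z\lambda x^0)\\&+e^{-\frac\lambda\mu zx^0}\sin(z\lambda x^0)\otimes x^1-x^1\otimes e^{\frac\lambda\mu zx^0}\sin(z\lambda x^0),\\ \Delta(X_1)={}&e^{-\mu zX_0}\cos(zX_0)\otimes X_1+X_1\otimes e^{\mu zX_0}\cos(zX_0)\\&-e^{-\mu zX_0}\sin(zX_0)\otimes X_2+X_2\otimes e^{\mu zX_0}\sin(zX_0),\\ \Delta(X_2)={}&e^{-\mu zX_0}\cos(zX_0)\otimes X_2+X_2\otimes e^{\mu zX_0}\cos(zX_0)\\&+e^{-\mu zX_0}\sin(zX_0)\otimes X_1-X_1\otimes e^{\mu zX_0}\sin(zX_0). \end{aligned}$$ The commutation rules are the undeformed brackets of $\mathfrak g$ and of $\mathfrak g^*$, $$[x^0,x^1]=\mu x^1-x^2,\quad [x^0,x^2]=x^1+\mu x^2,\quad [x^1,x^2]=0,$$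 $$[X_0,X_1]=-\tfrac\lambda\mu X_1+\lambda X_2,\quad [X_0,X_2]=-\lambda X_1-\tfrac\lambda\mu X_2,\quad [X_1,X_2]=0,$$ and the crossed relations $$[x^0,X_0]=0,\quad [x^0,X_1]=-\mu X_1-X_2,\quad [x^0,X_2]=X_1-\mu X_2,$$ $$[x^1,X_0]=-\tfrac\lambda\mu x^1-\lambda x^2,\quad [x^2,X_0]=\lambda x^1-\tfrac\lambda\mu x^2,$$ $$[x^1,X_1]=[x^2,X_2]=\frac{\sinh\!\big(z(\tfrac\lambda\mu x^0+\mu X_0)\big)}{z}\cos\!\big(z(\lambda x^0-X_0)\big),$$ $$[x^1,X_2]=-[x^2,X_1]=\frac{\sin\!\big(z(\lambda x^0-X_0)\big)}{z}\cosh\!\big(z(\tfrac\lambda\mu x^0+\mu X_0)\big).$$ These commutation rules define $A$: for every $z$-adically complete and separated $\mathbb R[[z]]$-algebra $B$ and all six elements of $B$ that satisfy them, there is exactly one $\mathbb R[[z]]$-algebra homomorphism $A\to B$ sending $x^0,x^1,x^2,X_0,X_1,X_2$ to these elements. -/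

import Mathlib

open scoped TensorProduct PowerSeries

noncomputable section

/-! ### Lie algebras and Lie bialgebras of dimension three given by structure tensors

A tensor `t : Fin 3 → Fin 3 → Fin 3 → ℝ` encodes a bracket by `[e_i, e_j] = ∑ k, t i j k e_k`. -/

/-- The bilinear bracket on `ℝ³` with structure constants `t i j k`. -/
def tensorBracket (t : Fin 3 → Fin 3 → Fin 3 → ℝ) (u v : Fin 3 → ℝ) : Fin 3 → ℝ :=
  fun k => ∑ i, ∑ j, t i j k * u i * v j

/-- The cobracket on `ℝ³` dual to the bracket with structure constants `t`:
`e_n ↦ ∑ l m, t l m n e_l ⊗ e_m`. -/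
def tensorCobracket (t : Fin 3 → Fin 3 → Fin 3 → ℝ) :
    (Fin 3 → ℝ) →ₗ[ℝ] (Fin 3 → ℝ) ⊗[ℝ] (Fin 3 → ℝ) :=
  ∑ n, ∑ l, ∑ m, t l m n •
    (LinearMap.proj n : (Fin 3 → ℝ) →ₗ[ℝ] ℝ).smulRight
      ((Pi.single l 1 : Fin 3 → ℝ) ⊗ₜ[ℝ] (Pi.single m 1 : Fin 3 → ℝ))

/-- `φ` is an isomorphism from the Lie bialgebra with bracket tensor `f` and cobracket tensor `c`
to the one with bracket tensor `f'` and cobracket tensor `c'`. -/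
structure IsLieBialgebraIso (f c f' c' : Fin 3 → Fin 3 → Fin 3 → ℝ)
    (φ : (Fin 3 → ℝ) ≃ₗ[ℝ] (Fin 3 → ℝ)) : Prop where
  map_bracket : ∀ u v, φ (tensorBracket f u v) = tensorBracket f' (φ u) (φ v)
  map_cobracket : ∀ u, TensorProduct.map φ.toLinearMap φ.toLinearMap (tensorCobracket c u) =
    tensorCobracket c' (φ u)

/-- Structure constants of `[e₀, e₁] = a e₁ - b e₂`, `[e₀, e₂] = b e₁ + a e₂`, `[e₁, e₂] = 0`. -/
def spiralTensor (a b : ℝ) : Fin 3 → Fin 3 → Fin 3 → ℝ :=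
  ![![![0, 0, 0], ![0, a, -b], ![0, b, a]],
    ![![0, -a, b], ![0, 0, 0], ![0, 0, 0]],
    ![![0, -b, -a], ![0, 0, 0], ![0, 0, 0]]]

/-- The real Lie algebra `𝔰₃(ρ)`: `[e₀, e₁] = ρ e₁ - e₂`, `[e₀, e₂] = e₁ + ρ e₂`,
`[e₁, e₂] = 0`. -/
def SThree (_ρ : ℝ) : Type := Fin 3 → ℝ

namespace SThree

variable (ρ : ℝ)

instance : AddCommGroup (SThree ρ) := inferInstanceAs (AddCommGroup (Fin 3 → ℝ))
instance : Module ℝ (SThree ρ) := inferInstanceAs (Module ℝ (Fin 3 → ℝ))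
instance : Bracket (SThree ρ) (SThree ρ) := ⟨tensorBracket (spiralTensor ρ 1)⟩

theorem bracket_def (u v : SThree ρ) : ⁅u, v⁆ = tensorBracket (spiralTensor ρ 1) u v := rfl

theorem add_ap (u v : SThree ρ) (i : Fin 3) : (u + v) i = u i + v i := rfl

theorem lie_zero' (u v : SThree ρ) : ⁅u, v⁆ 0 = 0 := by
  simp [bracket_def, tensorBracket, spiralTensor, Fin.sum_univ_three]

theorem lie_one' (u v : SThree ρ) :
    ⁅u, v⁆ 1 = ρ * (u 0 * v 1 - u 1 * v 0) + (u 0 * v 2 - u 2 * v 0) := by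
  simp [bracket_def, tensorBracket, spiralTensor, Fin.sum_univ_three]; ring

theorem lie_two' (u v : SThree ρ) :
    ⁅u, v⁆ 2 = -(u 0 * v 1 - u 1 * v 0) + ρ * (u 0 * v 2 - u 2 * v 0) := by
  simp [bracket_def, tensorBracket, spiralTensor, Fin.sum_univ_three]; ring

theorem ext_ap {u v : SThree ρ} (h₀ : u 0 = v 0) (h₁ : u 1 = v 1) (h₂ : u 2 = v 2) : u = v :=
  funext fun i => by fin_cases i <;> assumption

instance : LieRing (SThree ρ) where
  add_lie u v w := by
    apply ext_ap <;> simp only [lie_zero', lie_one', lie_two', add_ap] <;> ring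
  lie_add u v w := by
    apply ext_ap <;> simp only [lie_zero', lie_one', lie_two', add_ap] <;> ring
  lie_self u := by
    apply ext_ap <;> simp only [lie_zero', lie_one', lie_two'] <;> show _ = (0 : ℝ) <;> ring
  leibniz_lie u v w := by
    apply ext_ap <;> simp only [lie_zero', lie_one', lie_two', add_ap] <;> ring

instance : LieAlgebra ℝ (SThree ρ) where
  lie_smul t u v := by
    have h : ∀ (w : SThree ρ) (i : Fin 3), (t • w) i = t * w i := fun _ _ => rfl
    apply ext_ap <;> simp only [lie_zero', lie_one', lie_two', h] <;> ring

end SThree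

/-! ### The classical double -/

/-- Structure tensor `f` of `𝔤 = 𝔰₃(μ)`: `[xⁱ, xʲ] = ∑ k, f i j k xᵏ`. -/
def fTensor (mu : ℝˣ) : Fin 3 → Fin 3 → Fin 3 → ℝ := spiralTensor mu 1

/-- Structure tensor `c` of `𝔤*`: `[X_i, X_j] = ∑ k, c i j k X_k`, that is
`[X₀, X₁] = -(λ/μ) X₁ + λ X₂`, `[X₀, X₂] = -λ X₁ - (λ/μ) X₂`, `[X₁, X₂] = 0`.
Dually, it gives the cobracket `δ(xⁿ) = ∑ l m, c l m n xˡ ⊗ xᵐ` of `𝔤`. -/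
def cTensor (lam mu : ℝˣ) : Fin 3 → Fin 3 → Fin 3 → ℝ := spiralTensor (-(lam / mu : ℝ)) (-lam)

/-- The bracket of the double `𝔤 ⊕ 𝔤*`, for `𝔤` with bracket tensor `f` and cobracket tensor `c`:
the bilinear bracket with `[xⁱ, xʲ] = f i j k xᵏ`, `[X_i, X_j] = c i j k X_k` and
`[xⁱ, X_j] = c j k i xᵏ - f i k j X_k` (summed over `k`). -/
def doubleBracket (f c : Fin 3 → Fin 3 → Fin 3 → ℝ) (u v : (Fin 3 → ℝ) × (Fin 3 → ℝ)) :
    (Fin 3 → ℝ) × (Fin 3 → ℝ) :=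
  (fun k => tensorBracket f u.1 v.1 k + ∑ i, ∑ j, c j k i * (u.1 i * v.2 j - v.1 i * u.2 j),
   fun k => tensorBracket c u.2 v.2 k - ∑ i, ∑ j, f i k j * (u.1 i * v.2 j - v.1 i * u.2 j))

/-- The Drinfel'd double Lie algebra `D(𝔤) = 𝔤 ⊕ 𝔤*` of `𝔤 = 𝔰₃(μ)` with the cobracket given by
`cTensor lam mu`. -/
def S3Double (_lam _mu : ℝˣ) : Type := (Fin 3 → ℝ) × (Fin 3 → ℝ)

namespace S3Double

variable (lam mu : ℝˣ)

instance : AddCommGroup (S3Double lam mu) :=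
  inferInstanceAs (AddCommGroup ((Fin 3 → ℝ) × (Fin 3 → ℝ)))
instance : Module ℝ (S3Double lam mu) := inferInstanceAs (Module ℝ ((Fin 3 → ℝ) × (Fin 3 → ℝ)))
instance : Bracket (S3Double lam mu) (S3Double lam mu) :=
  ⟨doubleBracket (fTensor mu) (cTensor lam mu)⟩

theorem bracket_def (u v : S3Double lam mu) :
    ⁅u, v⁆ = doubleBracket (fTensor mu) (cTensor lam mu) u v := rfl

theorem fst_add_ap (u v : S3Double lam mu) (i : Fin 3) : (u + v).1 i = u.1 i + v.1 i := rfl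
theorem snd_add_ap (u v : S3Double lam mu) (i : Fin 3) : (u + v).2 i = u.2 i + v.2 i := rfl

theorem fst_lie_zero (u v : S3Double lam mu) : ⁅u, v⁆.1 0 =
    lam / mu * (u.1 1 * v.2 1 - v.1 1 * u.2 1) - lam * (u.1 2 * v.2 1 - v.1 2 * u.2 1) +
      lam * (u.1 1 * v.2 2 - v.1 1 * u.2 2) + lam / mu * (u.1 2 * v.2 2 - v.1 2 * u.2 2) := by
  simp [bracket_def, doubleBracket, tensorBracket, fTensor, cTensor, spiralTensor,
    Fin.sum_univ_three]
  ring

theorem fst_lie_one (u v : S3Double lam mu) : ⁅u, v⁆.1 1 =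
    mu * (u.1 0 * v.1 1 - u.1 1 * v.1 0) + (u.1 0 * v.1 2 - u.1 2 * v.1 0) -
      lam / mu * (u.1 1 * v.2 0 - v.1 1 * u.2 0) + lam * (u.1 2 * v.2 0 - v.1 2 * u.2 0) := by
  simp [bracket_def, doubleBracket, tensorBracket, fTensor, cTensor, spiralTensor,
    Fin.sum_univ_three]
  ring

theorem fst_lie_two (u v : S3Double lam mu) : ⁅u, v⁆.1 2 =
    -(u.1 0 * v.1 1 - u.1 1 * v.1 0) + mu * (u.1 0 * v.1 2 - u.1 2 * v.1 0) -
      lam * (u.1 1 * v.2 0 - v.1 1 * u.2 0) - lam / mu * (u.1 2 * v.2 0 - v.1 2 * u.2 0) := by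
  simp [bracket_def, doubleBracket, tensorBracket, fTensor, cTensor, spiralTensor,
    Fin.sum_univ_three]
  ring

theorem snd_lie_zero (u v : S3Double lam mu) : ⁅u, v⁆.2 0 =
    mu * (u.1 1 * v.2 1 - v.1 1 * u.2 1) - (u.1 1 * v.2 2 - v.1 1 * u.2 2) +
      (u.1 2 * v.2 1 - v.1 2 * u.2 1) + mu * (u.1 2 * v.2 2 - v.1 2 * u.2 2) := by
  simp [bracket_def, doubleBracket, tensorBracket, fTensor, cTensor, spiralTensor,
    Fin.sum_univ_three]
  ring

theorem snd_lie_one (u v : S3Double lam mu) : ⁅u, v⁆.2 1 =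
    -(lam / mu) * (u.2 0 * v.2 1 - u.2 1 * v.2 0) - lam * (u.2 0 * v.2 2 - u.2 2 * v.2 0) -
      mu * (u.1 0 * v.2 1 - v.1 0 * u.2 1) + (u.1 0 * v.2 2 - v.1 0 * u.2 2) := by
  simp [bracket_def, doubleBracket, tensorBracket, fTensor, cTensor, spiralTensor,
    Fin.sum_univ_three]
  ring

theorem snd_lie_two (u v : S3Double lam mu) : ⁅u, v⁆.2 2 =
    lam * (u.2 0 * v.2 1 - u.2 1 * v.2 0) - lam / mu * (u.2 0 * v.2 2 - u.2 2 * v.2 0) -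
      (u.1 0 * v.2 1 - v.1 0 * u.2 1) - mu * (u.1 0 * v.2 2 - v.1 0 * u.2 2) := by
  simp [bracket_def, doubleBracket, tensorBracket, fTensor, cTensor, spiralTensor,
    Fin.sum_univ_three]
  ring

theorem ext_ap {u v : S3Double lam mu} (h₀ : u.1 0 = v.1 0) (h₁ : u.1 1 = v.1 1)
    (h₂ : u.1 2 = v.1 2) (k₀ : u.2 0 = v.2 0) (k₁ : u.2 1 = v.2 1) (k₂ : u.2 2 = v.2 2) : u = v :=
  Prod.ext (funext fun i => by fin_cases i <;> assumption)
    (funext fun i => by fin_cases i <;> assumption)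

instance : LieRing (S3Double lam mu) where
  add_lie u v w := by
    apply ext_ap <;> simp only [fst_lie_zero, fst_lie_one, fst_lie_two, snd_lie_zero, snd_lie_one,
      snd_lie_two,
      fst_add_ap, snd_add_ap] <;> ring
  lie_add u v w := by
    apply ext_ap <;> simp only [fst_lie_zero, fst_lie_one, fst_lie_two, snd_lie_zero, snd_lie_one,
      snd_lie_two,
      fst_add_ap, snd_add_ap] <;> ring
  lie_self u := by
    apply ext_ap <;> simp only [fst_lie_zero, fst_lie_one, fst_lie_two, snd_lie_zero, snd_lie_one,
      snd_lie_two] <;>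
      show _ = (0 : ℝ) <;> ring
  leibniz_lie u v w := by
    have hmu : (mu : ℝ) ≠ 0 := mu.ne_zero
    apply ext_ap <;> simp only [fst_lie_zero, fst_lie_one, fst_lie_two, snd_lie_zero, snd_lie_one,
      snd_lie_two,
      fst_add_ap, snd_add_ap] <;> field_simp <;> ring

instance : LieAlgebra ℝ (S3Double lam mu) where
  lie_smul t u v := by
    have h₁ : ∀ (w : S3Double lam mu) (i : Fin 3), (t • w).1 i = t * w.1 i := fun _ _ => rfl
    have h₂ : ∀ (w : S3Double lam mu) (i : Fin 3), (t • w).2 i = t * w.2 i := fun _ _ => rfl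
    apply ext_ap <;> simp only [fst_lie_zero, fst_lie_one, fst_lie_two, snd_lie_zero, snd_lie_one,
      snd_lie_two,
      h₁, h₂] <;> ring

/-- The basis elements `xⁱ` of `𝔤 ⊆ D(𝔤)`. -/
def x (i : Fin 3) : S3Double lam mu := (Pi.single i 1, 0)

/-- The dual basis elements `X_i` of `𝔤* ⊆ D(𝔤)`. -/
def X (i : Fin 3) : S3Double lam mu := (0, Pi.single i 1)

/-- The canonical classical `r`-matrix `r = ∑ xⁱ ⊗ X_i` of the double. -/
def rMatrix : S3Double lam mu ⊗[ℝ] S3Double lam mu := ∑ i, x lam mu i ⊗ₜ[ℝ] X lam mu i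

/-- The canonical cobracket `δ_DD(Y) = [Y ⊗ 1 + 1 ⊗ Y, r]` of the double. -/
def cobracket : S3Double lam mu →ₗ[ℝ] S3Double lam mu ⊗[ℝ] S3Double lam mu where
  toFun Y := ⁅Y, rMatrix lam mu⁆
  map_add' Y Z := add_lie Y Z _
  map_smul' t Y := smul_lie t Y _

end S3Double

/-! ### Algebras over `ℝ⟦z⟧`, completed tensor squares, and topological Hopf algebras

The deformation parameter `z` is the variable `PowerSeries.X` of `ℝ⟦X⟧`. -/

/-- `a` is the `z`-adic limit of the partial sums of `∑ k, zᵏ cₖ`. -/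
def HasZSum {A : Type*} [Ring A] [Algebra ℝ⟦X⟧ A] (c : ℕ → A) (a : A) : Prop :=
  ∀ n : ℕ, ∃ b : A, a = ∑ k ∈ Finset.range n, (PowerSeries.X : ℝ⟦X⟧) ^ k • c k +
    (PowerSeries.X : ℝ⟦X⟧) ^ n • b

open Classical in
/-- The `z`-adic sum `∑ k, zᵏ cₖ` (which exists and is unique in every `z`-adically complete
algebra, see `hasZSum_zSum` and `HasZSum.unique`). -/
def zSum {A : Type*} [Ring A] [Algebra ℝ⟦X⟧ A] (c : ℕ → A) : A :=
  if h : ∃ a, HasZSum c a then h.choose else 0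

/-- `φ(z a) = ∑ k, φₖ zᵏ aᵏ` for a power series `φ` with real coefficients. -/
def zEval {A : Type*} [Ring A] [Algebra ℝ⟦X⟧ A] [Algebra ℝ A] (φ : ℝ⟦X⟧) (a : A) : A :=
  zSum fun k => PowerSeries.coeff k φ • a ^ k

/-- `(φ(z a) - φ(0)) / z = ∑ k, φₖ₊₁ zᵏ aᵏ⁺¹` for a power series `φ` with real coefficients. -/
def zEvalDiv {A : Type*} [Ring A] [Algebra ℝ⟦X⟧ A] [Algebra ℝ A] (φ : ℝ⟦X⟧) (a : A) : A :=
  zSum fun k => PowerSeries.coeff (k + 1) φ • a ^ (k + 1)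

/-- Power series of `sinh`. -/
def sinhSeries : ℝ⟦X⟧ := PowerSeries.mk fun n => if Even n then 0 else 1 / (n.factorial : ℝ)

/-- Power series of `cosh`. -/
def coshSeries : ℝ⟦X⟧ := PowerSeries.mk fun n => if Even n then 1 / (n.factorial : ℝ) else 0

/-- The two-sided ideal `zⁿ A`. -/
def zIdeal (A : Type*) [Ring A] [Algebra ℝ⟦X⟧ A] (n : ℕ) : Ideal A where
  carrier := {a | ∃ b : A, a = (PowerSeries.X : ℝ⟦X⟧) ^ n • b}
  add_mem' := by
    rintro _ _ ⟨b, rfl⟩ ⟨c, rfl⟩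
    exact ⟨b + c, (smul_add _ _ _).symm⟩
  zero_mem' := ⟨0, (smul_zero _).symm⟩
  smul_mem' := by
    rintro c _ ⟨b, rfl⟩
    exact ⟨c * b, by rw [smul_eq_mul, mul_smul_comm]⟩

theorem mem_zIdeal {A : Type*} [Ring A] [Algebra ℝ⟦X⟧ A] {n : ℕ} {a : A} :
    a ∈ zIdeal A n ↔ ∃ b : A, a = (PowerSeries.X : ℝ⟦X⟧) ^ n • b := Iff.rfl

instance (A : Type*) [Ring A] [Algebra ℝ⟦X⟧ A] (n : ℕ) : (zIdeal A n).IsTwoSided where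
  mul_mem_of_left := by
    rintro _ c ⟨b, rfl⟩
    exact ⟨b * c, by rw [smul_mul_assoc]⟩

theorem zIdeal_succ_le (A : Type*) [Ring A] [Algebra ℝ⟦X⟧ A] (n : ℕ) :
    zIdeal A (n + 1) ≤ zIdeal A n := by
  rintro _ ⟨b, rfl⟩
  exact ⟨(PowerSeries.X : ℝ⟦X⟧) • b, by rw [smul_smul, pow_succ]⟩

theorem mem_pow_smul_top {A : Type*} [Ring A] [Algebra ℝ⟦X⟧ A] {n : ℕ} {a : A} :
    a ∈ ((Ideal.span {(PowerSeries.X : ℝ⟦X⟧)}) ^ n • ⊤ : Submodule ℝ⟦X⟧ A) ↔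
      ∃ b : A, a = (PowerSeries.X : ℝ⟦X⟧) ^ n • b := by
  rw [Ideal.span_singleton_pow, Submodule.ideal_span_singleton_smul,
    Submodule.mem_smul_pointwise_iff_exists]
  constructor
  · rintro ⟨b, -, rfl⟩
    exact ⟨b, rfl⟩
  · rintro ⟨b, rfl⟩
    exact ⟨b, trivial, rfl⟩

theorem HasZSum.unique {A : Type*} [Ring A] [Algebra ℝ⟦X⟧ A]
    [IsHausdorff (Ideal.span {(PowerSeries.X : ℝ⟦X⟧)}) A] {c : ℕ → A} {a a' : A}
    (h : HasZSum c a) (h' : HasZSum c a') : a = a' := by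
  rw [← sub_eq_zero]
  refine IsHausdorff.haus (I := Ideal.span {(PowerSeries.X : ℝ⟦X⟧)}) inferInstance _ fun n => ?_
  rw [SModEq.zero, mem_pow_smul_top]
  obtain ⟨b, hb⟩ := h n
  obtain ⟨b', hb'⟩ := h' n
  exact ⟨b - b', by rw [hb, hb', smul_sub]; abel⟩

theorem hasZSum_zSum {A : Type*} [Ring A] [Algebra ℝ⟦X⟧ A]
    [IsPrecomplete (Ideal.span {(PowerSeries.X : ℝ⟦X⟧)}) A] (c : ℕ → A) :
    HasZSum c (zSum c) := by
  have hex : ∃ a, HasZSum c a := by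
    obtain ⟨L, hL⟩ := IsPrecomplete.prec (I := Ideal.span {(PowerSeries.X : ℝ⟦X⟧)}) inferInstance
      (f := fun n => ∑ k ∈ Finset.range n, (PowerSeries.X : ℝ⟦X⟧) ^ k • c k) (by
        intro m n hmn
        rw [SModEq.sub_mem, mem_pow_smul_top]
        obtain ⟨d, rfl⟩ := Nat.exists_eq_add_of_le hmn
        refine ⟨-∑ k ∈ Finset.range d, (PowerSeries.X : ℝ⟦X⟧) ^ k • c (m + k), ?_⟩
        rw [Finset.sum_range_add, smul_neg, Finset.smul_sum]
        simp only [smul_smul, pow_add]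
        abel)
    refine ⟨L, fun n => ?_⟩
    have h := hL n
    rw [SModEq.sub_mem, mem_pow_smul_top] at h
    obtain ⟨b, hb⟩ := h
    refine ⟨-b, ?_⟩
    rw [smul_neg, ← hb]
    abel
  rw [zSum, dif_pos hex]
  exact hex.choose_spec

/-- The truncation `A / zⁿ A`. -/
abbrev ZQuot (A : Type*) [Ring A] [Algebra ℝ⟦X⟧ A] (n : ℕ) : Type _ := A ⧸ zIdeal A n

/-- The projection `A → A / zⁿ A`. -/
abbrev ZQuot.mk {A : Type*} [Ring A] [Algebra ℝ⟦X⟧ A] (n : ℕ) : A →ₐ[ℝ⟦X⟧] ZQuot A n :=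
  Ideal.Quotient.mkₐ ℝ⟦X⟧ (zIdeal A n)

/-- The transition map `A / zⁿ⁺¹ A → A / zⁿ A`. -/
abbrev ZQuot.trans (A : Type*) [Ring A] [Algebra ℝ⟦X⟧ A] (n : ℕ) :
    ZQuot A (n + 1) →ₐ[ℝ⟦X⟧] ZQuot A n :=
  Ideal.Quotient.factorₐ ℝ⟦X⟧ (zIdeal_succ_le A n)

/-- The map `A / zⁿ A → B / zⁿ B` induced by an algebra homomorphism `A → B`. -/
def ZQuot.map {A B : Type*} [Ring A] [Algebra ℝ⟦X⟧ A] [Ring B] [Algebra ℝ⟦X⟧ B]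
    (φ : A →ₐ[ℝ⟦X⟧] B) (n : ℕ) : ZQuot A n →ₐ[ℝ⟦X⟧] ZQuot B n :=
  Ideal.Quotient.liftₐ (zIdeal A n) ((ZQuot.mk n).comp φ) (by
    rintro _ ⟨b, rfl⟩
    rw [map_smul]
    exact Ideal.Quotient.eq_zero_iff_mem.2 ⟨φ b, rfl⟩)

/-- The linear map `A / zⁿ A → A / zⁿ A` induced by an `ℝ⟦z⟧`-linear map `A → A`. -/
def ZQuot.mapLinear {A : Type*} [Ring A] [Algebra ℝ⟦X⟧ A] (S : A →ₗ[ℝ⟦X⟧] A) (n : ℕ) :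
    ZQuot A n →ₗ[ℝ⟦X⟧] ZQuot A n where
  toFun := QuotientAddGroup.map _ _ S.toAddMonoidHom (by
    rintro _ ⟨b, rfl⟩
    exact ⟨S b, by simp⟩)
  map_add' := map_add _
  map_smul' t a := by
    obtain ⟨a, rfl⟩ := Ideal.Quotient.mk_surjective a
    exact congrArg (Ideal.Quotient.mk (zIdeal A n)) (S.map_smul t a)

theorem ZQuot.mapLinear_mk {A : Type*} [Ring A] [Algebra ℝ⟦X⟧ A] (S : A →ₗ[ℝ⟦X⟧] A) (n : ℕ)
    (a : A) : ZQuot.mapLinear S n (ZQuot.mk n a) = ZQuot.mk n (S a) := rfl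

/-- The `z`-adically completed tensor square `A ⊗̂ A = lim (A / zⁿ A) ⊗ (A / zⁿ A)`, the algebra of
compatible sequences `(tₙ)` with `tₙ ∈ (A / zⁿ A) ⊗ (A / zⁿ A)`. -/
def CTensor (A : Type*) [Ring A] [Algebra ℝ⟦X⟧ A] :
    Subalgebra ℝ⟦X⟧ (∀ n : ℕ, ZQuot A n ⊗[ℝ⟦X⟧] ZQuot A n) where
  carrier := {t | ∀ n, Algebra.TensorProduct.map (ZQuot.trans A n) (ZQuot.trans A n) (t (n + 1)) =
    t n}
  mul_mem' := fun ha hb n => by rw [Pi.mul_apply, map_mul, ha n, hb n, Pi.mul_apply]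
  add_mem' := fun ha hb n => by rw [Pi.add_apply, map_add, ha n, hb n, Pi.add_apply]
  algebraMap_mem' := fun r n => by
    rw [Pi.algebraMap_apply, Pi.algebraMap_apply, AlgHom.commutes]

/-- The element `a ⊗ b` of `A ⊗̂ A`. -/
def CTensor.tmul {A : Type*} [Ring A] [Algebra ℝ⟦X⟧ A] (a b : A) : CTensor A :=
  ⟨fun n => ZQuot.mk n a ⊗ₜ[ℝ⟦X⟧] ZQuot.mk n b, fun _ => by
    rw [Algebra.TensorProduct.map_tmul]; rfl⟩

infix:100 " ⊗ᶻ " => CTensor.tmul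

/-- The map `A / zⁿ A → (A / zⁿ A) ⊗ (A / zⁿ A)` induced by an algebra homomorphism `A → A ⊗̂ A`. -/
def CTensor.level {A : Type*} [Ring A] [Algebra ℝ⟦X⟧ A] (Δ : A →ₐ[ℝ⟦X⟧] CTensor A) (n : ℕ) :
    ZQuot A n →ₐ[ℝ⟦X⟧] ZQuot A n ⊗[ℝ⟦X⟧] ZQuot A n :=
  Ideal.Quotient.liftₐ (zIdeal A n)
    (((Pi.evalAlgHom ℝ⟦X⟧ (fun n : ℕ => ZQuot A n ⊗[ℝ⟦X⟧] ZQuot A n) n).comp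
      (CTensor A).val).comp Δ) (by
    rintro _ ⟨b, rfl⟩
    rw [map_smul]
    generalize (((Pi.evalAlgHom ℝ⟦X⟧ (fun n : ℕ => ZQuot A n ⊗[ℝ⟦X⟧] ZQuot A n) n).comp
      (CTensor A).val).comp Δ) b = t
    induction t with
    | zero => rw [smul_zero]
    | add s t hs ht => rw [smul_add, hs, ht, add_zero]
    | tmul u v =>
      obtain ⟨u, rfl⟩ := Ideal.Quotient.mk_surjective u
      have h : (PowerSeries.X : ℝ⟦X⟧) ^ n • Ideal.Quotient.mk (zIdeal A n) u = 0 :=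
        Ideal.Quotient.eq_zero_iff_mem.2 ⟨u, rfl⟩
      rw [TensorProduct.smul_tmul', h, TensorProduct.zero_tmul])

theorem CTensor.level_mk {A : Type*} [Ring A] [Algebra ℝ⟦X⟧ A] (Δ : A →ₐ[ℝ⟦X⟧] CTensor A) (n : ℕ)
    (a : A) : CTensor.level Δ n (ZQuot.mk n a) = (Δ a).1 n := rfl

/-- A topological (`z`-adic) Hopf algebra structure on an `ℝ⟦z⟧`-algebra `A`: a coproduct
`A → A ⊗̂ A`, a counit and an antipode, subject to the Hopf algebra axioms, which are expressed
modulo `zⁿ` for all `n`. (A counit `A → ℝ⟦z⟧` induces `A / zⁿ A → ℝ⟦z⟧ / zⁿ`; the identification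
`A / zⁿ A ≅ (ℝ⟦z⟧ / zⁿ) ⊗ (A / zⁿ A)` is `a ↦ 1 ⊗ a`.) -/
structure ZHopf (A : Type*) [Ring A] [Algebra ℝ⟦X⟧ A] where
  /-- The coproduct. -/
  comul : A →ₐ[ℝ⟦X⟧] CTensor A
  /-- The counit. -/
  counit : A →ₐ[ℝ⟦X⟧] ℝ⟦X⟧
  /-- The antipode. -/
  antipode : A →ₗ[ℝ⟦X⟧] A
  coassoc : ∀ (n : ℕ) (a : A),
    Algebra.TensorProduct.assoc ℝ⟦X⟧ ℝ⟦X⟧ ℝ⟦X⟧ (ZQuot A n) (ZQuot A n) (ZQuot A n)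
      (Algebra.TensorProduct.map (CTensor.level comul n) (AlgHom.id ℝ⟦X⟧ (ZQuot A n))
        ((comul a).1 n)) =
    Algebra.TensorProduct.map (AlgHom.id ℝ⟦X⟧ (ZQuot A n)) (CTensor.level comul n)
      ((comul a).1 n)
  counit_left : ∀ (n : ℕ) (a : A),
    Algebra.TensorProduct.map (ZQuot.map counit n) (AlgHom.id ℝ⟦X⟧ (ZQuot A n)) ((comul a).1 n) =
      1 ⊗ₜ[ℝ⟦X⟧] ZQuot.mk n a
  counit_right : ∀ (n : ℕ) (a : A),
    Algebra.TensorProduct.map (AlgHom.id ℝ⟦X⟧ (ZQuot A n)) (ZQuot.map counit n) ((comul a).1 n) =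
      ZQuot.mk n a ⊗ₜ[ℝ⟦X⟧] 1
  antipode_left : ∀ (n : ℕ) (a : A),
    LinearMap.mul' ℝ⟦X⟧ (ZQuot A n)
      (TensorProduct.map (ZQuot.mapLinear antipode n) LinearMap.id ((comul a).1 n)) =
      algebraMap ℝ⟦X⟧ (ZQuot A n) (counit a)
  antipode_right : ∀ (n : ℕ) (a : A),
    LinearMap.mul' ℝ⟦X⟧ (ZQuot A n)
      (TensorProduct.map LinearMap.id (ZQuot.mapLinear antipode n) ((comul a).1 n)) =
      algebraMap ℝ⟦X⟧ (ZQuot A n) (counit a)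

/-- The map `L ⊗ L → A ⊗̂ A` induced by a real linear map `γ : L → A`. -/
def CTensor.lift {L : Type*} [AddCommGroup L] [Module ℝ L] {A : Type*} [Ring A] [Algebra ℝ⟦X⟧ A]
    [Algebra ℝ A] [IsScalarTower ℝ ℝ⟦X⟧ A] (γ : L →ₗ[ℝ] A) : L ⊗[ℝ] L →+ CTensor A :=
  TensorProduct.liftAddHom
    { toFun := fun u =>
        { toFun := fun v => γ u ⊗ᶻ γ v
          map_zero' := Subtype.ext (funext fun n => by simp [CTensor.tmul])
          map_add' := fun v w => Subtype.ext (funext fun n => by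
            simp [CTensor.tmul, TensorProduct.tmul_add]) }
      map_zero' := AddMonoidHom.ext fun v => Subtype.ext (funext fun n => by simp [CTensor.tmul])
      map_add' := fun u v => AddMonoidHom.ext fun w => Subtype.ext (funext fun n => by
        simp [CTensor.tmul, TensorProduct.add_tmul]) }
    (fun t u v => Subtype.ext (funext fun n => by
      have h : ∀ a : A, t • a = (algebraMap ℝ ℝ⟦X⟧ t) • a := fun a =>
        (algebraMap_smul ℝ⟦X⟧ t a).symm
      show ZQuot.mk n (γ (t • u)) ⊗ₜ[ℝ⟦X⟧] ZQuot.mk n (γ v) =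
        ZQuot.mk n (γ u) ⊗ₜ[ℝ⟦X⟧] ZQuot.mk n (γ (t • v))
      rw [γ.map_smul, γ.map_smul, h, h, map_smul, map_smul, TensorProduct.smul_tmul]))

/-- `A`, with its topological Hopf algebra structure `H`, is a Hopf algebra quantization of the
Lie bialgebra `(L, δ)` in which the elements of `L` are lifted by the linear map `γ : L → A`:
`A` is a topologically free `ℝ⟦z⟧`-algebra, `A / z A` is the universal enveloping algebra of `L`
with `γ Y` lifting `Y`, and `Δ(Y) = 1 ⊗ Y + Y ⊗ 1 + z δ(Y) + O(z²)` for `Y ∈ L`. -/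
structure IsHopfQuantization {L : Type*} [LieRing L] [LieAlgebra ℝ L] (δ : L →ₗ[ℝ] L ⊗[ℝ] L)
    {A : Type*} [Ring A] [Algebra ℝ⟦X⟧ A] [Algebra ℝ A] [IsScalarTower ℝ ℝ⟦X⟧ A]
    (H : ZHopf A) (γ : L →ₗ[ℝ] A) : Prop where
  complete : IsAdicComplete (Ideal.span {(PowerSeries.X : ℝ⟦X⟧)}) A
  torsionFree : ∀ a : A, (PowerSeries.X : ℝ⟦X⟧) • a = 0 → a = 0
  classicalLimit : ∃ π : A →ₐ[ℝ] UniversalEnvelopingAlgebra ℝ L, Function.Surjective π ∧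
    (∀ a, π a = 0 ↔ ∃ b : A, a = (PowerSeries.X : ℝ⟦X⟧) • b) ∧
    ∀ Y, π (γ Y) = UniversalEnvelopingAlgebra.ι ℝ Y
  firstOrder : ∀ Y, ∃ t : CTensor A, H.comul (γ Y) = 1 ⊗ᶻ γ Y + γ Y ⊗ᶻ 1 +
    (PowerSeries.X : ℝ⟦X⟧) • CTensor.lift γ (δ Y) + (PowerSeries.X : ℝ⟦X⟧) ^ 2 • t

/-! ### The quantum double -/

/-- The commutation rules of the quantum `(𝔰₃(μ), 𝔰₃(1/μ))` double, for elements `x⁰, x¹, x²` and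
`X₀, X₁, X₂` of an `ℝ⟦z⟧`-algebra. -/
structure QuantumDoubleRelations (lam mu : ℝˣ) {A : Type*} [Ring A] [Algebra ℝ⟦X⟧ A] [Algebra ℝ A]
    (x X : Fin 3 → A) : Prop where
  x0_x1 : ⁅x 0, x 1⁆ = (mu : ℝ) • x 1 - x 2
  x0_x2 : ⁅x 0, x 2⁆ = x 1 + (mu : ℝ) • x 2
  x1_x2 : ⁅x 1, x 2⁆ = 0
  X0_X1 : ⁅X 0, X 1⁆ = -(lam / mu : ℝ) • X 1 + (lam : ℝ) • X 2
  X0_X2 : ⁅X 0, X 2⁆ = -(lam : ℝ) • X 1 - (lam / mu : ℝ) • X 2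
  X1_X2 : ⁅X 1, X 2⁆ = 0
  x0_X0 : ⁅x 0, X 0⁆ = 0
  x0_X1 : ⁅x 0, X 1⁆ = -(mu : ℝ) • X 1 - X 2
  x0_X2 : ⁅x 0, X 2⁆ = X 1 - (mu : ℝ) • X 2
  x1_X0 : ⁅x 1, X 0⁆ = -(lam / mu : ℝ) • x 1 - (lam : ℝ) • x 2
  x2_X0 : ⁅x 2, X 0⁆ = (lam : ℝ) • x 1 - (lam / mu : ℝ) • x 2
  x1_X1 : ⁅x 1, X 1⁆ = zEvalDiv sinhSeries ((lam / mu : ℝ) • x 0 + (mu : ℝ) • X 0) *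
    zEval (PowerSeries.cos ℝ) ((lam : ℝ) • x 0 - X 0)
  x1_X2 : ⁅x 1, X 2⁆ = zEvalDiv (PowerSeries.sin ℝ) ((lam : ℝ) • x 0 - X 0) *
    zEval coshSeries ((lam / mu : ℝ) • x 0 + (mu : ℝ) • X 0)
  x2_X1 : ⁅x 2, X 1⁆ = -(zEvalDiv (PowerSeries.sin ℝ) ((lam : ℝ) • x 0 - X 0) *
    zEval coshSeries ((lam / mu : ℝ) • x 0 + (mu : ℝ) • X 0))
  x2_X2 : ⁅x 2, X 2⁆ = zEvalDiv sinhSeries ((lam / mu : ℝ) • x 0 + (mu : ℝ) • X 0) *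
    zEval (PowerSeries.cos ℝ) ((lam : ℝ) • x 0 - X 0)

/-- The coproducts of the quantum `(𝔰₃(μ), 𝔰₃(1/μ))` double. -/
structure QuantumDoubleCoproducts (lam mu : ℝˣ) {A : Type*} [Ring A] [Algebra ℝ⟦X⟧ A] [Algebra ℝ A]
    (Δ : A →ₐ[ℝ⟦X⟧] CTensor A) (x X : Fin 3 → A) : Prop where
  comul_x0 : Δ (x 0) = 1 ⊗ᶻ x 0 + x 0 ⊗ᶻ 1
  comul_x1 : Δ (x 1) =
    (zEval (PowerSeries.exp ℝ) (-(lam / mu : ℝ) • x 0) *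
      zEval (PowerSeries.cos ℝ) ((lam : ℝ) • x 0)) ⊗ᶻ x 1 +
    x 1 ⊗ᶻ (zEval (PowerSeries.exp ℝ) ((lam / mu : ℝ) • x 0) *
      zEval (PowerSeries.cos ℝ) ((lam : ℝ) • x 0)) -
    (zEval (PowerSeries.exp ℝ) (-(lam / mu : ℝ) • x 0) *
      zEval (PowerSeries.sin ℝ) ((lam : ℝ) • x 0)) ⊗ᶻ x 2 +
    x 2 ⊗ᶻ (zEval (PowerSeries.exp ℝ) ((lam / mu : ℝ) • x 0) *
      zEval (PowerSeries.sin ℝ) ((lam : ℝ) • x 0))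
  comul_x2 : Δ (x 2) =
    (zEval (PowerSeries.exp ℝ) (-(lam / mu : ℝ) • x 0) *
      zEval (PowerSeries.cos ℝ) ((lam : ℝ) • x 0)) ⊗ᶻ x 2 +
    x 2 ⊗ᶻ (zEval (PowerSeries.exp ℝ) ((lam / mu : ℝ) • x 0) *
      zEval (PowerSeries.cos ℝ) ((lam : ℝ) • x 0)) +
    (zEval (PowerSeries.exp ℝ) (-(lam / mu : ℝ) • x 0) *
      zEval (PowerSeries.sin ℝ) ((lam : ℝ) • x 0)) ⊗ᶻ x 1 -
    x 1 ⊗ᶻ (zEval (PowerSeries.exp ℝ) ((lam / mu : ℝ) • x 0) *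
      zEval (PowerSeries.sin ℝ) ((lam : ℝ) • x 0))
  comul_X0 : Δ (X 0) = 1 ⊗ᶻ X 0 + X 0 ⊗ᶻ 1
  comul_X1 : Δ (X 1) =
    (zEval (PowerSeries.exp ℝ) (-(mu : ℝ) • X 0) * zEval (PowerSeries.cos ℝ) (X 0)) ⊗ᶻ X 1 +
    X 1 ⊗ᶻ (zEval (PowerSeries.exp ℝ) ((mu : ℝ) • X 0) * zEval (PowerSeries.cos ℝ) (X 0)) -
    (zEval (PowerSeries.exp ℝ) (-(mu : ℝ) • X 0) * zEval (PowerSeries.sin ℝ) (X 0)) ⊗ᶻ X 2 +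
    X 2 ⊗ᶻ (zEval (PowerSeries.exp ℝ) ((mu : ℝ) • X 0) * zEval (PowerSeries.sin ℝ) (X 0))
  comul_X2 : Δ (X 2) =
    (zEval (PowerSeries.exp ℝ) (-(mu : ℝ) • X 0) * zEval (PowerSeries.cos ℝ) (X 0)) ⊗ᶻ X 2 +
    X 2 ⊗ᶻ (zEval (PowerSeries.exp ℝ) ((mu : ℝ) • X 0) * zEval (PowerSeries.cos ℝ) (X 0)) +
    (zEval (PowerSeries.exp ℝ) (-(mu : ℝ) • X 0) * zEval (PowerSeries.sin ℝ) (X 0)) ⊗ᶻ X 1 -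
    X 1 ⊗ᶻ (zEval (PowerSeries.exp ℝ) ((mu : ℝ) • X 0) * zEval (PowerSeries.sin ℝ) (X 0))

end

noncomputable section

/-! ### Evaluation of power series with coefficients in a complete algebra -/

section ZAdic

variable {B B' : Type*} [Ring B] [Algebra ℝ⟦X⟧ B] [Ring B'] [Algebra ℝ⟦X⟧ B']

local notation "𝔷" => (Ideal.span {(PowerSeries.X : ℝ⟦X⟧)})
local notation "z" => (PowerSeries.X : ℝ⟦X⟧)

/-! Put u = x¹ + i x², v = X₁ + i X₂, and let a = λ/μ − iλ and b = μ + i be the weights of u under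
X₀ and x⁰. In complexified form the relations say that u, v, ū, v̄ are weight vectors, that u
commutes with ū and v, that v commutes with v̄, and that [u, v̄] = 2H classically and 2 sinh(zH)/z
after deformation, where H = a x⁰ + b X₀. The trigonometric and hyperbolic right-hand sides are the
real and imaginary parts of this single sinh. Since a b̄ + ā b = 0, H has weight zero on ū and v, so
the complexified double splits into two commuting, conjugate copies of sl₂, and each is deformed by
itself.

The algebra A is U(D)⟦z⟧ with its usual product; only the generator u changes. Let κ = ab, y = (H +
κ)², and let w = 2κ v̄u + y be the Casimir element of the half (u, v̄). Then u is replaced by u g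
with g = (κz / sinh κz) · 2(cosh z√w − cosh z√y) / ((w − y) z²). Moving u past g turns H + κ into H
− κ, the terms cosh z√w cancel in [u g, v̄], and cosh z(H + κ) − cosh z(H − κ) is a multiple of sinh
zH (`lie_deform`). The factor g commutes with the other half (`CxRelations.deform`) and is 1 modulo
z, so completeness, torsion-freeness and the classical limit hold by construction.

That the relations define A (`eval_eq_zero`) follows by comparison with an arbitrary solution in B.
The joint image of the free algebra in A × B satisfies the classical relations modulo z, so its
reduction is governed by U(D). An element of the free algebra that dies in A can therefore be
divided by z simultaneously on both sides; A has no z-torsion, so this can be repeated, and B is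
separated.

The Hopf structure is obtained from this universal property. The proposed coproducts have the form
e^{−zcy} ⊗ w + w ⊗ e^{zcy}; the cross terms in their commutators cancel by matching weights
(`comul_bracket`), and the remaining terms combine by sinh(p + q) = e^{−p} sinh q + sinh p e^{q}
(`fsdiv_add`). Coproducts are built on the truncations modulo zⁿ and glued by uniqueness. The
antipode is the anti-automorphism that changes all signs of generators, followed by conjugation with
the exponential of a real Cartan element. The classical claims are settled by explicit linear maps.
-/

theorem eq_zero_of_forall_zpow [IsHausdorff 𝔷 B] {a : B}
    (h : ∀ n : ℕ, ∃ b : B, a = z ^ n • b) : a = 0 :=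
  IsHausdorff.haus (I := 𝔷) inferInstance _ fun n => by
    rw [SModEq.zero, mem_pow_smul_top]; exact h n

/-- A Cauchy sequence is a telescoping sum whose increments are multiples of zⁿ, so convergence of
all z-adic sums gives convergence of all Cauchy sequences. -/
theorem isAdicComplete_of_hasZSum (h₁ : ∀ a : B, (∀ n : ℕ, ∃ b : B, a = z ^ n • b) → a = 0)
    (h₂ : ∀ c : ℕ → B, ∃ a, HasZSum c a) : IsAdicComplete 𝔷 B where
  haus' a ha := h₁ a fun n => by
    have := ha n
    rwa [SModEq.zero, mem_pow_smul_top] at this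
  prec' f hf := by
    have h : ∀ n, ∃ b : B, f (n + 1) - f n = z ^ n • b := fun n => by
      have := hf (Nat.le_succ n)
      rw [SModEq.sub_mem, mem_pow_smul_top] at this
      obtain ⟨b, hb⟩ := this
      exact ⟨-b, by rw [smul_neg, ← hb, neg_sub]⟩
    choose c hc using h
    obtain ⟨a, ha⟩ := h₂ c
    refine ⟨f 0 + a, fun n => ?_⟩
    rw [SModEq.sub_mem, mem_pow_smul_top]
    obtain ⟨b, hb⟩ := ha n
    refine ⟨-b, ?_⟩
    have : ∑ k ∈ Finset.range n, z ^ k • c k = f n - f 0 := by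
      rw [← Finset.sum_range_sub]
      exact Finset.sum_congr rfl fun k _ => (hc k).symm
    rw [hb, this, smul_neg]
    abel

/-- The topology is discrete and z-adic sums are finite. This makes tensor products of truncations
admissible targets for the universal property of the quantum double. -/
theorem isAdicComplete_of_zpow_smul_eq_zero {n : ℕ} (h : ∀ a : B, z ^ n • a = 0) :
    IsAdicComplete 𝔷 B := by
  refine isAdicComplete_of_hasZSum (fun a ha => ?_) fun c => ?_
  · obtain ⟨b, rfl⟩ := ha n
    exact h b
  · refine ⟨∑ k ∈ Finset.range n, z ^ k • c k, fun m => ?_⟩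
    rcases le_total m n with hm | hm
    · obtain ⟨d, rfl⟩ := Nat.exists_eq_add_of_le hm
      refine ⟨∑ k ∈ Finset.range d, z ^ k • c (m + k), ?_⟩
      rw [Finset.sum_range_add, Finset.smul_sum]
      simp only [smul_smul, pow_add]
    · obtain ⟨d, rfl⟩ := Nat.exists_eq_add_of_le hm
      refine ⟨0, ?_⟩
      rw [Finset.sum_range_add, smul_zero, add_zero, left_eq_add]
      refine Finset.sum_eq_zero fun k _ => ?_
      rw [pow_add, mul_smul, h]

theorem HasZSum.add {c d : ℕ → B} {a b : B} (h : HasZSum c a) (h' : HasZSum d b) :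
    HasZSum (fun k => c k + d k) (a + b) := fun n => by
  obtain ⟨s, hs⟩ := h n
  obtain ⟨t, ht⟩ := h' n
  refine ⟨s + t, ?_⟩
  simp only [smul_add, Finset.sum_add_distrib]
  conv_lhs => rw [hs, ht]
  abel

theorem HasZSum.map (f : B →ₗ[ℝ⟦X⟧] B') {c : ℕ → B} {a : B} (h : HasZSum c a) :
    HasZSum (fun k => f (c k)) (f a) := fun n => by
  obtain ⟨s, hs⟩ := h n
  refine ⟨f s, ?_⟩
  conv_lhs => rw [hs]
  simp

theorem HasZSum.cons (b : B) {c : ℕ → B} {a : B} (h : HasZSum (fun k => c (k + 1)) a)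
    (h0 : c 0 = b) : HasZSum c (b + z • a)
  | 0 => ⟨b + z • a, by simp⟩
  | n + 1 => by
    obtain ⟨s, hs⟩ := h n
    refine ⟨s, ?_⟩
    rw [Finset.sum_range_succ', h0]
    conv_lhs => rw [hs]
    rw [smul_add, Finset.smul_sum]
    simp only [smul_smul, pow_succ']
    rw [pow_zero, one_smul]
    abel

theorem map_zSum [IsAdicComplete 𝔷 B] [IsAdicComplete 𝔷 B'] (f : B →ₗ[ℝ⟦X⟧] B') (c : ℕ → B) :
    f (zSum c) = zSum fun k => f (c k) :=
  HasZSum.unique ((hasZSum_zSum c).map f) (hasZSum_zSum _)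

section

variable [IsAdicComplete 𝔷 B]

theorem zSum_eq {c : ℕ → B} {a : B} (h : HasZSum c a) : zSum c = a :=
  HasZSum.unique (hasZSum_zSum c) h

theorem zSum_add (c d : ℕ → B) : zSum (fun k => c k + d k) = zSum c + zSum d :=
  zSum_eq ((hasZSum_zSum c).add (hasZSum_zSum d))

theorem zSum_cons (c : ℕ → B) : zSum c = c 0 + z • zSum fun k => c (k + 1) :=
  zSum_eq (HasZSum.cons _ (hasZSum_zSum _) rfl)

theorem zSum_zero : zSum (fun _ => (0 : B)) = 0 :=
  zSum_eq fun n => ⟨0, by simp⟩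

/-- The additive map `∑ X^k c_k ↦ ∑ z^k c_k`. -/
def zsumAddHom (B : Type*) [Ring B] [Algebra ℝ⟦X⟧ B] [IsAdicComplete 𝔷 B] : B⟦X⟧ →+ B where
  toFun f := zSum fun k => PowerSeries.coeff k f
  map_zero' := by simpa using zSum_zero
  map_add' f g := by simp only [map_add]; exact zSum_add _ _

theorem zsumAddHom_apply (f : B⟦X⟧) : zsumAddHom B f = zSum fun k => PowerSeries.coeff k f := rfl

theorem zsumAddHom_C_mul (b : B) (f : B⟦X⟧) :
    zsumAddHom B (PowerSeries.C b * f) = b * zsumAddHom B f := by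
  simp only [zsumAddHom_apply, PowerSeries.coeff_C_mul]
  exact (map_zSum (LinearMap.mulLeft ℝ⟦X⟧ b) _).symm

theorem zsumAddHom_X_mul (f : B⟦X⟧) :
    zsumAddHom B (PowerSeries.X * f) = z • zsumAddHom B f := by
  rw [zsumAddHom_apply, zSum_cons]
  simp [zsumAddHom_apply, PowerSeries.coeff_succ_X_mul]

theorem zsumAddHom_C (b : B) : zsumAddHom B (PowerSeries.C b) = b := by
  rw [zsumAddHom_apply, zSum_cons]
  simp [PowerSeries.coeff_succ_C, zSum_zero]

/-- Splitting off the constant term of the left factor turns the defect of multiplicativity into z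
times the defect for the shifted series, because z is central. The defect is thus divisible by every
power of z, hence zero. Multiplicativity is what lets identities of formal series be transported to
any complete algebra. -/
theorem zsumAddHom_mul (f g : B⟦X⟧) :
    zsumAddHom B (f * g) = zsumAddHom B f * zsumAddHom B g := by
  rw [← sub_eq_zero]
  refine eq_zero_of_forall_zpow fun n => ?_
  induction n generalizing f with
  | zero => exact ⟨_, by rw [pow_zero, one_smul]⟩
  | succ n ih =>
    obtain ⟨b, hb⟩ := ih (PowerSeries.mk fun p => PowerSeries.coeff (p + 1) f)
    refine ⟨b, ?_⟩
    rw [pow_succ', mul_smul, ← hb]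
    conv_lhs => rw [PowerSeries.eq_X_mul_shift_add_const f]
    simp only [add_mul, map_add, mul_assoc, zsumAddHom_X_mul, zsumAddHom_C_mul, zsumAddHom_C,
      smul_sub, smul_mul_assoc]
    abel

/-- Evaluation of power series over a complete algebra at the central element `z`. -/
def zsum (B : Type*) [Ring B] [Algebra ℝ⟦X⟧ B] [IsAdicComplete 𝔷 B] : B⟦X⟧ →+* B :=
  { zsumAddHom B with
    map_one' := by
      have := zsumAddHom_C (1 : B)
      rwa [map_one] at this
    map_mul' := zsumAddHom_mul }

theorem zsum_apply (f : B⟦X⟧) : zsum B f = zSum fun k => PowerSeries.coeff k f := rfl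

theorem zsum_mk (c : ℕ → B) : zsum B (PowerSeries.mk c) = zSum c := by
  simp [zsum_apply]

theorem zsum_C (b : B) : zsum B (PowerSeries.C b) = b := zsumAddHom_C b

theorem zsum_X_mul (f : B⟦X⟧) : zsum B (PowerSeries.X * f) = z • zsum B f := zsumAddHom_X_mul f

theorem zsum_cons (f : B⟦X⟧) : zsum B f = PowerSeries.constantCoeff f +
    z • zsum B (PowerSeries.mk fun k => PowerSeries.coeff (k + 1) f) := by
  conv_lhs => rw [PowerSeries.eq_X_mul_shift_add_const f]
  rw [map_add, zsum_X_mul, zsum_C, add_comm]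

theorem commute_zsum {b : B} {g : B⟦X⟧} (h : ∀ k, Commute b (PowerSeries.coeff k g)) :
    Commute b (zsum B g) := by
  have : Commute (PowerSeries.C b) g := by
    refine PowerSeries.ext fun n => ?_
    rw [PowerSeries.coeff_C_mul, PowerSeries.coeff_mul_C]
    exact h n
  simpa only [zsum_C] using this.map (zsum B)

end

end ZAdic

/-! ### Formal versions of `zEval` and `zEvalDiv` -/

section Eval

variable {C : Type*} [Ring C] [Algebra ℝ C]

/-- The power series `φ(y X)`. -/
def fEval (φ : ℝ⟦X⟧) (y : C) : C⟦X⟧ := PowerSeries.mk fun k => PowerSeries.coeff k φ • y ^ k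

/-- The power series `(φ(y X) - φ(0)) / X`. -/
def fEvalDiv (φ : ℝ⟦X⟧) (y : C) : C⟦X⟧ :=
  PowerSeries.mk fun k => PowerSeries.coeff (k + 1) φ • y ^ (k + 1)

theorem coeff_fEval (φ : ℝ⟦X⟧) (y : C) (k : ℕ) :
    PowerSeries.coeff k (fEval φ y) = PowerSeries.coeff k φ • y ^ k := PowerSeries.coeff_mk _ _

theorem coeff_fEvalDiv (φ : ℝ⟦X⟧) (y : C) (k : ℕ) :
    PowerSeries.coeff k (fEvalDiv φ y) = PowerSeries.coeff (k + 1) φ • y ^ (k + 1) :=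
  PowerSeries.coeff_mk _ _

theorem constantCoeff_fEval (φ : ℝ⟦X⟧) (y : C) :
    PowerSeries.constantCoeff (fEval φ y) = algebraMap ℝ C (PowerSeries.constantCoeff φ) := by
  rw [← PowerSeries.coeff_zero_eq_constantCoeff_apply, coeff_fEval, pow_zero,
    PowerSeries.coeff_zero_eq_constantCoeff_apply, Algebra.algebraMap_eq_smul_one]

/-- In a complete algebra z may be a zero divisor, as in the truncations, whereas the formal
variable always cancels. Identities involving division by z are therefore proved in `C⟦X⟧` after
multiplication by X, and only then evaluated. -/
theorem X_mul_fEvalDiv (φ : ℝ⟦X⟧) (y : C) : PowerSeries.X * fEvalDiv φ y =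
    fEval φ y - PowerSeries.C (algebraMap ℝ C (PowerSeries.constantCoeff φ)) := by
  refine PowerSeries.ext fun n => ?_
  cases n with
  | zero => simp [constantCoeff_fEval]
  | succ n => simp [coeff_fEval, coeff_fEvalDiv, PowerSeries.coeff_succ_X_mul]

theorem zsum_fEval [Algebra ℝ⟦X⟧ C] [IsAdicComplete (Ideal.span {(PowerSeries.X : ℝ⟦X⟧)}) C]
    (φ : ℝ⟦X⟧) (y : C) : zsum C (fEval φ y) = zEval φ y := zsum_mk _

theorem zsum_fEvalDiv [Algebra ℝ⟦X⟧ C] [IsAdicComplete (Ideal.span {(PowerSeries.X : ℝ⟦X⟧)}) C]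
    (φ : ℝ⟦X⟧) (y : C) : zsum C (fEvalDiv φ y) = zEvalDiv φ y := zsum_mk _

notation "fexp" => fEval (PowerSeries.exp ℝ)

theorem fexp_add {x y : C} (h : Commute x y) : fexp (x + y) = fexp x * fexp y := by
  refine PowerSeries.ext fun n => ?_
  rw [coeff_fEval, PowerSeries.coeff_mul, h.add_pow', Finset.smul_sum]
  refine Finset.sum_congr rfl fun p hp => ?_
  rw [Finset.HasAntidiagonal.mem_antidiagonal] at hp
  subst hp
  rw [coeff_fEval, coeff_fEval, smul_mul_smul_comm, ← Nat.cast_smul_eq_nsmul ℝ, smul_smul]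
  congr 1
  simp only [PowerSeries.coeff_exp, map_div₀, map_one, map_natCast]
  rw [Nat.cast_add_choose]
  have := Nat.factorial_ne_zero p.1
  have := Nat.factorial_ne_zero p.2
  have := Nat.factorial_ne_zero (p.1 + p.2)
  field_simp

theorem fexp_zero : fexp (0 : C) = 1 := by
  refine PowerSeries.ext fun n => ?_
  rw [coeff_fEval, PowerSeries.coeff_one]
  rcases n with _ | n <;> simp

theorem commute_fEval_fEval {x y : C} (h : Commute x y) (φ ψ : ℝ⟦X⟧) :
    Commute (fEval φ x) (fEval ψ y) := by
  refine PowerSeries.ext fun n => ?_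
  rw [PowerSeries.coeff_mul, PowerSeries.coeff_mul, ← Finset.Nat.sum_antidiagonal_swap]
  refine Finset.sum_congr rfl fun p _ => ?_
  simp only [coeff_fEval, Prod.fst_swap, Prod.snd_swap]
  exact ((h.pow_pow _ _).smul_left _).smul_right _

theorem commute_C_fEval {x y : C} (h : Commute x y) (ψ : ℝ⟦X⟧) :
    Commute (PowerSeries.C x) (fEval ψ y) := by
  refine PowerSeries.ext fun n => ?_
  rw [PowerSeries.coeff_C_mul, PowerSeries.coeff_mul_C, coeff_fEval]
  exact (h.pow_right _).smul_right _

/-- Each power of y is shifted in the same way as y. This is the source of the rule for moving a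
weight vector past an exponential. -/
theorem fEval_mul_C_of_semiconj {w y y' : C} (h : SemiconjBy w y y') (φ : ℝ⟦X⟧) :
    fEval φ y' * PowerSeries.C w = PowerSeries.C w * fEval φ y := by
  refine PowerSeries.ext fun n => ?_
  rw [PowerSeries.coeff_mul_C, PowerSeries.coeff_C_mul, coeff_fEval, coeff_fEval,
    smul_mul_assoc, mul_smul_comm, (h.pow_right n).eq]

theorem fcosh_add_fsinh (y : C) : fEval coshSeries y + fEval sinhSeries y = fexp y := by
  refine PowerSeries.ext fun n => ?_
  rw [map_add, coeff_fEval, coeff_fEval, coeff_fEval, ← add_smul]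
  congr 1
  by_cases hn : Even n <;> simp [coshSeries, sinhSeries, hn]

theorem fcosh_neg (y : C) : fEval coshSeries (-y) = fEval coshSeries y := by
  refine PowerSeries.ext fun n => ?_
  rw [coeff_fEval, coeff_fEval]
  by_cases hn : Even n
  · rw [hn.neg_pow]
  · simp [coshSeries, hn]

theorem fsinh_neg (y : C) : fEval sinhSeries (-y) = -fEval sinhSeries y := by
  refine PowerSeries.ext fun n => ?_
  rw [map_neg, coeff_fEval, coeff_fEval]
  by_cases hn : Even n
  · simp [sinhSeries, hn]
  · rw [(Nat.not_even_iff_odd.1 hn).neg_pow, smul_neg]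

notation "fsdiv" => fEvalDiv sinhSeries

theorem two_X_mul_fsdiv (y : C) : 2 * (PowerSeries.X * fsdiv y) = fexp y - fexp (-y) := by
  rw [X_mul_fEvalDiv, ← fcosh_add_fsinh, ← fcosh_add_fsinh, fcosh_neg, fsinh_neg]
  have : PowerSeries.constantCoeff sinhSeries = 0 := by
    simp [sinhSeries, PowerSeries.constantCoeff_mk]
  rw [this, map_zero, map_zero, sub_zero]
  noncomm_ring

theorem two_mul_fcosh (y : C) : 2 * fEval coshSeries y = fexp y + fexp (-y) := by
  rw [← fcosh_add_fsinh, ← fcosh_add_fsinh, fcosh_neg, fsinh_neg]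
  noncomm_ring

theorem powerSeries_two_mul_cancel {f g : C⟦X⟧} (h : 2 * f = 2 * g) : f = g := by
  have h' : (2 : ℝ) • f = (2 : ℝ) • g := by
    rw [two_smul, two_smul, ← two_mul, ← two_mul, h]
  exact smul_right_injective _ (two_ne_zero' ℝ) h'

end Eval

end

/-! ### Naturality of evaluation and the addition formula for sinh -/

noncomputable section

theorem map_smul_real {A B : Type*} [Ring A] [Algebra ℝ⟦X⟧ A] [Algebra ℝ A]
    [IsScalarTower ℝ ℝ⟦X⟧ A] [Ring B] [Algebra ℝ⟦X⟧ B] [Algebra ℝ B] [IsScalarTower ℝ ℝ⟦X⟧ B]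
    (f : A →ₐ[ℝ⟦X⟧] B) (r : ℝ) (a : A) : f (r • a) = r • f a := by
  rw [← algebraMap_smul ℝ⟦X⟧ r a, map_smul, algebraMap_smul]

section MapEval

variable {A B : Type*} [Ring A] [Algebra ℝ⟦X⟧ A] [Algebra ℝ A] [IsScalarTower ℝ ℝ⟦X⟧ A]
  [IsAdicComplete (Ideal.span {(PowerSeries.X : ℝ⟦X⟧)}) A]
  [Ring B] [Algebra ℝ⟦X⟧ B] [Algebra ℝ B] [IsScalarTower ℝ ℝ⟦X⟧ B]
  [IsAdicComplete (Ideal.span {(PowerSeries.X : ℝ⟦X⟧)}) B]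

theorem map_zEval (f : A →ₐ[ℝ⟦X⟧] B) (φ : ℝ⟦X⟧) (a : A) : f (zEval φ a) = zEval φ (f a) := by
  refine (map_zSum f.toLinearMap _).trans (congrArg zSum (funext fun k => ?_))
  change f _ = _
  rw [map_smul_real, map_pow]

theorem map_zEvalDiv (f : A →ₐ[ℝ⟦X⟧] B) (φ : ℝ⟦X⟧) (a : A) :
    f (zEvalDiv φ a) = zEvalDiv φ (f a) := by
  refine (map_zSum f.toLinearMap _).trans (congrArg zSum (funext fun k => ?_))
  change f _ = _
  rw [map_smul_real, map_pow]

end MapEval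

section Formal

variable {B : Type*} [Ring B] [Algebra ℝ B]

/-- After multiplication by 2X both sides are e^{x+y} − e^{−x−y}. The asymmetric form of the
addition formula is the one that matches a coproduct e^{−H} ⊗ t + t ⊗ e^{H}. -/
theorem fsdiv_add {x y : B} (h : Commute x y) :
    fsdiv (x + y) = fexp (-x) * fsdiv y + fsdiv x * fexp y := by
  refine powerSeries_two_mul_cancel (PowerSeries.X_mul_cancel ?_)
  have hx := (PowerSeries.commute_X (fexp (-x))).eq
  have h1 : ∀ f : B⟦X⟧, PowerSeries.X * (2 * f) = 2 * (PowerSeries.X * f) := fun f => by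
    simp only [two_mul, mul_add]
  have h2 : ∀ f g : B⟦X⟧, f * (2 * g) = (2 * f) * g := fun f g => by
    simp only [two_mul, mul_add, add_mul]
  rw [h1, h1, mul_add PowerSeries.X, ← mul_assoc PowerSeries.X (fexp (-x)), ← hx, mul_add,
    mul_assoc (fexp (-x)), ← mul_assoc 2 (fexp (-x)), ← h2, two_X_mul_fsdiv, two_X_mul_fsdiv,
    ← mul_assoc PowerSeries.X, ← mul_assoc 2 _ (fexp y), two_X_mul_fsdiv, neg_add, fexp_add h,
    fexp_add h.neg_left.neg_right]
  noncomm_ring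

end Formal

section Eval

variable {B : Type*} [Ring B] [Algebra ℝ⟦X⟧ B] [Algebra ℝ B]

theorem zEval_neg_of_even {φ : ℝ⟦X⟧} (hφ : ∀ n, ¬ Even n → PowerSeries.coeff n φ = 0) (y : B) :
    zEval φ (-y) = zEval φ y := by
  refine congrArg zSum (funext fun n => ?_)
  by_cases hn : Even n
  · rw [hn.neg_pow]
  · simp [hφ n hn]

variable [IsAdicComplete (Ideal.span {(PowerSeries.X : ℝ⟦X⟧)}) B]

theorem zEvalDiv_neg_of_odd {φ : ℝ⟦X⟧} (hφ : ∀ n, Even n → PowerSeries.coeff n φ = 0) (y : B) :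
    zEvalDiv φ (-y) = -zEvalDiv φ y := by
  refine Eq.trans (congrArg zSum (funext fun n => ?_)) (map_zSum (-LinearMap.id) _).symm
  by_cases hn : Even (n + 1)
  · simp [hφ _ hn]
  · rw [(Nat.not_even_iff_odd.1 hn).neg_pow, smul_neg]; rfl

theorem commute_zEval_zEval {x y : B} (h : Commute x y) (φ ψ : ℝ⟦X⟧) :
    Commute (zEval φ x) (zEval ψ y) := by
  simpa only [zsum_fEval] using (commute_fEval_fEval h φ ψ).map (zsum B)

theorem commute_zEval {x y : B} (h : Commute x y) (ψ : ℝ⟦X⟧) :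
    Commute x (zEval ψ y) := by
  simpa only [zsum_fEval, zsum_C] using (commute_C_fEval h ψ).map (zsum B)

theorem zEval_mul_of_semiconj {w y y' : B} (h : SemiconjBy w y y') (φ : ℝ⟦X⟧) :
    zEval φ y' * w = w * zEval φ y := by
  simpa only [zsum_fEval, zsum_C, map_mul] using
    congrArg (zsum B) (fEval_mul_C_of_semiconj h φ)

notation "zexp" => zEval (PowerSeries.exp ℝ)

theorem zexp_add {x y : B} (h : Commute x y) : zexp (x + y) = zexp x * zexp y := by
  simpa only [zsum_fEval, map_mul] using congrArg (zsum B) (fexp_add h)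

theorem zexp_zero : zexp (0 : B) = 1 := by
  simpa only [zsum_fEval, map_one] using congrArg (zsum B) (fexp_zero (C := B))

theorem zexp_mul_zexp_neg (y : B) : zexp y * zexp (-y) = 1 := by
  rw [← zexp_add (Commute.refl y).neg_right, add_neg_cancel, zexp_zero]

theorem zexp_neg_mul_zexp (y : B) : zexp (-y) * zexp y = 1 := by
  rw [← zexp_add (Commute.refl y).neg_left, neg_add_cancel, zexp_zero]

notation "zsdiv" => zEvalDiv sinhSeries

theorem zsdiv_add {x y : B} (h : Commute x y) :
    zsdiv (x + y) = zexp (-x) * zsdiv y + zsdiv x * zexp y := by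
  simpa only [zsum_fEval, zsum_fEvalDiv, map_mul, map_add] using
    congrArg (zsum B) (fsdiv_add h)

theorem zEval_eq (φ : ℝ⟦X⟧) (y : B) : ∃ t : B, zEval φ y =
    algebraMap ℝ B (PowerSeries.coeff 0 φ) + (PowerSeries.X : ℝ⟦X⟧) • PowerSeries.coeff 1 φ • y +
      (PowerSeries.X : ℝ⟦X⟧) ^ 2 • t := by
  obtain ⟨t, ht⟩ := hasZSum_zSum (fun k => PowerSeries.coeff k φ • y ^ k) 2
  refine ⟨t, ht.trans ?_⟩
  simp [Finset.sum_range_succ, Algebra.algebraMap_eq_smul_one]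

theorem zEvalDiv_eq (φ : ℝ⟦X⟧) (y : B) : ∃ t : B, zEvalDiv φ y =
    PowerSeries.coeff 1 φ • y + (PowerSeries.X : ℝ⟦X⟧) • t := by
  obtain ⟨t, ht⟩ := hasZSum_zSum (fun k => PowerSeries.coeff (k + 1) φ • y ^ (k + 1)) 1
  refine ⟨t, ht.trans ?_⟩
  simp

end Eval

/-! ### Trigonometric series over a complex algebra -/

section Trig

variable {C : Type*} [Ring C] [Algebra ℂ C]

/-- Euler's formula, compared coefficient by coefficient according to the parity of the degree. -/
theorem fexp_I_smul (y : C) : fexp (Complex.I • y) =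
    fEval (PowerSeries.cos ℝ) y + PowerSeries.C (algebraMap ℂ C Complex.I) *
      fEval (PowerSeries.sin ℝ) y := by
  refine PowerSeries.ext fun n => ?_
  rw [map_add, PowerSeries.coeff_C_mul, coeff_fEval, coeff_fEval, coeff_fEval, smul_pow,
    ← Algebra.smul_def]
  simp only [← Complex.coe_smul, smul_smul, ← add_smul]
  congr 1
  rcases n.even_or_odd' with ⟨m, rfl | rfl⟩
  · simp [PowerSeries.cos, PowerSeries.sin, pow_mul, PowerSeries.coeff_exp]
    ring
  · have h : (2 * m + 1) / 2 = m := by omega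
    simp [PowerSeries.cos, PowerSeries.sin, pow_mul, pow_succ, PowerSeries.coeff_exp, h]
    ring

theorem fexp_neg_I_smul (y : C) : fexp (-(Complex.I • y)) =
    fEval (PowerSeries.cos ℝ) y - PowerSeries.C (algebraMap ℂ C Complex.I) *
      fEval (PowerSeries.sin ℝ) y := by
  rw [← smul_neg, fexp_I_smul, sub_eq_add_neg, ← mul_neg]
  congr 1
  on_goal 2 => congr 1
  all_goals refine PowerSeries.ext fun n => ?_
  · rw [coeff_fEval, coeff_fEval]
    by_cases hn : Even n
    · rw [hn.neg_pow]
    · simp [PowerSeries.cos, hn]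
  · rw [map_neg, coeff_fEval, coeff_fEval]
    by_cases hn : Even n
    · simp [PowerSeries.sin, hn]
    · rw [(Nat.not_even_iff_odd.1 hn).neg_pow, smul_neg]

/-- This packages the products sinh · cos and sin · cosh of the crossed relations into one complex
sinh. The computation clears 2X and expands all exponentials by Euler's formula. -/
theorem fsdiv_sub_I_smul {p q : C} (h : Commute p q) : fsdiv (p - Complex.I • q) =
    fsdiv p * fEval (PowerSeries.cos ℝ) q - PowerSeries.C (algebraMap ℂ C Complex.I) *
      (fEvalDiv (PowerSeries.sin ℝ) q * fEval coshSeries p) := by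
  refine powerSeries_two_mul_cancel (PowerSeries.X_mul_cancel ?_)
  have hI : ∀ f : C⟦X⟧, f * PowerSeries.C (algebraMap ℂ C Complex.I) =
      PowerSeries.C (algebraMap ℂ C Complex.I) * f := fun f => PowerSeries.ext fun n => by
    rw [PowerSeries.coeff_mul_C, PowerSeries.coeff_C_mul, Algebra.commutes]
  have hX : ∀ f g : C⟦X⟧, PowerSeries.X * (2 * (f * g)) = 2 * (PowerSeries.X * f) * g := fun f g => by
    simp only [two_mul, mul_add, add_mul, mul_assoc]
  have hX' : ∀ f : C⟦X⟧, PowerSeries.X * (2 * f) = 2 * (PowerSeries.X * f) := fun f => by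
    simp only [two_mul, mul_add]
  have hs : PowerSeries.X * fEvalDiv (PowerSeries.sin ℝ) q = fEval (PowerSeries.sin ℝ) q := by
    rw [X_mul_fEvalDiv]
    simp [PowerSeries.sin]
  have hc : Commute (fEval (PowerSeries.sin ℝ) q) (fexp p) := commute_fEval_fEval h.symm _ _
  have hc' : Commute (fEval (PowerSeries.sin ℝ) q) (fexp (-p)) :=
    commute_fEval_fEval h.symm.neg_right _ _
  have hp : Commute p (Complex.I • q) := h.smul_right _
  have hsum : PowerSeries.X * (2 * (PowerSeries.C (algebraMap ℂ C Complex.I) *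
      (fEvalDiv (PowerSeries.sin ℝ) q * fEval coshSeries p))) =
      PowerSeries.C (algebraMap ℂ C Complex.I) * (fEval (PowerSeries.sin ℝ) q *
        (fexp p + fexp (-p))) := by
    rw [← two_mul_fcosh, ← hs]
    simp only [two_mul, mul_add, add_mul, ← mul_assoc, ← hI PowerSeries.X]
  have h1 : fexp (p - Complex.I • q) = fexp p * fexp (-(Complex.I • q)) := by
    rw [sub_eq_add_neg, fexp_add hp.neg_right]
  have h2 : fexp (-(p - Complex.I • q)) = fexp (-p) * fexp (Complex.I • q) := by
    rw [neg_sub, sub_eq_add_neg, add_comm, fexp_add hp.neg_left]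
  rw [hX', two_X_mul_fsdiv, h1, h2, fexp_I_smul, fexp_neg_I_smul, mul_sub 2, mul_sub PowerSeries.X,
    hX, two_X_mul_fsdiv, hsum, mul_add (fEval (PowerSeries.sin ℝ) q), hc.eq, hc'.eq]
  simp only [mul_add, mul_sub, sub_mul, ← mul_assoc, hI]
  abel

section

variable [Algebra ℝ⟦X⟧ C] [IsAdicComplete (Ideal.span {(PowerSeries.X : ℝ⟦X⟧)}) C]

theorem zexp_I_smul (y : C) : zexp (Complex.I • y) =
    zEval (PowerSeries.cos ℝ) y + Complex.I • zEval (PowerSeries.sin ℝ) y := by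
  simpa only [zsum_fEval, zsum_C, map_mul, map_add, ← Algebra.smul_def] using
    congrArg (zsum C) (fexp_I_smul y)

theorem zexp_neg_I_smul (y : C) : zexp (-(Complex.I • y)) =
    zEval (PowerSeries.cos ℝ) y - Complex.I • zEval (PowerSeries.sin ℝ) y := by
  simpa only [zsum_fEval, zsum_C, map_mul, map_sub, ← Algebra.smul_def] using
    congrArg (zsum C) (fexp_neg_I_smul y)

theorem zsdiv_sub_I_smul {p q : C} (h : Commute p q) : zsdiv (p - Complex.I • q) =
    zsdiv p * zEval (PowerSeries.cos ℝ) q -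
      Complex.I • (zEvalDiv (PowerSeries.sin ℝ) q * zEval coshSeries p) := by
  simpa only [zsum_fEval, zsum_fEvalDiv, zsum_C, map_mul, map_sub, ← Algebra.smul_def] using
    congrArg (zsum C) (fsdiv_sub_I_smul h)

end

end Trig

end

noncomputable section

/-! ### Complexification -/

/-- The complexification of a real algebra. -/
@[ext]
structure Cx (B : Type*) where
  /-- The real part. -/
  re : B
  /-- The imaginary part. -/
  im : B

namespace Cx

variable {B : Type*}

section Ring

variable [Ring B]

instance : Zero (Cx B) := ⟨⟨0, 0⟩⟩
instance : One (Cx B) := ⟨⟨1, 0⟩⟩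
instance : Add (Cx B) := ⟨fun u v => ⟨u.re + v.re, u.im + v.im⟩⟩
instance : Neg (Cx B) := ⟨fun u => ⟨-u.re, -u.im⟩⟩
instance : Sub (Cx B) := ⟨fun u v => ⟨u.re - v.re, u.im - v.im⟩⟩
instance : Mul (Cx B) := ⟨fun u v => ⟨u.re * v.re - u.im * v.im, u.re * v.im + u.im * v.re⟩⟩

@[simp] theorem zero_re : (0 : Cx B).re = 0 := rfl
@[simp] theorem zero_im : (0 : Cx B).im = 0 := rfl
@[simp] theorem one_re : (1 : Cx B).re = 1 := rfl
@[simp] theorem one_im : (1 : Cx B).im = 0 := rfl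
@[simp] theorem add_re (u v : Cx B) : (u + v).re = u.re + v.re := rfl
@[simp] theorem add_im (u v : Cx B) : (u + v).im = u.im + v.im := rfl
@[simp] theorem neg_re (u : Cx B) : (-u).re = -u.re := rfl
@[simp] theorem neg_im (u : Cx B) : (-u).im = -u.im := rfl
@[simp] theorem sub_re (u v : Cx B) : (u - v).re = u.re - v.re := rfl
@[simp] theorem sub_im (u v : Cx B) : (u - v).im = u.im - v.im := rfl
@[simp] theorem mul_re (u v : Cx B) : (u * v).re = u.re * v.re - u.im * v.im := rfl
@[simp] theorem mul_im (u v : Cx B) : (u * v).im = u.re * v.im + u.im * v.re := rfl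

instance : Ring (Cx B) where
  add_assoc u v w := by ext <;> simp [add_assoc]
  zero_add u := by ext <;> simp
  add_zero u := by ext <;> simp
  add_comm u v := by ext <;> simp [add_comm]
  neg_add_cancel u := by ext <;> simp
  sub_eq_add_neg u v := by ext <;> simp [sub_eq_add_neg]
  mul_assoc u v w := by ext <;> simp <;> noncomm_ring
  one_mul u := by ext <;> simp
  mul_one u := by ext <;> simp
  zero_mul u := by ext <;> simp
  mul_zero u := by ext <;> simp
  left_distrib u v w := by ext <;> simp <;> noncomm_ring
  right_distrib u v w := by ext <;> simp <;> noncomm_ring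
  nsmul := nsmulRec
  zsmul := zsmulRec

/-- Complex conjugation. -/
def conj : Cx B →+* Cx B where
  toFun u := ⟨u.re, -u.im⟩
  map_zero' := by ext <;> simp
  map_one' := by ext <;> simp
  map_add' u v := by ext <;> simp [add_comm]
  map_mul' u v := by ext <;> simp [add_comm]

@[simp] theorem conj_re (u : Cx B) : (conj u).re = u.re := rfl
@[simp] theorem conj_im (u : Cx B) : (conj u).im = -u.im := rfl

@[simp] theorem conj_conj (u : Cx B) : conj (conj u) = u := by ext <;> simp

/-- The embedding of an algebra in its complexification. -/
def of : B →+* Cx B where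
  toFun b := ⟨b, 0⟩
  map_zero' := rfl
  map_one' := rfl
  map_add' _ _ := by ext <;> simp
  map_mul' _ _ := by ext <;> simp

@[simp] theorem of_re (b : B) : (of b).re = b := rfl
@[simp] theorem of_im (b : B) : (of b).im = 0 := rfl

@[simp] theorem conj_of (b : B) : conj (of b) = of b := by ext <;> simp

end Ring

section Complex

variable [Ring B] [Algebra ℝ B]

instance : SMul ℂ (Cx B) := ⟨fun c u => ⟨c.re • u.re - c.im • u.im, c.re • u.im + c.im • u.re⟩⟩

@[simp] theorem smul_re (c : ℂ) (u : Cx B) : (c • u).re = c.re • u.re - c.im • u.im := rfl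
@[simp] theorem smul_im (c : ℂ) (u : Cx B) : (c • u).im = c.re • u.im + c.im • u.re := rfl

instance : Module ℂ (Cx B) where
  one_smul u := by ext <;> simp
  mul_smul c d u := by ext <;> simp <;> module
  smul_zero c := by ext <;> simp
  smul_add c u v := by ext <;> simp <;> module
  add_smul c d u := by ext <;> simp <;> module
  zero_smul u := by ext <;> simp

instance : Algebra ℂ (Cx B) := Algebra.ofModule
  (fun c u v => by ext <;> simp [sub_mul, add_mul] <;> module)
  (fun c u v => by ext <;> simp [mul_sub, mul_add] <;> module)

@[simp] theorem real_smul_re (r : ℝ) (u : Cx B) : (r • u).re = r • u.re := by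
  rw [← Complex.coe_smul, smul_re, Complex.ofReal_re, Complex.ofReal_im, zero_smul, sub_zero]

@[simp] theorem real_smul_im (r : ℝ) (u : Cx B) : (r • u).im = r • u.im := by
  rw [← Complex.coe_smul, smul_im, Complex.ofReal_re, Complex.ofReal_im, zero_smul, add_zero]

theorem of_smul (r : ℝ) (b : B) : of (r • b) = r • of b := by ext <;> simp

theorem conj_smul (c : ℂ) (u : Cx B) : conj (c • u) = (starRingEnd ℂ) c • conj u := by
  ext
  · simp
  · simp; abel

theorem mk_eq (p q : B) : (⟨p, q⟩ : Cx B) = of p + Complex.I • of q := by ext <;> simp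

end Complex

section Formal

variable [Ring B] [Algebra ℝ⟦X⟧ B]

instance : SMul ℝ⟦X⟧ (Cx B) := ⟨fun c u => ⟨c • u.re, c • u.im⟩⟩

@[simp] theorem formal_smul_re (c : ℝ⟦X⟧) (u : Cx B) : (c • u).re = c • u.re := rfl
@[simp] theorem formal_smul_im (c : ℝ⟦X⟧) (u : Cx B) : (c • u).im = c • u.im := rfl

instance : Module ℝ⟦X⟧ (Cx B) where
  one_smul u := by ext <;> simp
  mul_smul c d u := by ext <;> simp [mul_smul]
  smul_zero c := by ext <;> simp
  smul_add c u v := by ext <;> simp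
  add_smul c d u := by ext <;> simp [add_smul]
  zero_smul u := by ext <;> simp

instance : Algebra ℝ⟦X⟧ (Cx B) := Algebra.ofModule
  (fun c u v => by ext <;> simp [smul_sub])
  (fun c u v => by ext <;> simp [smul_sub])

instance [Algebra ℝ B] [IsScalarTower ℝ ℝ⟦X⟧ B] : IsScalarTower ℝ ℝ⟦X⟧ (Cx B) where
  smul_assoc r c u := by ext <;> simp

/-- The embedding of an algebra in its complexification, as an algebra homomorphism. -/
def ofₐ : B →ₐ[ℝ⟦X⟧] Cx B := AlgHom.mk' of fun c b => by ext <;> simp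

/-- Complex conjugation as an algebra homomorphism. -/
def conjₐ : Cx B →ₐ[ℝ⟦X⟧] Cx B := AlgHom.mk' conj fun c b => by ext <;> simp

/-- The map of complexifications induced by a homomorphism. -/
def map {B' : Type*} [Ring B'] [Algebra ℝ⟦X⟧ B'] (f : B →ₐ[ℝ⟦X⟧] B') : Cx B →ₐ[ℝ⟦X⟧] Cx B' :=
  AlgHom.mk' { toFun := fun u => ⟨f u.re, f u.im⟩
               map_zero' := by ext <;> simp
               map_one' := by ext <;> simp
               map_add' := fun u v => by ext <;> simp
               map_mul' := fun u v => by ext <;> simp } fun c b => by ext <;> simp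

@[simp] theorem map_re {B' : Type*} [Ring B'] [Algebra ℝ⟦X⟧ B'] (f : B →ₐ[ℝ⟦X⟧] B') (u : Cx B) :
    (map f u).re = f u.re := rfl

@[simp] theorem map_im {B' : Type*} [Ring B'] [Algebra ℝ⟦X⟧ B'] (f : B →ₐ[ℝ⟦X⟧] B') (u : Cx B) :
    (map f u).im = f u.im := rfl

theorem map_of {B' : Type*} [Ring B'] [Algebra ℝ⟦X⟧ B'] (f : B →ₐ[ℝ⟦X⟧] B') (b : B) :
    map f (of b) = of (f b) := by ext <;> simp

instance [IsAdicComplete (Ideal.span {(PowerSeries.X : ℝ⟦X⟧)}) B] :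
    IsAdicComplete (Ideal.span {(PowerSeries.X : ℝ⟦X⟧)}) (Cx B) := by
  refine isAdicComplete_of_hasZSum (fun a ha => ?_) fun c => ?_
  · refine Cx.ext (eq_zero_of_forall_zpow fun n => ?_) (eq_zero_of_forall_zpow fun n => ?_)
    · obtain ⟨b, hb⟩ := ha n
      exact ⟨b.re, congrArg Cx.re hb⟩
    · obtain ⟨b, hb⟩ := ha n
      exact ⟨b.im, congrArg Cx.im hb⟩
  · refine ⟨⟨zSum fun k => (c k).re, zSum fun k => (c k).im⟩, fun n => ?_⟩
    obtain ⟨s, hs⟩ := hasZSum_zSum (fun k => (c k).re) n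
    obtain ⟨t, ht⟩ := hasZSum_zSum (fun k => (c k).im) n
    let reHom : Cx B →+ B := ⟨⟨Cx.re, rfl⟩, fun _ _ => rfl⟩
    let imHom : Cx B →+ B := ⟨⟨Cx.im, rfl⟩, fun _ _ => rfl⟩
    refine ⟨⟨s, t⟩, Cx.ext (hs.trans ?_) (ht.trans ?_)⟩
    · rw [add_re]
      exact congrArg (· + _) (map_sum reHom (fun k => (PowerSeries.X : ℝ⟦X⟧) ^ k • c k) _).symm
    · rw [add_im]
      exact congrArg (· + _) (map_sum imHom (fun k => (PowerSeries.X : ℝ⟦X⟧) ^ k • c k) _).symm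

section

variable [Algebra ℝ B] [IsScalarTower ℝ ℝ⟦X⟧ B]
  [IsAdicComplete (Ideal.span {(PowerSeries.X : ℝ⟦X⟧)}) B]

theorem of_zEval (φ : ℝ⟦X⟧) (b : B) : of (zEval φ b) = zEval φ (of b) := map_zEval ofₐ φ b

theorem of_zEvalDiv (φ : ℝ⟦X⟧) (b : B) : of (zEvalDiv φ b) = zEvalDiv φ (of b) :=
  map_zEvalDiv ofₐ φ b

theorem conj_zEval (φ : ℝ⟦X⟧) (b : Cx B) : conj (zEval φ b) = zEval φ (conj b) :=
  map_zEval conjₐ φ b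

/-- The damped cosines and sines in the coproducts are the real and imaginary parts of one complex
exponential. -/
theorem zexp_of_add_I_smul {p q : B} (h : Commute p q) : zexp (of p + Complex.I • of q) =
    ⟨zexp p * zEval (PowerSeries.cos ℝ) q, zexp p * zEval (PowerSeries.sin ℝ) q⟩ := by
  rw [zexp_add ((h.map of).smul_right _), zexp_I_smul, mk_eq, map_mul, map_mul, of_zEval, of_zEval,
    of_zEval, mul_add, mul_smul_comm]

theorem zexp_of_sub_I_smul {p q : B} (h : Commute p q) : zexp (of p - Complex.I • of q) =
    ⟨zexp p * zEval (PowerSeries.cos ℝ) q, -(zexp p * zEval (PowerSeries.sin ℝ) q)⟩ := by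
  rw [sub_eq_add_neg, zexp_add ((h.map of).smul_right _).neg_right, zexp_neg_I_smul, mk_eq, map_mul,
    map_neg, map_mul, of_zEval, of_zEval, of_zEval, mul_sub, mul_smul_comm, smul_neg,
    sub_eq_add_neg]

theorem zsdiv_of_sub_I_smul {p q : B} (h : Commute p q) : zsdiv (of p - Complex.I • of q) =
    ⟨zsdiv p * zEval (PowerSeries.cos ℝ) q,
      -(zEvalDiv (PowerSeries.sin ℝ) q * zEval coshSeries p)⟩ := by
  rw [zsdiv_sub_I_smul (h.map of), mk_eq, map_mul,
    map_neg, map_mul, of_zEval, of_zEval, of_zEvalDiv, of_zEvalDiv, smul_neg,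
    sub_eq_add_neg]

end

end Formal

end Cx

end

open scoped ComplexConjugate

noncomputable section

/-! ### The relations of the double in complex form -/

/-- The commutation rules of the double, with `[x¹, X₁] = [x², X₂] = p` and
`[x¹, X₂] = -[x², X₁] = q`. -/
structure DoubleRelations (lam mu : ℝˣ) {A : Type*} [Ring A] [Algebra ℝ A] (x X : Fin 3 → A)
    (p q : A) : Prop where
  x0_x1 : x 0 * x 1 - x 1 * x 0 = (mu : ℝ) • x 1 - x 2
  x0_x2 : x 0 * x 2 - x 2 * x 0 = x 1 + (mu : ℝ) • x 2
  x1_x2 : x 1 * x 2 - x 2 * x 1 = 0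
  X0_X1 : X 0 * X 1 - X 1 * X 0 = -(lam / mu : ℝ) • X 1 + (lam : ℝ) • X 2
  X0_X2 : X 0 * X 2 - X 2 * X 0 = -(lam : ℝ) • X 1 - (lam / mu : ℝ) • X 2
  X1_X2 : X 1 * X 2 - X 2 * X 1 = 0
  x0_X0 : x 0 * X 0 - X 0 * x 0 = 0
  x0_X1 : x 0 * X 1 - X 1 * x 0 = -(mu : ℝ) • X 1 - X 2
  x0_X2 : x 0 * X 2 - X 2 * x 0 = X 1 - (mu : ℝ) • X 2
  x1_X0 : x 1 * X 0 - X 0 * x 1 = -(lam / mu : ℝ) • x 1 - (lam : ℝ) • x 2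
  x2_X0 : x 2 * X 0 - X 0 * x 2 = (lam : ℝ) • x 1 - (lam / mu : ℝ) • x 2
  x1_X1 : x 1 * X 1 - X 1 * x 1 = p
  x1_X2 : x 1 * X 2 - X 2 * x 1 = q
  x2_X1 : x 2 * X 1 - X 1 * x 2 = -q
  x2_X2 : x 2 * X 2 - X 2 * x 2 = p

/-- Separating the shape of the relations from the two right-hand sides p and q lets the same lemmas
serve the classical and the deformed case. -/
theorem quantumDoubleRelations_iff (lam mu : ℝˣ) {A : Type*} [Ring A] [Algebra ℝ⟦X⟧ A]
    [Algebra ℝ A] (x X : Fin 3 → A) : QuantumDoubleRelations lam mu x X ↔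
      DoubleRelations lam mu x X
        (zEvalDiv sinhSeries ((lam / mu : ℝ) • x 0 + (mu : ℝ) • X 0) *
          zEval (PowerSeries.cos ℝ) ((lam : ℝ) • x 0 - X 0))
        (zEvalDiv (PowerSeries.sin ℝ) ((lam : ℝ) • x 0 - X 0) *
          zEval coshSeries ((lam / mu : ℝ) • x 0 + (mu : ℝ) • X 0)) :=
  ⟨fun ⟨h1, h2, h3, h4, h5, h6, h7, h8, h9, h10, h11, h12, h13, h14, h15⟩ =>
    ⟨h1, h2, h3, h4, h5, h6, h7, h8, h9, h10, h11, h12, h13, h14, h15⟩,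
  fun ⟨h1, h2, h3, h4, h5, h6, h7, h8, h9, h10, h11, h12, h13, h14, h15⟩ =>
    ⟨h1, h2, h3, h4, h5, h6, h7, h8, h9, h10, h11, h12, h13, h14, h15⟩⟩

/-- The commutation rules of one half of the complexified double. -/
structure CxRelations (a b : ℂ) {C : Type*} [Ring C] [Algebra ℂ C] (x₀ X₀ u u' v v' t : C) :
    Prop where
  x_X : Commute x₀ X₀
  x_u : x₀ * u - u * x₀ = b • u
  X_u : X₀ * u - u * X₀ = a • u
  x_v : x₀ * v - v * x₀ = -conj b • v
  X_v : X₀ * v - v * X₀ = -conj a • v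
  u_u' : Commute u u'
  v_v' : Commute v v'
  u_v : Commute u v
  u_v' : u * v' - v' * u = t

/-- The weight of `x¹ + i x²` under `X₀`. -/
def wtX (lam mu : ℝˣ) : ℂ := ⟨lam / mu, -lam⟩

/-- The weight of `x¹ + i x²` under `x⁰`. -/
def wtx (mu : ℝˣ) : ℂ := ⟨mu, 1⟩

/-- One has a = −i (λ/μ) b, so a b̄ is purely imaginary. This is the reason why the two halves of
the complexified double commute. -/
theorem wtX_mul_conj_add (lam mu : ℝˣ) :
    wtX lam mu * conj (wtx mu) + conj (wtX lam mu) * wtx mu = 0 := by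
  have := mu.ne_zero
  apply Complex.ext
  · simp [wtX, wtx]
  · simp [wtX, wtx]; field_simp; ring

/-- The weight of u under its own Cartan element a x⁰ + b X₀ is 2ab; the deformation of u requires
division by it. -/
theorem wtX_mul_wtx_ne_zero (lam mu : ℝˣ) : wtX lam mu * wtx mu ≠ 0 := by
  intro h
  rcases mul_eq_zero.1 h with h | h
  · exact lam.ne_zero (by simpa [wtX] using congrArg Complex.im h)
  · exact mu.ne_zero (by simpa [wtx] using congrArg Complex.re h)

/-- The elements x⁰ and X₀ are real, so conjugation exchanges the two halves. Hence the relations of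
one half carry all the information. -/
theorem CxRelations.conj {a b : ℂ} {B : Type*} [Ring B] [Algebra ℝ B] {p q : B} {u v t : Cx B}
    (h : CxRelations a b (Cx.of p) (Cx.of q) u (Cx.conj u) v (Cx.conj v) t) :
    CxRelations (conj a) (conj b) (Cx.of p) (Cx.of q) (Cx.conj u) u (Cx.conj v) v
      (Cx.conj t) where
  x_X := h.x_X
  x_u := by simpa [Cx.conj_smul] using congrArg Cx.conj h.x_u
  X_u := by simpa [Cx.conj_smul] using congrArg Cx.conj h.X_u
  x_v := by simpa [Cx.conj_smul] using congrArg Cx.conj h.x_v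
  X_v := by simpa [Cx.conj_smul] using congrArg Cx.conj h.X_v
  u_u' := h.u_u'.symm
  v_v' := h.v_v'.symm
  u_v := h.u_v.map Cx.conj
  u_v' := by simpa using congrArg Cx.conj h.u_v'

/-- Each weight relation is a pair of real relations, and [u, ū] = −2i [x¹, x²], likewise for v. The
four crossed brackets are recovered from half sums and half differences of the components of [u, v]
= 0 and [u, v̄] = 2(p − iq). -/
theorem doubleRelations_iff (lam mu : ℝˣ) {B : Type*} [Ring B] [Algebra ℝ B] (x X : Fin 3 → B)
    (p q : B) : DoubleRelations lam mu x X p q ↔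
      CxRelations (wtX lam mu) (wtx mu) (Cx.of (x 0)) (Cx.of (X 0)) ⟨x 1, x 2⟩
        (Cx.conj ⟨x 1, x 2⟩) ⟨X 1, X 2⟩ (Cx.conj ⟨X 1, X 2⟩) ((2 : ℂ) • ⟨p, -q⟩) := by
  constructor
  · rintro ⟨h1, h2, h3, h4, h5, h6, h7, h8, h9, h10, h11, h12, h13, h14, h15⟩
    constructor
    · exact (show Commute (x 0) (X 0) from sub_eq_zero.1 h7).map Cx.of
    · ext <;> simp [wtx, h1, h2, add_comm]
    · ext <;> simp [wtX]
      · linear_combination (norm := module) -h10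
      · linear_combination (norm := module) -h11
    · ext <;> simp [wtx]
      · linear_combination (norm := module) h8
      · linear_combination (norm := module) h9
    · ext <;> simp [wtX]
      · linear_combination (norm := module) h4
      · linear_combination (norm := module) h5
    · rw [sub_eq_zero] at h3
      ext <;> simp [h3, add_comm]
    · rw [sub_eq_zero] at h6
      ext <;> simp [h6, add_comm]
    · ext <;> simp
      · linear_combination (norm := module) h12 - h15
      · linear_combination (norm := module) h13 + h14
    · ext <;> simp
      · linear_combination (norm := module) h12 + h15
      · linear_combination (norm := module) h14 - h13
  · rintro ⟨h1, h2, h3, h4, h5, h6, h7, h8, h9⟩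
    have r2 := congrArg Cx.re h2
    have i2 := congrArg Cx.im h2
    have r3 := congrArg Cx.re h3
    have i3 := congrArg Cx.im h3
    have r4 := congrArg Cx.re h4
    have i4 := congrArg Cx.im h4
    have r5 := congrArg Cx.re h5
    have i5 := congrArg Cx.im h5
    have i6 := congrArg Cx.im h6.eq
    have i7 := congrArg Cx.im h7.eq
    have r8 := congrArg Cx.re h8.eq
    have i8 := congrArg Cx.im h8.eq
    have r9 := congrArg Cx.re h9
    have i9 := congrArg Cx.im h9
    have r1 := congrArg Cx.re h1.eq
    simp [wtx, wtX] at r1 r2 i2 r3 i3 r4 i4 r5 i5 i6 i7 r8 i8 r9 i9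
    constructor
    · linear_combination (norm := module) r2
    · linear_combination (norm := module) i2
    · linear_combination (norm := module) (-1 / 2 : ℝ) • i6
    · linear_combination (norm := module) r5
    · linear_combination (norm := module) i5
    · linear_combination (norm := module) (-1 / 2 : ℝ) • i7
    · linear_combination (norm := module) r1
    · linear_combination (norm := module) r4
    · linear_combination (norm := module) i4
    · linear_combination (norm := module) -r3
    · linear_combination (norm := module) -i3
    · linear_combination (norm := module) (1 / 2 : ℝ) • (r8 + r9)
    · linear_combination (norm := module) (1 / 2 : ℝ) • (i8 - i9)
    · linear_combination (norm := module) (1 / 2 : ℝ) • (i8 + i9)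
    · linear_combination (norm := module) (1 / 2 : ℝ) • (r9 - r8)

theorem wt_smul_add (lam mu : ℝˣ) {B : Type*} [Ring B] [Algebra ℝ B] (p q : B) :
    wtX lam mu • Cx.of p + wtx mu • Cx.of q =
      Cx.of ((lam / mu : ℝ) • p + (mu : ℝ) • q) - Complex.I • Cx.of ((lam : ℝ) • p - q) := by
  ext <;> simp [wtX, wtx, sub_eq_add_neg, add_comm]

/-- With P = (λ/μ) x⁰ + μ X₀ and Q = λ x⁰ − X₀ one has a x⁰ + b X₀ = P − iQ, and sinh(z(P − iQ)) has
the prescribed right-hand sides as its components. -/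
theorem quantumDoubleRelations_iff_cx (lam mu : ℝˣ) {B : Type*} [Ring B] [Algebra ℝ⟦X⟧ B]
    [Algebra ℝ B] [IsScalarTower ℝ ℝ⟦X⟧ B]
    [IsAdicComplete (Ideal.span {(PowerSeries.X : ℝ⟦X⟧)}) B] (x X : Fin 3 → B) :
    QuantumDoubleRelations lam mu x X ↔
      CxRelations (wtX lam mu) (wtx mu) (Cx.of (x 0)) (Cx.of (X 0)) ⟨x 1, x 2⟩
        (Cx.conj ⟨x 1, x 2⟩) ⟨X 1, X 2⟩ (Cx.conj ⟨X 1, X 2⟩)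
        ((2 : ℂ) • zsdiv (wtX lam mu • Cx.of (x 0) + wtx mu • Cx.of (X 0))) := by
  have key : Commute (x 0) (X 0) →
      zsdiv (wtX lam mu • Cx.of (x 0) + wtx mu • Cx.of (X 0)) =
      ⟨zEvalDiv sinhSeries ((lam / mu : ℝ) • x 0 + (mu : ℝ) • X 0) *
        zEval (PowerSeries.cos ℝ) ((lam : ℝ) • x 0 - X 0),
      -(zEvalDiv (PowerSeries.sin ℝ) ((lam : ℝ) • x 0 - X 0) *
        zEval coshSeries ((lam / mu : ℝ) • x 0 + (mu : ℝ) • X 0))⟩ := fun h => by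
    have hs : ∀ r s : ℝ, Commute (r • x 0) (s • X 0) := fun r s =>
      (h.smul_left r).smul_right s
    have hx : ∀ r s : ℝ, Commute (r • x 0) (s • x 0) := fun r s =>
      ((Commute.refl _).smul_left r).smul_right s
    have hX : ∀ r : ℝ, Commute (r • X 0) (X 0) := fun r => (Commute.refl _).smul_left r
    rw [wt_smul_add, Cx.zsdiv_of_sub_I_smul]
    refine Commute.add_left (Commute.sub_right (hx _ _) (h.smul_left _)) ?_
    exact (hs _ _).symm.sub_right (hX _)
  rw [quantumDoubleRelations_iff, doubleRelations_iff]
  constructor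
  · intro h
    -- The sinh can be split into components only once x⁰ and X₀ are known to commute, so this
    -- relation is extracted first.
    have h0 := congrArg Cx.re h.x_X.eq
    rw [key (show x 0 * X 0 = X 0 * x 0 by simpa using h0)]
    exact h
  · intro h
    have h0 := congrArg Cx.re h.x_X.eq
    rw [key (show x 0 * X 0 = X 0 * x 0 by simpa using h0)] at h
    exact h

end

noncomputable section

/-! ### The coproduct of the generators respects the relations -/

theorem Cx.map_csmul {B B' : Type*} [Ring B] [Algebra ℝ⟦X⟧ B] [Algebra ℝ B]
    [IsScalarTower ℝ ℝ⟦X⟧ B] [Ring B'] [Algebra ℝ⟦X⟧ B'] [Algebra ℝ B'] [IsScalarTower ℝ ℝ⟦X⟧ B']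
    (f : B →ₐ[ℝ⟦X⟧] B') (c : ℂ) (u : Cx B) : Cx.map f (c • u) = c • Cx.map f u := by
  ext <;> simp [map_smul_real]

/-- Both products can be reordered to w w' E E'. Passing E across w and passing E' across w' cost
the same central factor q, so the two orders agree. -/
theorem commute_of_qcommute {C : Type*} [Ring C] {E w E' w' q : C} (h : E * w = q * (w * E))
    (h' : E' * w' = q * (w' * E')) (hq : ∀ y, Commute y q) (hEE : Commute E E') (hww : Commute w w')
    (hEw : Commute E w') : Commute (E * w') (w * E') := by
  have h1 : E * w' * (w * E') = q * (w * w' * (E * E')) := by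
    rw [mul_assoc, ← mul_assoc w', ← hww.eq, ← mul_assoc, ← mul_assoc E, h]
    rw [mul_assoc q, mul_assoc w E, hEw.eq]
    simp only [mul_assoc]
  have h2 : w * E' * (E * w') = q * (w * w' * (E * E')) := by
    rw [mul_assoc, ← mul_assoc E', ← hEE.eq, mul_assoc E, h', ← mul_assoc E, (hq E).eq,
      ← mul_assoc w, ← mul_assoc w, (hq w).eq, mul_assoc q w, mul_assoc q, mul_assoc w E,
      ← mul_assoc E w', hEw.eq]
    simp only [mul_assoc]
  exact h1.trans h2.symm

section Comul

variable {C : Type*} [Ring C] [Algebra ℝ⟦X⟧ C] [Algebra ℂ C]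
  [IsAdicComplete (Ideal.span {(PowerSeries.X : ℝ⟦X⟧)}) C]

theorem commute_zexp_smul_one (c : ℂ) (w : C) : Commute w (zexp (c • (1 : C))) :=
  commute_zEval ((Commute.one_right w).smul_right c) _

/-- For w of weight β under Z, moving w to the left of γZ adds the scalar γβ. The factor e^{zγβ} is
written as the exponential of a multiple of 1, which is central. -/
theorem zexp_smul_mul {Z w : C} {β : ℂ} (h : Z * w - w * Z = β • w) (γ : ℂ) :
    zexp (γ • Z) * w = zexp ((γ * β) • (1 : C)) * (w * zexp (γ • Z)) := by
  have hs : SemiconjBy w ((γ * β) • (1 : C) + γ • Z) (γ • Z) := by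
    rw [SemiconjBy, mul_add, mul_smul_comm, mul_smul_comm, smul_mul_assoc, mul_one,
      eq_add_of_sub_eq h, smul_add, smul_smul]
  rw [zEval_mul_of_semiconj hs, ← mul_assoc, ← (commute_zexp_smul_one _ w).eq, mul_assoc]
  have hc : Commute ((γ * β) • (1 : C)) (γ • Z) :=
    ((Commute.one_left Z).smul_left _).smul_right _
  rw [zexp_add hc]

variable {A : Type*} [Ring A] [Algebra ℝ⟦X⟧ A] [Algebra ℂ A]
  [IsScalarTower ℝ ℝ⟦X⟧ A] [IsScalarTower ℝ ℝ⟦X⟧ C]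
  [IsAdicComplete (Ideal.span {(PowerSeries.X : ℝ⟦X⟧)}) A]
  {f g : A →ₐ[ℝ⟦X⟧] C} (hf : ∀ (c : ℂ) (y : A), f (c • y) = c • f y)
  (hg : ∀ (c : ℂ) (y : A), g (c • y) = c • g y) (hfg : ∀ p q : A, Commute (f p) (g q))

include hf hg hfg

/-- Read f p · g q as p ⊗ q. The mixed terms e^{−γZ} w ⊗ u e^{cY} and their counterparts commute by
`commute_of_qcommute`: the factors picked up in the two legs agree exactly when γβ_w + cβ_u = 0.
What remains are the commutators within one leg, multiplied by the merged exponentials. -/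
theorem comul_bracket {Z Y u w : A} {γ c βw βu : ℂ} (hZY : Commute Z Y)
    (hZw : Z * w - w * Z = βw • w)
    (hYu : Y * u - u * Y = βu • u) (hβ : γ * βw + c * βu = 0) :
    (zexp (-(γ • f Z)) * g u + f u * zexp (γ • g Z)) *
      (zexp (-(c • f Y)) * g w + f w * zexp (c • g Y)) -
      (zexp (-(c • f Y)) * g w + f w * zexp (c • g Y)) *
      (zexp (-(γ • f Z)) * g u + f u * zexp (γ • g Z)) =
    zexp (-(γ • f Z + c • f Y)) * g (u * w - w * u) +
      f (u * w - w * u) * zexp (γ • g Z + c • g Y) := by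
  have hE : zexp (-(γ • f Z)) = f (zexp ((-γ) • Z)) := by rw [map_zEval, hf, neg_smul]
  have hF : zexp (-(c • f Y)) = f (zexp ((-c) • Y)) := by rw [map_zEval, hf, neg_smul]
  have hE' : zexp (γ • g Z) = g (zexp (γ • Z)) := by rw [map_zEval, hg]
  have hF' : zexp (c • g Y) = g (zexp (c • Y)) := by rw [map_zEval, hg]
  have hfe : ∀ c : ℂ, f (zexp (c • (1 : A))) = zexp (c • (1 : C)) := fun c => by
    rw [map_zEval, hf, map_one]
  have hge : ∀ c : ℂ, g (zexp (c • (1 : A))) = zexp (c • (1 : C)) := fun c => by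
    rw [map_zEval, hg, map_one]
  have hZY' : ∀ r s : ℂ, Commute (r • Z) (s • Y) := fun r s => (hZY.smul_left r).smul_right s
  have c1 : Commute (f (zexp ((-γ) • Z)) * g u) (f w * g (zexp (c • Y))) := by
    refine commute_of_qcommute (q := zexp ((-γ * βw) • (1 : C))) ?_ ?_
      (commute_zexp_smul_one _) (hfg _ _) (hfg _ _) (hfg _ _)
    · rw [← map_mul, ← map_mul, ← hfe, ← map_mul, zexp_smul_mul hZw]
    · rw [← map_mul, ← map_mul, ← hge, ← map_mul, zexp_smul_mul hYu,
        show -γ * βw = c * βu by linear_combination -hβ]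
  have c2 : Commute (f (zexp ((-c) • Y)) * g w) (f u * g (zexp (γ • Z))) := by
    refine commute_of_qcommute (q := zexp ((-c * βu) • (1 : C))) ?_ ?_
      (commute_zexp_smul_one _) (hfg _ _) (hfg _ _) (hfg _ _)
    · rw [← map_mul, ← map_mul, ← hfe, ← map_mul, zexp_smul_mul hYu]
    · rw [← map_mul, ← map_mul, ← hge, ← map_mul, zexp_smul_mul hZw,
        show -c * βu = γ * βw by linear_combination -hβ]
  have c3 : zexp (-(γ • f Z + c • f Y)) = f (zexp ((-γ) • Z)) * f (zexp ((-c) • Y)) := by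
    rw [← map_mul, ← zexp_add (hZY' _ _), map_zEval, map_add, hf, hf]
    congr 1
    module
  have c4 : zexp (γ • g Z + c • g Y) = g (zexp (γ • Z)) * g (zexp (c • Y)) := by
    rw [← map_mul, ← zexp_add (hZY' _ _), map_zEval, map_add, hg, hg]
  have c5 : f (zexp ((-c) • Y)) * f (zexp ((-γ) • Z)) =
      f (zexp ((-γ) • Z)) * f (zexp ((-c) • Y)) := by
    rw [← map_mul, ← map_mul, (commute_zEval_zEval (hZY' _ _) _ _).eq]
  have c6 : g (zexp (c • Y)) * g (zexp (γ • Z)) = g (zexp (γ • Z)) * g (zexp (c • Y)) := by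
    rw [← map_mul, ← map_mul, (commute_zEval_zEval (hZY' _ _) _ _).eq]
  rw [hE, hF, hE', hF', c3, c4]
  generalize zexp ((-γ) • Z) = E at *
  generalize zexp ((-c) • Y) = F at *
  generalize zexp (γ • Z) = E' at *
  generalize zexp (c • Y) = F' at *
  have d1 : f E * g u * (f F * g w) = f E * f F * (g u * g w) := by
    rw [mul_assoc, ← mul_assoc (g u), ← (hfg F u).eq]; simp only [mul_assoc]
  have d2 : f F * g w * (f E * g u) = f E * f F * (g w * g u) := by
    rw [← c5, mul_assoc, ← mul_assoc (g w), ← (hfg E w).eq]; simp only [mul_assoc]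
  have d3 : f u * g E' * (f w * g F') = f u * f w * (g E' * g F') := by
    rw [mul_assoc, ← mul_assoc (g E'), ← (hfg w E').eq]; simp only [mul_assoc]
  have d4 : f w * g F' * (f u * g E') = f w * f u * (g E' * g F') := by
    rw [← c6, mul_assoc, ← mul_assoc (g F'), ← (hfg u F').eq]; simp only [mul_assoc]
  rw [add_mul, mul_add, mul_add, add_mul, mul_add, mul_add, d1, d2, d3, d4, c1.eq, c2.eq, map_sub,
    map_sub, map_mul, map_mul, map_mul, map_mul, mul_sub, sub_mul]
  abel

/-- The exponentials commute with Y, so the primitive element Y ⊗ 1 + 1 ⊗ Y acts only on the factor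
u in each summand. -/
theorem comul_weight {Z Y u : A} {γ β : ℂ} (hZY : Commute Z Y) (hY : Y * u - u * Y = β • u) :
    (g Y + f Y) * (zexp (-(γ • f Z)) * g u + f u * zexp (γ • g Z)) -
      (zexp (-(γ • f Z)) * g u + f u * zexp (γ • g Z)) * (g Y + f Y) =
    β • (zexp (-(γ • f Z)) * g u + f u * zexp (γ • g Z)) := by
  have hE : zexp (-(γ • f Z)) = f (zexp ((-γ) • Z)) := by rw [map_zEval, hf, neg_smul]
  have hE' : zexp (γ • g Z) = g (zexp (γ • Z)) := by rw [map_zEval, hg]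
  have hZ : ∀ γ : ℂ, Commute Y (zexp (γ • Z)) := fun γ =>
    commute_zEval (hZY.symm.smul_right γ) _
  have c1 := ((hZ (-γ)).map f).eq
  have c2 := ((hZ γ).map g).eq
  have c3 := congrArg f hY
  have c4 := congrArg g hY
  rw [map_sub, map_mul, map_mul, hf] at c3
  rw [map_sub, map_mul, map_mul, hg] at c4
  have e1 := (hfg (zexp ((-γ) • Z)) Y).eq
  have e2 := (hfg Y (zexp (γ • Z))).eq
  have e3 := (hfg Y u).eq
  have e4 := (hfg u Y).eq
  rw [hE, hE', smul_add, ← mul_smul_comm, ← smul_mul_assoc, ← c3, ← c4]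
  generalize f (zexp ((-γ) • Z)) = E at *
  generalize g (zexp (γ • Z)) = E' at *
  have d1 : g Y * (E * g u) = E * (g Y * g u) := by rw [← mul_assoc, ← e1, mul_assoc]
  have d2 : g Y * (f u * E') = f u * E' * g Y := by
    rw [← mul_assoc, ← e4, mul_assoc, c2, mul_assoc]
  have d3 : f Y * (E * g u) = E * g u * f Y := by
    rw [← mul_assoc, c1, mul_assoc, e3, mul_assoc]
  have d4 : f u * E' * f Y = f u * f Y * E' := by rw [mul_assoc, ← e2, mul_assoc]
  rw [add_mul, mul_add, mul_add, mul_add, add_mul, add_mul, d1, d2, d3, d4]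
  simp only [mul_sub, sub_mul, mul_assoc]
  abel

/-- The relations are satisfied by `Δ(x⁰)`, `Δ(X₀)`, `Δ(x¹ ± i x²)`, `Δ(X₁ ± i X₂)`. -/
theorem CxRelations.comul {a b : ℂ} (hab : a * conj b + conj a * b = 0) {x X u u' v v' t : A}
    (h : CxRelations a b x X u u' v v' ((2 : ℂ) • zsdiv (a • x + b • X)))
    (h' : CxRelations (conj a) (conj b) x X u' u v' v t) :
    CxRelations a b (g x + f x) (g X + f X)
      (zexp (-(a • f x)) * g u + f u * zexp (a • g x))
      (zexp (-(conj a • f x)) * g u' + f u' * zexp (conj a • g x))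
      (zexp (-(conj b • f X)) * g v + f v * zexp (conj b • g X))
      (zexp (-(b • f X)) * g v' + f v' * zexp (b • g X))
      ((2 : ℂ) • zsdiv (a • (g x + f x) + b • (g X + f X))) where
  x_X := ((h.x_X.map g).add_left (hfg _ _)).add_right ((hfg _ _).symm.add_left (h.x_X.map f))
  x_u := comul_weight hf hg hfg (Commute.refl x) h.x_u
  X_u := comul_weight hf hg hfg h.x_X h.X_u
  x_v := comul_weight hf hg hfg h.x_X.symm h.x_v
  X_v := comul_weight hf hg hfg (Commute.refl X) h.X_v
  -- The weight condition of `comul_bracket` is the orthogonality a b̄ + ā b = 0 here, and its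
  -- negative for v and v'.
  u_u' := by
    refine sub_eq_zero.1 ((comul_bracket hf hg hfg (Commute.refl x) h'.x_u h.x_u hab).trans ?_)
    rw [sub_eq_zero.2 h.u_u'.eq, map_zero, map_zero, mul_zero, zero_mul, add_zero]
  v_v' := by
    refine sub_eq_zero.1 ((comul_bracket hf hg hfg (Commute.refl X) h'.X_v h.X_v ?_).trans ?_)
    · rw [Complex.conj_conj]
      linear_combination -hab
    · rw [sub_eq_zero.2 h.v_v'.eq, map_zero, map_zero, mul_zero, zero_mul, add_zero]
  -- For u against v or v' the weight condition is automatic: the exponent in the coproduct of each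
  -- element is, up to sign, the weight of the other.
  u_v := by
    refine sub_eq_zero.1 ((comul_bracket hf hg hfg h.x_X h.x_v h.X_u ?_).trans ?_)
    · ring
    · rw [sub_eq_zero.2 h.u_v.eq, map_zero, map_zero, mul_zero, zero_mul, add_zero]
  u_v' := by
    refine (comul_bracket hf hg hfg h.x_X h'.x_v h.X_u ?_).trans ?_
    · rw [Complex.conj_conj]; ring
    -- The commutator is e^{−H} ⊗ t + t ⊗ e^{H} with t = 2 sinh(zH)/z, which the addition formula
    -- turns into the same function of H ⊗ 1 + 1 ⊗ H.
    · have hxX := (hfg (a • x + b • X) (a • x + b • X))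
      rw [h.u_v', hf, hg, map_zEvalDiv, map_zEvalDiv, mul_smul_comm, smul_mul_assoc, ← smul_add,
        ← hf, ← hf, ← hg, ← hg, ← map_add, ← map_add, ← zsdiv_add hxX]
      simp only [map_add, smul_add, hf, hg]
      congr 2
      abel

end Comul

end

noncomputable section

/-! ### Deformation of the classical relations -/

section Deform

variable {C : Type*} [Ring C] [Algebra ℂ C]

/-- The power series `cosh (√s X)`. -/
def coshSqrt (s : C) : C⟦X⟧ :=
  PowerSeries.mk fun k => PowerSeries.coeff k coshSeries • s ^ (k / 2)

/-- The divided difference `2 (cosh (√s X) - cosh (√t X)) / ((s - t) X²)`. -/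
def coshDiff (s t : C) : C⟦X⟧ :=
  PowerSeries.mk fun k => (2 * PowerSeries.coeff (k + 2) coshSeries : ℝ) •
    ∑ i ∈ Finset.range (k / 2 + 1), s ^ i * t ^ (k / 2 - i)

theorem coshSqrt_sq (t : C) : coshSqrt (t ^ 2) = fEval coshSeries t := by
  refine PowerSeries.ext fun n => ?_
  rw [coshSqrt, PowerSeries.coeff_mk, coeff_fEval]
  by_cases hn : Even n
  · rw [← pow_mul, Nat.two_mul_div_two_of_even hn]
  · simp [coshSeries, hn]

/-- The coefficients telescope by the geometric sum (s − t) ∑ sⁱ tᵐ⁻ⁱ = sᵐ⁺¹ − tᵐ⁺¹. Dividing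
differences of cosh in this way needs no inverse of s − t. -/
theorem X_sq_mul_sub_mul_coshDiff {s t : C} (h : Commute s t) :
    PowerSeries.X ^ 2 * (PowerSeries.C (s - t) * coshDiff s t) =
      2 * (coshSqrt s - coshSqrt t) := by
  refine PowerSeries.ext fun n => ?_
  rw [two_mul, map_add]
  -- Degrees 0 and 1 vanish on both sides: the constant term of cosh does not involve s, and there
  -- is no linear term.
  rcases n with _ | _ | n
  · simp [pow_two, mul_assoc, coshSqrt]
  · simp [pow_two, mul_assoc, coshSqrt, coshSeries, PowerSeries.coeff_succ_X_mul]
  · rw [pow_two, mul_assoc, PowerSeries.coeff_succ_X_mul, PowerSeries.coeff_succ_X_mul,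
      PowerSeries.coeff_C_mul, map_sub (PowerSeries.coeff (n + 1 + 1)), coshDiff, PowerSeries.coeff_mk, coshSqrt, coshSqrt,
      PowerSeries.coeff_mk, PowerSeries.coeff_mk, mul_smul_comm,
      show (n + 1 + 1) / 2 = n / 2 + 1 by omega]
    have := h.mul_geom_sum₂ (n / 2 + 1)
    simp only [Nat.add_sub_cancel] at this
    rw [this]
    module

theorem commute_coshDiff {b s t : C} (hs : Commute b s) (ht : Commute b t) :
    Commute (PowerSeries.C b) (coshDiff s t) := by
  refine PowerSeries.ext fun n => ?_
  rw [PowerSeries.coeff_C_mul, PowerSeries.coeff_mul_C, coshDiff, PowerSeries.coeff_mk]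
  exact (Commute.sum_right _ _ _ fun i _ => (hs.pow_right _).mul_right (ht.pow_right _)).smul_right _

theorem C_mul_coshDiff {b s t t' : C} (hs : Commute b s) (ht : SemiconjBy b t t') :
    PowerSeries.C b * coshDiff s t = coshDiff s t' * PowerSeries.C b := by
  refine PowerSeries.ext fun n => ?_
  rw [PowerSeries.coeff_C_mul, PowerSeries.coeff_mul_C, coshDiff, coshDiff, PowerSeries.coeff_mk,
    PowerSeries.coeff_mk, mul_smul_comm, smul_mul_assoc, Finset.mul_sum, Finset.sum_mul]
  refine congrArg _ (Finset.sum_congr rfl fun i _ => ?_)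
  exact (SemiconjBy.mul_right (hs.pow_right i) (ht.pow_right _)).eq

/-- The power series `sinh (κ X) / (κ X)`. -/
def sinhc (κ : ℂ) : ℂ⟦X⟧ :=
  PowerSeries.mk fun k => (PowerSeries.coeff (k + 1) sinhSeries : ℝ) * κ ^ k

/-- The power series `κ X / sinh (κ X)`. -/
def invSinhc (κ : ℂ) : C⟦X⟧ := PowerSeries.map (algebraMap ℂ C) (sinhc κ)⁻¹

theorem commute_invSinhc (κ : ℂ) (f : C⟦X⟧) : Commute (invSinhc κ) f := by
  refine PowerSeries.ext fun n => ?_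
  rw [PowerSeries.coeff_mul, PowerSeries.coeff_mul, ← Finset.Nat.sum_antidiagonal_swap]
  refine Finset.sum_congr rfl fun p _ => ?_
  rw [invSinhc, PowerSeries.coeff_map, PowerSeries.coeff_map]
  exact Algebra.commutes _ _

theorem constantCoeff_invSinhc (κ : ℂ) :
    PowerSeries.constantCoeff (invSinhc κ : C⟦X⟧) = 1 := by
  rw [invSinhc, ← PowerSeries.coeff_zero_eq_constantCoeff_apply, PowerSeries.coeff_map,
    PowerSeries.coeff_zero_eq_constantCoeff_apply, PowerSeries.constantCoeff_inv]
  simp [sinhc, sinhSeries]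

/-- The scalar series sinh(κX)/(κX) has constant term 1, so it is invertible even for κ = 0. -/
theorem invSinhc_mul_fsdiv (κ : ℂ) :
    invSinhc κ * fsdiv (κ • (1 : C)) = PowerSeries.C (algebraMap ℂ C κ) := by
  have h : fsdiv (κ • (1 : C)) =
      PowerSeries.map (algebraMap ℂ C) (sinhc κ * PowerSeries.C κ) := by
    refine PowerSeries.ext fun n => ?_
    rw [coeff_fEvalDiv, PowerSeries.coeff_map, PowerSeries.coeff_mul_C, sinhc, PowerSeries.coeff_mk,
      smul_pow, one_pow, ← Complex.coe_smul, smul_smul, Algebra.algebraMap_eq_smul_one, pow_succ,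
      mul_assoc]
  rw [h, invSinhc, ← map_mul, ← mul_assoc, PowerSeries.inv_mul_cancel, one_mul,
    PowerSeries.map_C]
  simp [sinhc, sinhSeries]

/-- The leading coefficient is twice the coefficient 1/2 of cosh. Hence the deformation factor is 1
modulo z and the classical limit of u is unchanged. -/
theorem constantCoeff_coshDiff (s t : C) : PowerSeries.constantCoeff (coshDiff s t) = 1 := by
  rw [coshDiff, PowerSeries.constantCoeff_mk]
  simp [coshSeries]

theorem two_fcosh_sub (κ : ℂ) (H : C) :
    2 * fEval coshSeries (H + κ • (1 : C)) - 2 * fEval coshSeries (H - κ • (1 : C)) =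
      (2 * (PowerSeries.X * fsdiv H)) * (2 * (PowerSeries.X * fsdiv (κ • (1 : C)))) := by
  have hc : Commute H (κ • (1 : C)) := (Commute.one_right H).smul_right κ
  rw [two_mul_fcosh, two_mul_fcosh, two_X_mul_fsdiv, two_X_mul_fsdiv, neg_add, neg_sub,
    sub_eq_add_neg H, sub_eq_neg_add (κ • (1 : C)), fexp_add hc, fexp_add hc.neg_right,
    fexp_add hc.neg_left, fexp_add hc.neg_left.neg_right]
  noncomm_ring

variable {a b : ℂ} {x X u u' v v' : C}

theorem CxRelations.commute_v_of_conj {t : C}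
    (h : CxRelations a b x X u u' v v' t) {r s : ℂ} (hrs : r * conj b + conj a * s = 0) :
    Commute (r • x + s • X) v := by
  refine sub_eq_zero.1 ?_
  have : (r • x + s • X) * v - v * (r • x + s • X) =
      r • (x * v - v * x) + s • (X * v - v * X) := by
    simp only [add_mul, mul_add, smul_mul_assoc, mul_smul_comm]; module
  rw [this, h.x_v, h.X_v]
  rw [mul_comm (conj a)] at hrs
  linear_combination (norm := module) -hrs • v

theorem CxRelations.lie_u {t : C} (h : CxRelations a b x X u u' v v' t) (r s : ℂ) :
    (r • x + s • X) * u - u * (r • x + s • X) = (r * b + s * a) • u := by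
  have : (r • x + s • X) * u - u * (r • x + s • X) =
      r • (x * u - u * x) + s • (X * u - u * X) := by
    simp only [add_mul, mul_add, smul_mul_assoc, mul_smul_comm]; module
  rw [this, h.x_u, h.X_u]
  module

variable (a b x X u v')

/-- The square of the Cartan element of one half of the double, shifted. -/
def cartanSq : C := (a • x + b • X + (a * b) • (1 : C)) ^ 2

/-- The (shifted and normalized) Casimir element of one half of the double. -/
def casimir : C := (2 * (a * b)) • (v' * u) + cartanSq a b x X

/-- The factor by which the root vector `u` is deformed. -/
def deformFactor : C⟦X⟧ :=
  invSinhc (a * b) * coshDiff (casimir a b x X u v') (cartanSq a b x X)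

variable {a b x X u v'}

end Deform

section Deform2

variable {C : Type*} [Ring C] [Algebra ℂ C]
  {a b : ℂ} {x X u u' v v' t : C}
  (h : CxRelations a b x X u u' v v' ((2 : ℂ) • (a • x + b • X)))
  (h' : CxRelations (conj a) (conj b) x X u' u v' v t)

include h h'

/-- The factors v' and u have opposite weights under every combination of x and X. -/
theorem commute_cartan_mul {r s : ℂ} : Commute (r • x + s • X) (v' * u) := by
  have h1 := h.lie_u r s
  have h2 : (r • x + s • X) * v' - v' * (r • x + s • X) = -(r * b + s * a) • v' := by
    have : (r • x + s • X) * v' - v' * (r • x + s • X) =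
        r • (x * v' - v' * x) + s • (X * v' - v' * X) := by
      simp only [add_mul, mul_add, smul_mul_assoc, mul_smul_comm]; module
    rw [this, h'.x_v, h'.X_v, Complex.conj_conj, Complex.conj_conj]
    module
  refine sub_eq_zero.1 ?_
  have : (r • x + s • X) * (v' * u) - v' * u * (r • x + s • X) =
      ((r • x + s • X) * v' - v' * (r • x + s • X)) * u +
        v' * ((r • x + s • X) * u - u * (r • x + s • X)) := by noncomm_ring
  rw [this, h1, h2, smul_mul_assoc, mul_smul_comm]
  module

omit h' in
theorem commute_cartan_cartan (r s r' s' : ℂ) : Commute (r • x + s • X) (r' • x + s' • X) := by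
  have hs : ∀ c d : ℂ, ∀ {y z : C}, Commute y z → Commute (c • y) (d • z) :=
    fun c d y z hyz => (hyz.smul_left c).smul_right d
  exact ((hs _ _ (Commute.refl x)).add_right (hs _ _ h.x_X)).add_left
    ((hs _ _ h.x_X.symm).add_right (hs _ _ (Commute.refl X)))

omit h' in
theorem commute_cartan_cartanSq (r s : ℂ) : Commute (r • x + s • X) (cartanSq a b x X) :=
  ((commute_cartan_cartan h r s a b).add_right
    ((Commute.one_right _).smul_right _)).pow_right 2

theorem commute_cartan_casimir (r s : ℂ) : Commute (r • x + s • X) (casimir a b x X u v') :=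
  ((commute_cartan_mul h h').smul_right _).add_right (commute_cartan_cartanSq h r s)

omit h' in
-- With H = a x + b X the weight of u under H is 2ab, so moving u to the right across H − ab gives H
-- + ab.
theorem semiconj_cartanSq : SemiconjBy u (cartanSq a b x X)
    ((a • x + b • X - (a * b) • (1 : C)) ^ 2) := by
  refine SemiconjBy.pow_right ?_ 2
  have := h.lie_u a b
  rw [SemiconjBy, mul_add, sub_mul, eq_add_of_sub_eq this, mul_smul_comm, smul_mul_assoc, mul_one,
    one_mul]
  module

omit h h' in
theorem cartanSq_sub (a b : ℂ) (x X : C) :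
    cartanSq a b x X - (a • x + b • X - (a * b) • (1 : C)) ^ 2 =
    (4 * (a * b)) • (a • x + b • X) := by
  rw [cartanSq, pow_two, pow_two]
  simp only [add_mul, mul_add, sub_mul, mul_sub, smul_mul_assoc, mul_smul_comm, one_mul, mul_one]
  module

omit h' in
-- Reversing the order of v' and u costs [u, v'] = 2H, which is absorbed by (H + ab)² − (H − ab)² =
-- 4ab H. The Casimir element thus has a second form, with u v' and the opposite shift.
theorem casimir_sub : casimir a b x X u v' - (a • x + b • X - (a * b) • (1 : C)) ^ 2 =
    (2 * (a * b)) • (u * v') := by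
  rw [eq_add_of_sub_eq h.u_v', casimir, add_sub_assoc, cartanSq_sub]
  module

omit h' in
-- The product with u on the left is computed from the form with v'u, the product with u on the
-- right from the form with u v'; both equal 2ab u v'u + (H − ab)² u.
theorem commute_u_casimir : Commute u (casimir a b x X u v') := by
  have h1 := casimir_sub h
  have h2 : u * casimir a b x X u v' = (2 * (a * b)) • (u * v' * u) +
      (a • x + b • X - (a * b) • (1 : C)) ^ 2 * u := by
    rw [casimir, mul_add, (semiconj_cartanSq h).eq, mul_smul_comm, mul_assoc]
  have h3 : casimir a b x X u v' * u = (2 * (a * b)) • (u * v') * u +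
      (a • x + b • X - (a * b) • (1 : C)) ^ 2 * u := by
    rw [← h1]; noncomm_ring
  rw [commute_iff_eq, h2, h3, smul_mul_assoc]

omit h h' in
theorem commute_C_deformFactor {y : C} (h1 : Commute y (cartanSq a b x X))
    (h2 : Commute y (casimir a b x X u v')) :
    Commute (PowerSeries.C y) (deformFactor a b x X u v') :=
  (commute_invSinhc _ _).symm.mul_right (commute_coshDiff h2 h1)

/-- In the first product u is moved across the factor, which replaces y by (H − κ)². Then both
products are of the form (w − s) times a divided difference of cosh √w and cosh √s, with s = (H ∓
κ)². Their difference is cosh(H + κ) − cosh(H − κ), a product of two sinh, and the normalization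
`invSinhc` removes sinh κ. -/
theorem lie_deform (hab : a * b ≠ 0) :
    PowerSeries.C u * deformFactor a b x X u v' * PowerSeries.C v' -
      PowerSeries.C v' * (PowerSeries.C u * deformFactor a b x X u v') =
    2 * fsdiv (a • x + b • X) := by
  set κ := a * b with hκ
  set H := a • x + b • X with hH
  set w := casimir a b x X u v' with hw
  set y := cartanSq a b x X with hy
  set ym := (H - κ • (1 : C)) ^ 2 with hym
  set S : C⟦X⟧ := invSinhc κ
  have hS : ∀ f : C⟦X⟧, f * S = S * f := fun f => ((commute_invSinhc κ f).eq).symm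
  have cy : Commute w y := by
    have h1 : Commute w H := (commute_cartan_casimir h h' a b).symm
    exact (h1.add_right ((Commute.one_right _).smul_right _)).pow_right 2
  have cym : Commute w ym := by
    have h1 : Commute w H := (commute_cartan_casimir h h' a b).symm
    exact (h1.sub_right ((Commute.one_right _).smul_right _)).pow_right 2
  have e1 : PowerSeries.X ^ 2 * (PowerSeries.C ((2 * κ) • (v' * u)) * coshDiff w y) =
      2 * (coshSqrt w - fEval coshSeries (H + κ • (1 : C))) := by
    rw [← coshSqrt_sq, show (2 * κ) • (v' * u) = w - y by rw [hw, casimir, add_sub_cancel_right]]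
    exact X_sq_mul_sub_mul_coshDiff cy
  have e2 : PowerSeries.X ^ 2 * (PowerSeries.C ((2 * κ) • (u * v')) * coshDiff w ym) =
      2 * (coshSqrt w - fEval coshSeries (H - κ • (1 : C))) := by
    rw [← coshSqrt_sq, ← casimir_sub h]
    exact X_sq_mul_sub_mul_coshDiff cym
  have e3 : PowerSeries.C u * coshDiff w y = coshDiff w ym * PowerSeries.C u :=
    C_mul_coshDiff (commute_u_casimir h) (semiconj_cartanSq h)
  have e4 : Commute (PowerSeries.C ((2 * κ) • (u * v'))) (coshDiff w ym) := by
    rw [← casimir_sub h]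
    exact commute_coshDiff ((Commute.refl w).sub_left cym.symm)
      (cym.sub_left (Commute.refl ym))
  have hC : ∀ (c : ℂ) (y : C), PowerSeries.C (c • y) =
      PowerSeries.C (algebraMap ℂ C c) * PowerSeries.C y := fun c y => by
    rw [← map_mul, Algebra.smul_def]
  -- The factor X² clears the divided differences, and 2κ turns v'u and u v' into w − (H ± κ)². Both
  -- are cancelled at the end.
  have key : PowerSeries.X ^ 2 * (PowerSeries.C (algebraMap ℂ C (2 * κ)) *
      (PowerSeries.C u * deformFactor a b x X u v' * PowerSeries.C v' -
      PowerSeries.C v' * (PowerSeries.C u * deformFactor a b x X u v'))) =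
      PowerSeries.X ^ 2 * (PowerSeries.C (algebraMap ℂ C (2 * κ)) *
        (2 * fsdiv (a • x + b • X))) := by
    have l1 : PowerSeries.C u * deformFactor a b x X u v' * PowerSeries.C v' =
        S * (coshDiff w ym * PowerSeries.C (u * v')) := by
      rw [deformFactor, ← mul_assoc, hS, mul_assoc S, e3, map_mul, mul_assoc, mul_assoc]
    have l2 : PowerSeries.C v' * (PowerSeries.C u * deformFactor a b x X u v') =
        S * (PowerSeries.C (v' * u) * coshDiff w y) := by
      rw [deformFactor, ← mul_assoc, ← map_mul, ← mul_assoc, hS, mul_assoc]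
    have hcen : ∀ (c : ℂ) (f : C⟦X⟧), f * PowerSeries.C (algebraMap ℂ C c) =
        PowerSeries.C (algebraMap ℂ C c) * f := fun c f => PowerSeries.ext fun n => by
      rw [PowerSeries.coeff_mul_C, PowerSeries.coeff_C_mul, Algebra.commutes]
    have hX : ∀ f : C⟦X⟧, f * PowerSeries.X ^ 2 = PowerSeries.X ^ 2 * f := fun f =>
      (PowerSeries.commute_X_pow f 2).eq
    have l3 : PowerSeries.X ^ 2 * (PowerSeries.C (algebraMap ℂ C (2 * κ)) *
        (S * (coshDiff w ym * PowerSeries.C (u * v')))) =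
        S * (2 * (coshSqrt w - fEval coshSeries (H - κ • (1 : C)))) := by
      rw [← e2, e4.eq, hC]
      simp only [← mul_assoc]
      rw [hX S, mul_assoc (PowerSeries.X ^ 2) _ S, ← hcen _ S,
        mul_assoc (PowerSeries.X ^ 2 * S) (coshDiff w ym), hcen _ (coshDiff w ym)]
      simp only [mul_assoc]
    have l4 : PowerSeries.X ^ 2 * (PowerSeries.C (algebraMap ℂ C (2 * κ)) *
        (S * (PowerSeries.C (v' * u) * coshDiff w y))) =
        S * (2 * (coshSqrt w - fEval coshSeries (H + κ • (1 : C)))) := by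
      rw [← e1, hC]
      simp only [← mul_assoc]
      rw [hX S, mul_assoc (PowerSeries.X ^ 2) _ S, ← hcen]
      simp only [mul_assoc]
    -- The two contributions of cosh √w cancel; no square root of the Casimir element survives.
    have l5 : S * (2 * (coshSqrt w - fEval coshSeries (H - κ • (1 : C)))) -
        S * (2 * (coshSqrt w - fEval coshSeries (H + κ • (1 : C)))) =
        S * ((2 * (PowerSeries.X * fsdiv H)) * (2 * (PowerSeries.X * fsdiv (κ • (1 : C))))) := by
      rw [← two_fcosh_sub]
      noncomm_ring
    have l6 : S * ((2 * (PowerSeries.X * fsdiv H)) *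
        (2 * (PowerSeries.X * fsdiv (κ • (1 : C))))) = PowerSeries.X ^ 2 *
          (2 * (2 * (fsdiv H * (S * fsdiv (κ • (1 : C)))))) := by
      have : (2 * (PowerSeries.X * fsdiv H)) * (2 * (PowerSeries.X * fsdiv (κ • (1 : C)))) =
          PowerSeries.X ^ 2 * (2 * (2 * (fsdiv H * fsdiv (κ • (1 : C))))) := by
        simp only [two_mul, mul_add, add_mul, pow_two]
        simp only [mul_assoc]
        simp only [← mul_assoc (fsdiv H) PowerSeries.X, ← PowerSeries.X_mul]
        simp only [mul_assoc]
      rw [this, ← mul_assoc, hX, mul_assoc]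
      congr 1
      rw [← mul_assoc (fsdiv H) S, hS]
      noncomm_ring
    rw [l1, l2, mul_sub, mul_sub, l3, l4, l5, l6, invSinhc_mul_fsdiv, hcen]
    have l7 : PowerSeries.C (algebraMap ℂ C (2 * κ)) = 2 * PowerSeries.C (algebraMap ℂ C κ) := by
      rw [map_mul (algebraMap ℂ C), map_mul PowerSeries.C, map_ofNat, map_ofNat]
    rw [l7, ← hH]
    simp only [two_mul, mul_add, add_mul]
  have key2 := PowerSeries.X_pow_mul_cancel key
  have hinv : PowerSeries.C (algebraMap ℂ C (2 * κ)⁻¹) * PowerSeries.C (algebraMap ℂ C (2 * κ)) =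
      1 := by
    rw [← map_mul, ← map_mul, inv_mul_cancel₀ (mul_ne_zero two_ne_zero hab), map_one, map_one]
  have := congrArg (PowerSeries.C (algebraMap ℂ C (2 * κ)⁻¹) * ·) key2
  simpa only [← mul_assoc, hinv, one_mul] using this

end Deform2

/-! ### Deformation of one half compatible with conjugation -/

section DeformCx

open Cx

theorem Commute.of_conj {B : Type*} [Ring B] {s t : Cx B} (h : Commute (Cx.conj s) t) :
    Commute s (Cx.conj t) := by
  simpa using h.map Cx.conj

variable {B : Type*} [Ring B] [Algebra ℝ B] {a b : ℂ} {p q : B} {u v : Cx B}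

theorem conj_cartanSq (a b : ℂ) (x X : Cx B) : Cx.conj (cartanSq a b x X) =
    cartanSq (conj a) (conj b) (Cx.conj x) (Cx.conj X) := by
  simp [cartanSq, conj_smul]

theorem conj_casimir (a b : ℂ) (x X u v' : Cx B) : Cx.conj (casimir a b x X u v') =
    casimir (conj a) (conj b) (Cx.conj x) (Cx.conj X) (Cx.conj u) (Cx.conj v') := by
  simp [casimir, conj_cartanSq, conj_smul, map_ofNat]


variable [Algebra ℝ⟦X⟧ B]
  [IsAdicComplete (Ideal.span {(PowerSeries.X : ℝ⟦X⟧)}) B]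

/-- The factor g is a function of w and y, which belong to the half of u and v̄. It commutes with
x⁰, X₀, with ū and v from the other half, and with ḡ. Replacing u by u g therefore changes only the
bracket [u, v̄]. -/
theorem CxRelations.deform (hab : a * conj b + conj a * b = 0) (hab0 : a * b ≠ 0)
    (h : CxRelations a b (of p) (of q) u (Cx.conj u) v (Cx.conj v)
      ((2 : ℂ) • (a • of p + b • of q))) :
    CxRelations a b (of p) (of q)
      (u * zsum _ (deformFactor a b (of p) (of q) u (Cx.conj v)))
      (Cx.conj (u * zsum _ (deformFactor a b (of p) (of q) u (Cx.conj v)))) v (Cx.conj v)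
      ((2 : ℂ) • zsdiv (a • of p + b • of q)) := by
  have h' := h.conj
  set g := zsum _ (deformFactor a b (of p) (of q) u (Cx.conj v)) with hg
  set w := casimir a b (of p) (of q) u (Cx.conj v) with hw
  set y := cartanSq a b (of p) (of q) with hy
  have hgc : ∀ s : Cx B, Commute s w → Commute s y → Commute s g := fun s h1 h2 => by
    simpa only [zsum_C] using (commute_C_deformFactor h2 h1).map (zsum (Cx B))
  -- A Cartan combination orthogonal to the weights of ū commutes with ū; by `hab` this applies to a
  -- x⁰ + b X₀.
  have cart_u : ∀ r s : ℂ, r * conj b + conj a * s = 0 →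
      Commute (r • of p + s • of q) (Cx.conj u) := fun r s hrs => by
    refine sub_eq_zero.1 ?_
    rw [h'.lie_u, mul_comm s, hrs, zero_smul]
  have y_u' : Commute (Cx.conj u) y :=
    (((cart_u a b hab).symm).add_right ((Commute.one_right _).smul_right _)).pow_right 2
  have y_v : Commute v y :=
    (((h.commute_v_of_conj hab).symm).add_right
      ((Commute.one_right _).smul_right _)).pow_right 2
  have w_u' : Commute (Cx.conj u) w :=
    ((h'.u_v.mul_right h.u_u'.symm).smul_right _).add_right y_u'
  have w_v : Commute v w := ((h.v_v'.mul_right h.u_v.symm).smul_right _).add_right y_v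
  have x_y : ∀ r s : ℂ, Commute (r • of p + s • of q) y := commute_cartan_cartanSq h
  have x_w : ∀ r s : ℂ, Commute (r • of p + s • of q) w := commute_cartan_casimir h h'
  have cy : Cx.conj y = cartanSq (conj a) (conj b) (of p) (of q) := by
    rw [hy, conj_cartanSq, conj_of, conj_of]
  have cw : Cx.conj w = (2 * (conj a * conj b)) • (v * Cx.conj u) + Cx.conj y := by
    rw [cy, hw, conj_casimir, conj_of, conj_of, conj_conj]
    rfl
  -- The conjugate of y is the square of an affine expression in x⁰ and X₀, so it commutes with
  -- everything that commutes with their combinations.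
  have y'_of : ∀ s : Cx B, (∀ r t : ℂ, Commute (r • of p + t • of q) s) →
      Commute (Cx.conj y) s := fun s hs => by
    rw [cy]
    exact ((hs _ _).add_left ((Commute.one_left _).smul_left _)).pow_left 2
  have y'_y : Commute (Cx.conj y) y := y'_of y x_y
  have y'_w : Commute (Cx.conj y) w := y'_of w x_w
  have w'_w : Commute (Cx.conj w) w := by
    rw [cw]
    exact ((w_v.mul_left w_u').smul_left _).add_left y'_w
  have w'_y : Commute (Cx.conj w) y := by
    rw [cw]
    exact ((y_v.mul_left y_u').smul_left _).add_left y'_y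
  -- Conjugation turns commutation of g with w̄ and ȳ into commutation of ḡ with w and y. It follows
  -- that ḡ commutes with g, as [u g, ū ḡ] = 0 requires.
  have g_w : Commute w (Cx.conj g) := (hgc _ w'_w w'_y).of_conj
  have g_y : Commute y (Cx.conj g) := (hgc _ y'_w y'_y).of_conj
  have g_g : Commute (Cx.conj g) g := hgc _ g_w.symm g_y.symm
  have g_u' : Commute (Cx.conj u) g := hgc _ w_u' y_u'
  have g_v : Commute v g := hgc _ w_v y_v
  have g_x : Commute (of p) g := by
    refine hgc _ ?_ ?_
    · simpa using x_w 1 0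
    · simpa using x_y 1 0
  have g_X : Commute (of q) g := by
    refine hgc _ ?_ ?_
    · simpa using x_w 0 1
    · simpa using x_y 0 1
  have u_g : Commute u (Cx.conj g) := g_u'.of_conj
  refine ⟨h.x_X, ?_, ?_, h.x_v, h.X_v, ?_, h.v_v', ?_, ?_⟩
  · rw [mul_assoc u, ← g_x.eq, ← mul_assoc, ← mul_assoc, ← sub_mul, h.x_u, smul_mul_assoc]
  · rw [mul_assoc u, ← g_X.eq, ← mul_assoc, ← mul_assoc, ← sub_mul, h.X_u, smul_mul_assoc]
  · rw [map_mul]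
    exact (h.u_u'.mul_right u_g).mul_left (g_u'.symm.mul_right g_g.symm)
  · exact h.u_v.mul_left g_v.symm
  · have := congrArg (zsum (Cx B)) (lie_deform h h' hab0)
    rw [map_sub, map_mul, map_mul, map_mul, map_mul, map_mul, zsum_C, zsum_C, map_ofNat,
      zsum_fEvalDiv] at this
    rw [this, ofNat_smul_eq_nsmul, nsmul_eq_mul, Nat.cast_ofNat]

end DeformCx

end

noncomputable section

/-! ### Formal power series over a real algebra as an algebra over `ℝ⟦X⟧` -/

/-- The algebra `R⟦z⟧` for a real algebra `R`. -/
def Formal (R : Type*) : Type _ := PowerSeries R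

namespace Formal

variable {R : Type*} [Ring R] [Algebra ℝ R]

instance : Ring (Formal R) := inferInstanceAs (Ring R⟦X⟧)

/-- The elements of `R⟦z⟧` as power series. -/
def toPS : Formal R ≃+* R⟦X⟧ := RingEquiv.refl _

/-- The structure map `ℝ⟦z⟧ → R⟦z⟧`. -/
def scalar : ℝ⟦X⟧ →+* Formal R :=
  (toPS (R := R)).symm.toRingHom.comp (PowerSeries.map (algebraMap ℝ R))

theorem toPS_scalar (c : ℝ⟦X⟧) :
    toPS (scalar c : Formal R) = PowerSeries.map (algebraMap ℝ R) c := rfl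

instance : Algebra ℝ⟦X⟧ (Formal R) :=
  RingHom.toAlgebra' scalar fun c f => toPS.injective (by
    rw [map_mul, map_mul, toPS_scalar]
    refine PowerSeries.ext fun n => ?_
    rw [PowerSeries.coeff_mul, PowerSeries.coeff_mul, ← Finset.Nat.sum_antidiagonal_swap]
    refine Finset.sum_congr rfl fun p _ => ?_
    rw [PowerSeries.coeff_map]
    exact Algebra.commutes _ _)

theorem toPS_algebraMap (c : ℝ⟦X⟧) :
    toPS (algebraMap ℝ⟦X⟧ (Formal R) c) = PowerSeries.map (algebraMap ℝ R) c := rfl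

instance : Algebra ℝ (Formal R) := Algebra.compHom (Formal R) (algebraMap ℝ ℝ⟦X⟧)

instance : IsScalarTower ℝ ℝ⟦X⟧ (Formal R) := IsScalarTower.of_algebraMap_eq fun _ => rfl

theorem toPS_algebraMap_real (c : ℝ) :
    toPS (algebraMap ℝ (Formal R) c) = PowerSeries.C (algebraMap ℝ R c) := by
  rw [IsScalarTower.algebraMap_apply ℝ ℝ⟦X⟧ (Formal R), toPS_algebraMap,
    ← PowerSeries.C_eq_algebraMap, PowerSeries.map_C]

theorem toPS_X_pow_smul (n : ℕ) (f : Formal R) :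
    toPS ((PowerSeries.X : ℝ⟦X⟧) ^ n • f) = PowerSeries.X ^ n * toPS f := by
  rw [Algebra.smul_def, map_mul, toPS_algebraMap, map_pow, PowerSeries.map_X]

theorem toPS_X_smul (f : Formal R) :
    toPS ((PowerSeries.X : ℝ⟦X⟧) • f) = PowerSeries.X * toPS f := by
  simpa using toPS_X_pow_smul 1 f

theorem eq_zero_of_X_smul {f : Formal R} (h : (PowerSeries.X : ℝ⟦X⟧) • f = 0) : f = 0 := by
  apply toPS.injective
  rw [map_zero]
  refine PowerSeries.X_mul_cancel ?_
  rw [← toPS_X_smul, h, map_zero, mul_zero]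

/-- The constants `R ⊆ R⟦z⟧`. -/
def const : R →ₐ[ℝ] Formal R :=
  { (toPS (R := R)).symm.toRingHom.comp PowerSeries.C with
    commutes' := fun r => toPS.injective (toPS_algebraMap_real r).symm }

/-- The reduction modulo `z`. -/
def constCoeff : Formal R →ₐ[ℝ] R :=
  { (PowerSeries.constantCoeff : R⟦X⟧ →+* R).comp (toPS (R := R)).toRingHom with
    commutes' := fun r => (congrArg PowerSeries.constantCoeff (toPS_algebraMap_real r)).trans
      (PowerSeries.constantCoeff_C _) }

theorem toPS_const (r : R) : toPS (const r) = PowerSeries.C r := rfl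

theorem constCoeff_apply (f : Formal R) :
    constCoeff f = PowerSeries.constantCoeff (toPS f) := rfl

@[simp] theorem constCoeff_const (r : R) : constCoeff (const r) = r :=
  PowerSeries.constantCoeff_C r

@[simp] theorem constCoeff_X_smul (f : Formal R) :
    constCoeff ((PowerSeries.X : ℝ⟦X⟧) • f) = 0 := by
  rw [constCoeff_apply, toPS_X_smul, map_mul, PowerSeries.constantCoeff_X, zero_mul]

theorem exists_eq_const_add (f : Formal R) :
    ∃ g : Formal R, f = const (constCoeff f) + (PowerSeries.X : ℝ⟦X⟧) • g := by
  refine ⟨toPS.symm (PowerSeries.mk fun k => PowerSeries.coeff (k + 1) (toPS f)), ?_⟩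
  apply toPS.injective
  rw [map_add, toPS_X_smul, toPS_const, RingEquiv.apply_symm_apply, constCoeff_apply]
  exact (PowerSeries.eq_X_mul_shift_add_const (toPS f)).trans (add_comm _ _)

theorem constCoeff_eq_zero_iff (f : Formal R) :
    constCoeff f = 0 ↔ ∃ g : Formal R, f = (PowerSeries.X : ℝ⟦X⟧) • g := by
  constructor
  · intro h
    obtain ⟨g, hg⟩ := exists_eq_const_add f
    exact ⟨g, by rw [hg, h, map_zero, zero_add]⟩
  · rintro ⟨g, rfl⟩
    exact constCoeff_X_smul g

instance : IsAdicComplete (Ideal.span {(PowerSeries.X : ℝ⟦X⟧)}) (Formal R) := by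
  refine isAdicComplete_of_hasZSum (fun a ha => ?_) fun c => ?_
  · apply toPS.injective
    refine PowerSeries.ext fun n => ?_
    obtain ⟨b, hb⟩ := ha (n + 1)
    rw [hb, toPS_X_pow_smul, PowerSeries.coeff_X_pow_mul', if_neg (by omega), map_zero, map_zero]
  · let a : R⟦X⟧ := PowerSeries.mk fun n =>
      ∑ k ∈ Finset.range (n + 1), PowerSeries.coeff (n - k) (toPS (c k))
    refine ⟨toPS.symm a, fun n => ?_⟩
    let s : R⟦X⟧ := ∑ k ∈ Finset.range n, PowerSeries.X ^ k * toPS (c k)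
    refine ⟨toPS.symm (PowerSeries.mk fun m => PowerSeries.coeff (m + n) (a - s)), ?_⟩
    apply toPS.injective
    rw [map_add, map_sum, toPS_X_pow_smul]
    simp only [toPS_X_pow_smul, RingEquiv.apply_symm_apply]
    change a = s + _
    refine PowerSeries.ext fun m => ?_
    rw [map_add, PowerSeries.coeff_X_pow_mul']
    split_ifs with h
    · rw [PowerSeries.coeff_mk (m - n), Nat.sub_add_cancel h, map_sub, add_sub_cancel]
    · rw [add_zero, PowerSeries.coeff_mk, map_sum]
      obtain ⟨d, rfl⟩ : ∃ d, n = m + 1 + d := Nat.exists_eq_add_of_le (by omega)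
      rw [Finset.sum_range_add _ (m + 1) d]
      have : ∀ k ∈ Finset.range d,
          PowerSeries.coeff m (PowerSeries.X ^ (m + 1 + k) * toPS (c (m + 1 + k))) = 0 :=
        fun k _ => by rw [PowerSeries.coeff_X_pow_mul', if_neg (by omega)]
      rw [Finset.sum_eq_zero this, add_zero]
      refine Finset.sum_congr rfl fun k hk => ?_
      rw [PowerSeries.coeff_X_pow_mul', if_pos (Nat.lt_succ_iff.1 (Finset.mem_range.1 hk))]

end Formal

/-! ### Brackets of the classical double -/

namespace S3Double

variable (lam mu : ℝˣ)

theorem fst_smul_ap (t : ℝ) (w : S3Double lam mu) (i : Fin 3) : (t • w).1 i = t * w.1 i := rfl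
theorem snd_smul_ap (t : ℝ) (w : S3Double lam mu) (i : Fin 3) : (t • w).2 i = t * w.2 i := rfl
theorem fst_sub_ap (u v : S3Double lam mu) (i : Fin 3) : (u - v).1 i = u.1 i - v.1 i := rfl
theorem snd_sub_ap (u v : S3Double lam mu) (i : Fin 3) : (u - v).2 i = u.2 i - v.2 i := rfl
theorem fst_neg_ap (u : S3Double lam mu) (i : Fin 3) : (-u).1 i = -u.1 i := rfl
theorem snd_neg_ap (u : S3Double lam mu) (i : Fin 3) : (-u).2 i = -u.2 i := rfl
theorem fst_zero_ap (i : Fin 3) : (0 : S3Double lam mu).1 i = 0 := rfl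
theorem snd_zero_ap (i : Fin 3) : (0 : S3Double lam mu).2 i = 0 := rfl

theorem x_fst (i : Fin 3) : (x lam mu i).1 = Pi.single i 1 := rfl
theorem x_snd (i : Fin 3) : (x lam mu i).2 = 0 := rfl
theorem X_fst (i : Fin 3) : (X lam mu i).1 = 0 := rfl
theorem X_snd (i : Fin 3) : (X lam mu i).2 = Pi.single i 1 := rfl

theorem x0_x1 : ⁅x lam mu 0, x lam mu 1⁆ = (mu : ℝ) • x lam mu 1 - x lam mu 2 := by
  apply ext_ap <;> simp [fst_lie_zero, fst_lie_one, fst_lie_two, snd_lie_zero, snd_lie_one,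
    snd_lie_two, fst_smul_ap, snd_smul_ap, fst_sub_ap, snd_sub_ap, x_fst, x_snd]

theorem x0_x2 : ⁅x lam mu 0, x lam mu 2⁆ = x lam mu 1 + (mu : ℝ) • x lam mu 2 := by
  apply ext_ap <;> simp [fst_lie_zero, fst_lie_one, fst_lie_two, snd_lie_zero, snd_lie_one,
    snd_lie_two, fst_smul_ap, snd_smul_ap, fst_add_ap, snd_add_ap, x_fst, x_snd]

theorem x1_x2 : ⁅x lam mu 1, x lam mu 2⁆ = 0 := by
  apply ext_ap <;> simp [fst_lie_zero, fst_lie_one, fst_lie_two, snd_lie_zero, snd_lie_one,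
    snd_lie_two, fst_zero_ap, snd_zero_ap, x_fst, x_snd]

theorem X0_X1 : ⁅X lam mu 0, X lam mu 1⁆ =
    -(lam / mu : ℝ) • X lam mu 1 + (lam : ℝ) • X lam mu 2 := by
  apply ext_ap <;> simp [fst_lie_zero, fst_lie_one, fst_lie_two, snd_lie_zero, snd_lie_one,
    snd_lie_two, fst_smul_ap, snd_smul_ap, fst_add_ap, snd_add_ap, X_fst, X_snd,
    fst_neg_ap, snd_neg_ap]

theorem X0_X2 : ⁅X lam mu 0, X lam mu 2⁆ =
    -(lam : ℝ) • X lam mu 1 - (lam / mu : ℝ) • X lam mu 2 := by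
  apply ext_ap <;> simp [fst_lie_zero, fst_lie_one, fst_lie_two, snd_lie_zero, snd_lie_one,
    snd_lie_two, fst_smul_ap, snd_smul_ap, fst_sub_ap, snd_sub_ap, X_fst, X_snd,
    fst_neg_ap, snd_neg_ap]

theorem X1_X2 : ⁅X lam mu 1, X lam mu 2⁆ = 0 := by
  apply ext_ap <;> simp [fst_lie_zero, fst_lie_one, fst_lie_two, snd_lie_zero, snd_lie_one,
    snd_lie_two, fst_zero_ap, snd_zero_ap, X_fst, X_snd]

theorem x0_X0 : ⁅x lam mu 0, X lam mu 0⁆ = 0 := by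
  apply ext_ap <;> simp [fst_lie_zero, fst_lie_one, fst_lie_two, snd_lie_zero, snd_lie_one,
    snd_lie_two, fst_zero_ap, snd_zero_ap, X_fst, X_snd, x_fst, x_snd]

theorem x0_X1 : ⁅x lam mu 0, X lam mu 1⁆ = -(mu : ℝ) • X lam mu 1 - X lam mu 2 := by
  apply ext_ap <;> simp [fst_lie_zero, fst_lie_one, fst_lie_two, snd_lie_zero, snd_lie_one,
    snd_lie_two, fst_smul_ap, snd_smul_ap, fst_sub_ap, snd_sub_ap, X_fst, X_snd, x_fst, x_snd,
    fst_neg_ap, snd_neg_ap]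

theorem x0_X2 : ⁅x lam mu 0, X lam mu 2⁆ = X lam mu 1 - (mu : ℝ) • X lam mu 2 := by
  apply ext_ap <;> simp [fst_lie_zero, fst_lie_one, fst_lie_two, snd_lie_zero, snd_lie_one,
    snd_lie_two, fst_smul_ap, snd_smul_ap, fst_sub_ap, snd_sub_ap, X_fst, X_snd, x_fst, x_snd]

theorem x1_X0 : ⁅x lam mu 1, X lam mu 0⁆ =
    -(lam / mu : ℝ) • x lam mu 1 - (lam : ℝ) • x lam mu 2 := by
  apply ext_ap <;> simp [fst_lie_zero, fst_lie_one, fst_lie_two, snd_lie_zero, snd_lie_one,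
    snd_lie_two, fst_smul_ap, snd_smul_ap, fst_sub_ap, snd_sub_ap, X_fst, X_snd, x_fst, x_snd,
    fst_neg_ap, snd_neg_ap]

theorem x2_X0 : ⁅x lam mu 2, X lam mu 0⁆ =
    (lam : ℝ) • x lam mu 1 - (lam / mu : ℝ) • x lam mu 2 := by
  apply ext_ap <;> simp [fst_lie_zero, fst_lie_one, fst_lie_two, snd_lie_zero, snd_lie_one,
    snd_lie_two, fst_smul_ap, snd_smul_ap, fst_sub_ap, snd_sub_ap, X_fst, X_snd, x_fst, x_snd]

theorem x1_X1 : ⁅x lam mu 1, X lam mu 1⁆ =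
    (lam / mu : ℝ) • x lam mu 0 + (mu : ℝ) • X lam mu 0 := by
  apply ext_ap <;> simp [fst_lie_zero, fst_lie_one, fst_lie_two, snd_lie_zero, snd_lie_one,
    snd_lie_two, fst_smul_ap, snd_smul_ap, fst_add_ap, snd_add_ap, X_fst, X_snd, x_fst, x_snd]

theorem x2_X2 : ⁅x lam mu 2, X lam mu 2⁆ =
    (lam / mu : ℝ) • x lam mu 0 + (mu : ℝ) • X lam mu 0 := by
  apply ext_ap <;> simp [fst_lie_zero, fst_lie_one, fst_lie_two, snd_lie_zero, snd_lie_one,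
    snd_lie_two, fst_smul_ap, snd_smul_ap, fst_add_ap, snd_add_ap, X_fst, X_snd, x_fst, x_snd]

theorem x1_X2 : ⁅x lam mu 1, X lam mu 2⁆ = (lam : ℝ) • x lam mu 0 - X lam mu 0 := by
  apply ext_ap <;> simp [fst_lie_zero, fst_lie_one, fst_lie_two, snd_lie_zero, snd_lie_one,
    snd_lie_two, fst_smul_ap, snd_smul_ap, fst_sub_ap, snd_sub_ap, X_fst, X_snd, x_fst, x_snd]

theorem x2_X1 : ⁅x lam mu 2, X lam mu 1⁆ = -((lam : ℝ) • x lam mu 0 - X lam mu 0) := by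
  apply ext_ap <;> simp [fst_lie_zero, fst_lie_one, fst_lie_two, snd_lie_zero, snd_lie_one,
    snd_lie_two, fst_smul_ap, snd_smul_ap, fst_sub_ap, snd_sub_ap, X_fst, X_snd, x_fst, x_snd]

/-- The linear map on the double that sends `xⁱ` to `x i` and `X_i` to `X i`. -/
def lin {M : Type*} [AddCommGroup M] [Module ℝ M] (x X : Fin 3 → M) : S3Double lam mu →ₗ[ℝ] M where
  toFun Y := ∑ i, Y.1 i • x i + ∑ i, Y.2 i • X i
  map_add' Y Z := by
    simp only [fst_add_ap, snd_add_ap, add_smul, Finset.sum_add_distrib]; abel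
  map_smul' t Y := by
    simp only [fst_smul_ap, snd_smul_ap, mul_smul, smul_add, Finset.smul_sum, RingHom.id_apply]

theorem lin_apply {M : Type*} [AddCommGroup M] [Module ℝ M] (x X : Fin 3 → M)
    (Y : S3Double lam mu) : lin lam mu x X Y = ∑ i, Y.1 i • x i + ∑ i, Y.2 i • X i := rfl

@[simp] theorem lin_x {M : Type*} [AddCommGroup M] [Module ℝ M] (x' X' : Fin 3 → M) (i : Fin 3) :
    lin lam mu x' X' (x lam mu i) = x' i := by
  simp [lin_apply, x_fst, x_snd, Pi.single_apply]

@[simp] theorem lin_X {M : Type*} [AddCommGroup M] [Module ℝ M] (x' X' : Fin 3 → M) (i : Fin 3) :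
    lin lam mu x' X' (X lam mu i) = X' i := by
  simp [lin_apply, X_fst, X_snd, Pi.single_apply]

theorem eq_sum (Y : S3Double lam mu) :
    Y = ∑ i, Y.1 i • x lam mu i + ∑ i, Y.2 i • X lam mu i := by
  simp only [Fin.sum_univ_three]
  apply ext_ap <;> simp [fst_smul_ap, snd_smul_ap, fst_add_ap, snd_add_ap, X_fst, X_snd,
    x_fst, x_snd]

theorem linearMap_ext {M : Type*} [AddCommGroup M] [Module ℝ M] {f g : S3Double lam mu →ₗ[ℝ] M}
    (hx : ∀ i, f (x lam mu i) = g (x lam mu i)) (hX : ∀ i, f (X lam mu i) = g (X lam mu i)) :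
    f = g := by
  refine LinearMap.ext fun Y => ?_
  rw [eq_sum lam mu Y]
  simp only [map_add, map_sum, map_smul, hx, hX]

attribute [local instance 100] LieRing.ofAssociativeRing

theorem doubleRelations_of_lieHom {Q : Type*} [Ring Q] [Algebra ℝ Q]
    (f : S3Double lam mu →ₗ⁅ℝ⁆ Q) :
    DoubleRelations lam mu (fun i => f (x lam mu i)) (fun i => f (X lam mu i))
      ((lam / mu : ℝ) • f (x lam mu 0) + (mu : ℝ) • f (X lam mu 0))
      ((lam : ℝ) • f (x lam mu 0) - f (X lam mu 0)) := by
  constructor <;> rw [← Ring.lie_def, ← LieHom.map_lie]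
  · rw [x0_x1]; simp
  · rw [x0_x2]; simp
  · rw [x1_x2]; simp
  · rw [X0_X1]; simp
  · rw [X0_X2]; simp
  · rw [X1_X2]; simp
  · rw [x0_X0]; simp
  · rw [x0_X1]; simp
  · rw [x0_X2]; simp
  · rw [x1_X0]; simp
  · rw [x2_X0]; simp
  · rw [x1_X1]; simp
  · rw [x1_X2]; simp
  · rw [x2_X1]; simp
  · rw [x2_X2]; simp

/-- The Lie algebra homomorphism given by elements that satisfy the classical relations. -/
def lieHom {Q : Type*} [Ring Q] [Algebra ℝ Q] {x X : Fin 3 → Q}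
    (h : DoubleRelations lam mu x X ((lam / mu : ℝ) • x 0 + (mu : ℝ) • X 0)
      ((lam : ℝ) • x 0 - X 0)) : S3Double lam mu →ₗ⁅ℝ⁆ Q :=
  { lin lam mu x X with
    map_lie' := fun {u v} => by
      change lin lam mu x X _ = ⁅lin lam mu x X u, lin lam mu x X v⁆
      rw [Ring.lie_def]
      simp only [lin_apply, Fin.sum_univ_three, fst_lie_zero, fst_lie_one, fst_lie_two,
        snd_lie_zero, snd_lie_one, snd_lie_two]
      simp only [add_mul, mul_add, smul_mul_smul_comm]
      -- Each defining relation enters with the antisymmetrized product of the corresponding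
      -- coordinates of u and v.
      linear_combination (norm := module)
        -((u.1 0 * v.1 1 - u.1 1 * v.1 0) • h.x0_x1 + (u.1 0 * v.1 2 - u.1 2 * v.1 0) • h.x0_x2 +
        (u.1 1 * v.1 2 - u.1 2 * v.1 1) • h.x1_x2 + (u.2 0 * v.2 1 - u.2 1 * v.2 0) • h.X0_X1 +
        (u.2 0 * v.2 2 - u.2 2 * v.2 0) • h.X0_X2 + (u.2 1 * v.2 2 - u.2 2 * v.2 1) • h.X1_X2 +
        (u.1 0 * v.2 0 - v.1 0 * u.2 0) • h.x0_X0 + (u.1 0 * v.2 1 - v.1 0 * u.2 1) • h.x0_X1 +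
        (u.1 0 * v.2 2 - v.1 0 * u.2 2) • h.x0_X2 + (u.1 1 * v.2 0 - v.1 1 * u.2 0) • h.x1_X0 +
        (u.1 2 * v.2 0 - v.1 2 * u.2 0) • h.x2_X0 + (u.1 1 * v.2 1 - v.1 1 * u.2 1) • h.x1_X1 +
        (u.1 1 * v.2 2 - v.1 1 * u.2 2) • h.x1_X2 + (u.1 2 * v.2 1 - v.1 2 * u.2 1) • h.x2_X1 +
        (u.1 2 * v.2 2 - v.1 2 * u.2 2) • h.x2_X2) }

theorem lieHom_x {Q : Type*} [Ring Q] [Algebra ℝ Q] {x' X' : Fin 3 → Q}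
    (h : DoubleRelations lam mu x' X' ((lam / mu : ℝ) • x' 0 + (mu : ℝ) • X' 0)
      ((lam : ℝ) • x' 0 - X' 0)) (i : Fin 3) : lieHom lam mu h (x lam mu i) = x' i :=
  lin_x lam mu x' X' i

theorem lieHom_X {Q : Type*} [Ring Q] [Algebra ℝ Q] {x' X' : Fin 3 → Q}
    (h : DoubleRelations lam mu x' X' ((lam / mu : ℝ) • x' 0 + (mu : ℝ) • X' 0)
      ((lam : ℝ) • x' 0 - X' 0)) (i : Fin 3) : lieHom lam mu h (X lam mu i) = X' i :=
  lin_X lam mu x' X' i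

end S3Double

end

noncomputable section

/-! ### The quantum double as an algebra -/

theorem DoubleRelations.map {lam mu : ℝˣ} {A B : Type*} [Ring A] [Algebra ℝ A] [Ring B]
    [Algebra ℝ B] (f : A →ₐ[ℝ] B) {x X : Fin 3 → A} {p q : A}
    (h : DoubleRelations lam mu x X p q) :
    DoubleRelations lam mu (fun i => f (x i)) (fun i => f (X i)) (f p) (f q) where
  x0_x1 := by simpa using congrArg f h.x0_x1
  x0_x2 := by simpa using congrArg f h.x0_x2
  x1_x2 := by simpa using congrArg f h.x1_x2
  X0_X1 := by simpa using congrArg f h.X0_X1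
  X0_X2 := by simpa using congrArg f h.X0_X2
  X1_X2 := by simpa using congrArg f h.X1_X2
  x0_X0 := by simpa using congrArg f h.x0_X0
  x0_X1 := by simpa using congrArg f h.x0_X1
  x0_X2 := by simpa using congrArg f h.x0_X2
  x1_X0 := by simpa using congrArg f h.x1_X0
  x2_X0 := by simpa using congrArg f h.x2_X0
  x1_X1 := by simpa using congrArg f h.x1_X1
  x1_X2 := by simpa using congrArg f h.x1_X2
  x2_X1 := by simpa using congrArg f h.x2_X1
  x2_X2 := by simpa using congrArg f h.x2_X2

/-- The algebra underlying the quantum double. -/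
abbrev QDouble (lam mu : ℝˣ) : Type := Formal (UniversalEnvelopingAlgebra ℝ (S3Double lam mu))

namespace QDouble

variable (lam mu : ℝˣ)

attribute [local instance 100] LieRing.ofAssociativeRing

/-- The undeformed element of the quantum double given by an element of the double. -/
def ι : S3Double lam mu →ₗ[ℝ] QDouble lam mu :=
  Formal.const.toLinearMap ∘ₗ (UniversalEnvelopingAlgebra.ι ℝ (L := S3Double lam mu)).toLinearMap

theorem constCoeff_ι (Y : S3Double lam mu) :
    Formal.constCoeff (ι lam mu Y) = UniversalEnvelopingAlgebra.ι ℝ Y :=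
  Formal.constCoeff_const _

theorem doubleRelations_ι :
    DoubleRelations lam mu (fun i => ι lam mu (S3Double.x lam mu i))
      (fun i => ι lam mu (S3Double.X lam mu i))
      ((lam / mu : ℝ) • ι lam mu (S3Double.x lam mu 0) +
        (mu : ℝ) • ι lam mu (S3Double.X lam mu 0))
      ((lam : ℝ) • ι lam mu (S3Double.x lam mu 0) - ι lam mu (S3Double.X lam mu 0)) := by
  have h := (S3Double.doubleRelations_of_lieHom lam mu
    (UniversalEnvelopingAlgebra.ι ℝ (L := S3Double lam mu))).map (Formal.const (R := _))
  rw [map_add, map_sub, map_smul, map_smul, map_smul] at h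
  exact h

/-- The deformed element `x¹ + i x²`. -/
def u : Cx (QDouble lam mu) :=
  ⟨ι lam mu (S3Double.x lam mu 1), ι lam mu (S3Double.x lam mu 2)⟩ *
    zsum _ (deformFactor (wtX lam mu) (wtx mu) (Cx.of (ι lam mu (S3Double.x lam mu 0)))
      (Cx.of (ι lam mu (S3Double.X lam mu 0)))
      ⟨ι lam mu (S3Double.x lam mu 1), ι lam mu (S3Double.x lam mu 2)⟩
      (Cx.conj ⟨ι lam mu (S3Double.X lam mu 1), ι lam mu (S3Double.X lam mu 2)⟩))

/-- The generators `xⁱ`. -/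
def x : Fin 3 → QDouble lam mu :=
  ![ι lam mu (S3Double.x lam mu 0), (u lam mu).re, (u lam mu).im]

/-- The generators `X_i`. -/
def X (i : Fin 3) : QDouble lam mu := ι lam mu (S3Double.X lam mu i)

theorem relations : QuantumDoubleRelations lam mu (x lam mu) (X lam mu) := by
  have h := (doubleRelations_iff lam mu _ _ _ _).1 (doubleRelations_ι lam mu)
  have ht : ∀ p q : QDouble lam mu, (⟨p, -q⟩ : Cx _) = Cx.of p - Complex.I • Cx.of q :=
    fun p q => Cx.ext (by simp) (by simp)
  -- The classical right-hand side P − iQ equals a x⁰ + b X₀, which is the form required for the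
  -- deformation.
  rw [ht, ← wt_smul_add] at h
  rw [quantumDoubleRelations_iff_cx]
  exact h.deform (wtX_mul_conj_add lam mu) (wtX_mul_wtx_ne_zero lam mu)

/-- The deformation factor has constant term 1. -/
theorem exists_u_eq : ∃ t : Cx (QDouble lam mu), u lam mu =
    ⟨ι lam mu (S3Double.x lam mu 1), ι lam mu (S3Double.x lam mu 2)⟩ +
      (PowerSeries.X : ℝ⟦X⟧) • t := by
  obtain ⟨t, ht⟩ : ∃ t, zsum (Cx (QDouble lam mu)) (deformFactor (wtX lam mu) (wtx mu)
      (Cx.of (ι lam mu (S3Double.x lam mu 0))) (Cx.of (ι lam mu (S3Double.X lam mu 0)))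
      ⟨ι lam mu (S3Double.x lam mu 1), ι lam mu (S3Double.x lam mu 2)⟩
      (Cx.conj ⟨ι lam mu (S3Double.X lam mu 1), ι lam mu (S3Double.X lam mu 2)⟩)) =
      1 + (PowerSeries.X : ℝ⟦X⟧) • t := ⟨_, by
    rw [zsum_cons, deformFactor, map_mul, constantCoeff_invSinhc, constantCoeff_coshDiff, mul_one]⟩
  exact ⟨_, by rw [u, ht, mul_add, mul_one, mul_smul_comm]⟩

/-- The lift of the double to the quantum double. -/
def γ : S3Double lam mu →ₗ[ℝ] QDouble lam mu := S3Double.lin lam mu (x lam mu) (X lam mu)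

theorem γ_x (i : Fin 3) : γ lam mu (S3Double.x lam mu i) = x lam mu i := S3Double.lin_x ..
theorem γ_X (i : Fin 3) : γ lam mu (S3Double.X lam mu i) = X lam mu i := S3Double.lin_X ..

theorem constCoeff_γ (Y : S3Double lam mu) :
    Formal.constCoeff (γ lam mu Y) = UniversalEnvelopingAlgebra.ι ℝ Y := by
  refine LinearMap.congr_fun (f := Formal.constCoeff.toLinearMap ∘ₗ γ lam mu)
    (g := (UniversalEnvelopingAlgebra.ι ℝ (L := S3Double lam mu)).toLinearMap)
    (S3Double.linearMap_ext lam mu (fun i => ?_) fun i => ?_) Y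
  · change Formal.constCoeff (γ lam mu _) = UniversalEnvelopingAlgebra.ι ℝ _
    rw [γ_x]
    obtain ⟨t, ht⟩ := exists_u_eq lam mu
    fin_cases i
    · exact constCoeff_ι lam mu _
    · change Formal.constCoeff (u lam mu).re = _
      rw [ht, Cx.add_re, Cx.formal_smul_re, map_add, Formal.constCoeff_X_smul, add_zero]
      exact constCoeff_ι lam mu _
    · change Formal.constCoeff (u lam mu).im = _
      rw [ht, Cx.add_im, Cx.formal_smul_im, map_add, Formal.constCoeff_X_smul, add_zero]
      exact constCoeff_ι lam mu _
  · change Formal.constCoeff (γ lam mu _) = UniversalEnvelopingAlgebra.ι ℝ _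
    rw [γ_X]
    exact constCoeff_ι lam mu _

end QDouble

end

noncomputable section

/-! ### Homomorphisms from `R⟦z⟧` to complete algebras -/

/-- Splitting a series into its truncation and a multiple of zⁿ verifies the limit. This gives the
`ℝ⟦X⟧`-linearity of `Formal.lift`. -/
theorem zSum_algebraMap_coeff {B : Type*} [Ring B] [Algebra ℝ⟦X⟧ B] [Algebra ℝ B]
    [IsScalarTower ℝ ℝ⟦X⟧ B] [IsAdicComplete (Ideal.span {(PowerSeries.X : ℝ⟦X⟧)}) B] (c : ℝ⟦X⟧) :
    zSum (fun k => algebraMap ℝ B (PowerSeries.coeff k c)) = algebraMap ℝ⟦X⟧ B c := by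
  refine zSum_eq fun n => ⟨algebraMap ℝ⟦X⟧ B (PowerSeries.mk fun k => PowerSeries.coeff (k + n) c), ?_⟩
  conv_lhs => rw [PowerSeries.eq_X_pow_mul_shift_add_trunc n c]
  rw [map_add, add_comm, Algebra.smul_def, map_mul]
  congr 1
  rw [PowerSeries.trunc_apply, Nat.Ico_zero_eq_range, ← Polynomial.coeToPowerSeries.ringHom_apply,
    map_sum, map_sum]
  refine Finset.sum_congr rfl fun k _ => ?_
  rw [Polynomial.coeToPowerSeries.ringHom_apply, Polynomial.coe_monomial,
    PowerSeries.monomial_eq_C_mul_X_pow, mul_comm, map_mul, PowerSeries.C_eq_algebraMap,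
    ← IsScalarTower.algebraMap_apply, Algebra.smul_def]

namespace Formal

variable {R : Type*} [Ring R] [Algebra ℝ R] {B : Type*} [Ring B] [Algebra ℝ⟦X⟧ B] [Algebra ℝ B]
  [IsScalarTower ℝ ℝ⟦X⟧ B] [IsAdicComplete (Ideal.span {(PowerSeries.X : ℝ⟦X⟧)}) B]

/-- The extension of a homomorphism of real algebras `R → B` to `R⟦z⟧ → B`. -/
def lift (f : R →ₐ[ℝ] B) : Formal R →ₐ[ℝ⟦X⟧] B :=
  { (zsum B).comp ((PowerSeries.map (f : R →+* B)).comp (toPS (R := R)).toRingHom) with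
    commutes' := fun c => by
      change zsum B (PowerSeries.map (f : R →+* B) (toPS (algebraMap ℝ⟦X⟧ (Formal R) c))) = _
      rw [toPS_algebraMap, ← zSum_algebraMap_coeff, zsum_apply]
      simp }

theorem lift_apply (f : R →ₐ[ℝ] B) (r : Formal R) :
    lift f r = zsum B (PowerSeries.map (f : R →+* B) (toPS r)) := rfl

@[simp] theorem lift_const (f : R →ₐ[ℝ] B) (r : R) : lift f (const r) = f r := by
  rw [lift_apply, toPS_const, PowerSeries.map_C, zsum_C]
  rfl

/-- Successive approximation: the decomposition b = f r + z c is applied again to the remainder c,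
and the n-th remainder carries the factor zⁿ. -/
theorem lift_surjective {f : R →ₐ[ℝ] B}
    (h : ∀ b : B, ∃ (r : R) (c : B), b = f r + (PowerSeries.X : ℝ⟦X⟧) • c) :
    Function.Surjective (lift f) := by
  choose r c h using h
  intro b
  refine ⟨toPS.symm (PowerSeries.mk fun k => r (c^[k] b)), ?_⟩
  rw [lift_apply, RingEquiv.apply_symm_apply, zsum_apply]
  refine zSum_eq fun n => ⟨c^[n] b, ?_⟩
  simp only [PowerSeries.coeff_map, PowerSeries.coeff_mk]
  induction n with
  | zero => simp
  | succ n ih =>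
    conv_lhs => rw [ih, h (c^[n] b)]
    rw [Finset.sum_range_succ, smul_add, smul_smul, ← pow_succ, Function.iterate_succ_apply',
      add_assoc]
    rfl

end Formal

namespace QDouble

variable {lam mu : ℝˣ}

attribute [local instance 100] LieRing.ofAssociativeRing

/-- The homomorphism from the free algebra on six generators that is given by their images. -/
def word {B : Type*} [Ring B] [Algebra ℝ B] (x X : Fin 3 → B) :
    FreeAlgebra ℝ (Fin 3 ⊕ Fin 3) →ₐ[ℝ] B := FreeAlgebra.lift ℝ (Sum.elim x X)

@[simp] theorem word_inl {B : Type*} [Ring B] [Algebra ℝ B] (x X : Fin 3 → B) (i : Fin 3) :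
    word x X (FreeAlgebra.ι ℝ (Sum.inl i)) = x i := by simp [word]

@[simp] theorem word_inr {B : Type*} [Ring B] [Algebra ℝ B] (x X : Fin 3 → B) (i : Fin 3) :
    word x X (FreeAlgebra.ι ℝ (Sum.inr i)) = X i := by simp [word]

theorem word_ext {B : Type*} [Ring B] [Algebra ℝ B] {f g : FreeAlgebra ℝ (Fin 3 ⊕ Fin 3) →ₐ[ℝ] B}
    (hx : ∀ i, f (FreeAlgebra.ι ℝ (Sum.inl i)) = g (FreeAlgebra.ι ℝ (Sum.inl i)))
    (hX : ∀ i, f (FreeAlgebra.ι ℝ (Sum.inr i)) = g (FreeAlgebra.ι ℝ (Sum.inr i))) : f = g :=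
  FreeAlgebra.hom_ext (funext fun i => by
    rcases i with i | i
    · exact hx i
    · exact hX i)

/-- The universal property of the enveloping algebra gives a map into the subalgebra S generated by
the reductions of the generators. Composed with the inclusion it is the identity, so S is
everything; no basis theorem is needed. -/
theorem exists_word (w : UniversalEnvelopingAlgebra ℝ (S3Double lam mu)) :
    ∃ r, Formal.constCoeff (word (x lam mu) (X lam mu) r) = w := by
  let S := (Formal.constCoeff.comp (word (x lam mu) (X lam mu))).range
  have hS : ∀ Y : S3Double lam mu, UniversalEnvelopingAlgebra.ι ℝ Y ∈ S := fun Y => by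
    rw [S3Double.eq_sum lam mu Y, map_add, map_sum, map_sum]
    refine add_mem (sum_mem fun i _ => ?_) (sum_mem fun i _ => ?_) <;> rw [map_smul]
    · refine S.smul_mem (AlgHom.mem_range _ |>.2 ⟨FreeAlgebra.ι ℝ (Sum.inl i), ?_⟩) _
      change Formal.constCoeff (word (x lam mu) (X lam mu) _) = _
      rw [word_inl, ← γ_x, constCoeff_γ]
    · refine S.smul_mem (AlgHom.mem_range _ |>.2 ⟨FreeAlgebra.ι ℝ (Sum.inr i), ?_⟩) _
      change Formal.constCoeff (word (x lam mu) (X lam mu) _) = _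
      rw [word_inr, ← γ_X, constCoeff_γ]
  let f : S3Double lam mu →ₗ⁅ℝ⁆ S :=
    { LinearMap.codRestrict S.toSubmodule
        (UniversalEnvelopingAlgebra.ι ℝ (L := S3Double lam mu)).toLinearMap hS with
      map_lie' := fun {Y Z} => Subtype.ext (LieHom.map_lie _ Y Z) }
  have h : S.val.comp (UniversalEnvelopingAlgebra.lift ℝ f) = AlgHom.id ℝ _ := by
    ext Y
    change S.val (UniversalEnvelopingAlgebra.lift ℝ f (UniversalEnvelopingAlgebra.ι ℝ Y)) =
      UniversalEnvelopingAlgebra.ι ℝ Y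
    rw [UniversalEnvelopingAlgebra.lift_ι_apply]
    rfl
  have := (UniversalEnvelopingAlgebra.lift ℝ f w).2
  rwa [show ((UniversalEnvelopingAlgebra.lift ℝ f w : S) : _) = w from DFunLike.congr_fun h w]
    at this

/-- The generators generate the quantum double modulo `z`. -/
theorem exists_eq_word_add (a : QDouble lam mu) : ∃ r c,
    a = word (x lam mu) (X lam mu) r + (PowerSeries.X : ℝ⟦X⟧) • c := by
  obtain ⟨r, hr⟩ := exists_word (Formal.constCoeff a)
  obtain ⟨c, hc⟩ := (Formal.constCoeff_eq_zero_iff (a - word (x lam mu) (X lam mu) r)).1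
    (by rw [map_sub, hr, sub_self])
  exact ⟨r, c, by rw [← hc, add_sub_cancel]⟩

/-- A subalgebra that contains the generators and some `zⁿ A` is everything. -/
theorem mem_of_generators (S : Subalgebra ℝ⟦X⟧ (QDouble lam mu)) (hx : ∀ i, x lam mu i ∈ S)
    (hX : ∀ i, X lam mu i ∈ S) {n : ℕ} (hn : ∀ a, (PowerSeries.X : ℝ⟦X⟧) ^ n • a ∈ S)
    (a : QDouble lam mu) : a ∈ S := by
  have hw : ∀ r, word (x lam mu) (X lam mu) r ∈ S := fun r => by
    induction r using FreeAlgebra.induction with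
    | grade0 t =>
      rw [AlgHom.commutes, IsScalarTower.algebraMap_apply ℝ ℝ⟦X⟧]
      exact S.algebraMap_mem _
    | grade1 i =>
      rcases i with i | i
      · rw [word_inl]; exact hx i
      · rw [word_inr]; exact hX i
    | mul r s hr hs => rw [map_mul]; exact mul_mem hr hs
    | add r s hr hs => rw [map_add]; exact add_mem hr hs
  -- Descending induction on m, from zⁿA ⊆ S to m = 0: generation modulo z improves the exponent by
  -- one at each step.
  suffices h : ∀ m a, (PowerSeries.X : ℝ⟦X⟧) ^ m • a ∈ S by simpa using h 0 a
  intro m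
  by_cases hmn : n ≤ m
  · intro a
    obtain ⟨d, rfl⟩ := Nat.exists_eq_add_of_le hmn
    rw [pow_add, mul_smul]
    exact hn _
  · induction h : n - m generalizing m with
    | zero => omega
    | succ k ih =>
      intro a
      obtain ⟨r, c, rfl⟩ := exists_eq_word_add a
      rw [smul_add, smul_smul, ← pow_succ]
      refine add_mem (S.smul_mem (hw r) _) ?_
      by_cases hk : n ≤ m + 1
      · obtain ⟨d, hd⟩ := Nat.exists_eq_add_of_le hk
        rw [hd, pow_add, mul_smul]
        exact hn _
      · exact ih (m + 1) hk (by omega) c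

/-- Modulo zⁿ the equalizer trivially contains zⁿA, so agreement on the generators is enough there;
separatedness then removes the truncation. -/
theorem hom_ext {B : Type*} [Ring B] [Algebra ℝ⟦X⟧ B]
    [IsHausdorff (Ideal.span {(PowerSeries.X : ℝ⟦X⟧)}) B] {f g : QDouble lam mu →ₐ[ℝ⟦X⟧] B}
    (hx : ∀ i, f (x lam mu i) = g (x lam mu i)) (hX : ∀ i, f (X lam mu i) = g (X lam mu i)) :
    f = g := by
  refine AlgHom.ext fun a => sub_eq_zero.1 (eq_zero_of_forall_zpow fun n => ?_)
  have key : a ∈ AlgHom.equalizer ((ZQuot.mk n).comp f) ((ZQuot.mk n).comp g) :=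
    mem_of_generators _ (fun i => congrArg (ZQuot.mk n) (hx i))
      (fun i => congrArg (ZQuot.mk n) (hX i)) (n := n) (fun a => by
        have h0 : ∀ b : B, ZQuot.mk n ((PowerSeries.X : ℝ⟦X⟧) ^ n • b) = 0 := fun b =>
          Ideal.Quotient.eq_zero_iff_mem.2 ⟨b, rfl⟩
        rw [AlgHom.mem_equalizer, AlgHom.comp_apply, AlgHom.comp_apply, map_smul f, map_smul g, h0, h0])
      a
  exact (Ideal.Quotient.mk_eq_mk_iff_sub_mem _ _).1 key

end QDouble

end

noncomputable section

/-! ### The universal property of the quantum double -/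

theorem DoubleRelations.prod {lam mu : ℝˣ} {B₁ B₂ : Type*} [Ring B₁] [Algebra ℝ B₁]
    [Ring B₂] [Algebra ℝ B₂]
    {x₁ X₁ : Fin 3 → B₁} {p₁ q₁ : B₁} (h₁ : DoubleRelations lam mu x₁ X₁ p₁ q₁)
    {x₂ X₂ : Fin 3 → B₂} {p₂ q₂ : B₂} (h₂ : DoubleRelations lam mu x₂ X₂ p₂ q₂) :
    DoubleRelations lam mu (fun i => (x₁ i, x₂ i)) (fun i => (X₁ i, X₂ i)) (p₁, p₂) (q₁, q₂) :=
  ⟨Prod.ext h₁.1 h₂.1, Prod.ext h₁.2 h₂.2, Prod.ext h₁.3 h₂.3, Prod.ext h₁.4 h₂.4,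
    Prod.ext h₁.5 h₂.5, Prod.ext h₁.6 h₂.6, Prod.ext h₁.7 h₂.7, Prod.ext h₁.8 h₂.8,
    Prod.ext h₁.9 h₂.9, Prod.ext h₁.10 h₂.10, Prod.ext h₁.11 h₂.11, Prod.ext h₁.12 h₂.12,
    Prod.ext h₁.13 h₂.13, Prod.ext h₁.14 h₂.14, Prod.ext h₁.15 h₂.15⟩

theorem DoubleRelations.of_injective {lam mu : ℝˣ} {A B : Type*} [Ring A] [Algebra ℝ A] [Ring B]
    [Algebra ℝ B] {f : A →ₐ[ℝ] B} (hf : Function.Injective f) {x X : Fin 3 → A} {p q : A}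
    (h : DoubleRelations lam mu (fun i => f (x i)) (fun i => f (X i)) (f p) (f q)) :
    DoubleRelations lam mu x X p q where
  x0_x1 := hf (by simpa using h.x0_x1)
  x0_x2 := hf (by simpa using h.x0_x2)
  x1_x2 := hf (by simpa using h.x1_x2)
  X0_X1 := hf (by simpa using h.X0_X1)
  X0_X2 := hf (by simpa using h.X0_X2)
  X1_X2 := hf (by simpa using h.X1_X2)
  x0_X0 := hf (by simpa using h.x0_X0)
  x0_X1 := hf (by simpa using h.x0_X1)
  x0_X2 := hf (by simpa using h.x0_X2)
  x1_X0 := hf (by simpa using h.x1_X0)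
  x2_X0 := hf (by simpa using h.x2_X0)
  x1_X1 := hf (by simpa using h.x1_X1)
  x1_X2 := hf (by simpa using h.x1_X2)
  x2_X1 := hf (by simpa using h.x2_X1)
  x2_X2 := hf (by simpa using h.x2_X2)

namespace QDouble

variable {lam mu : ℝˣ}

attribute [local instance 100] LieRing.ofAssociativeRing

section Lift

variable {B : Type*} [Ring B] [Algebra ℝ⟦X⟧ B] [Algebra ℝ B]
  [IsScalarTower ℝ ℝ⟦X⟧ B] [IsAdicComplete (Ideal.span {(PowerSeries.X : ℝ⟦X⟧)}) B]

/-- The homomorphism from noncommutative polynomials over `ℝ⟦z⟧`, completed, that is given by the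
images of the generators. -/
def eval (x' X' : Fin 3 → B) : Formal (FreeAlgebra ℝ (Fin 3 ⊕ Fin 3)) →ₐ[ℝ⟦X⟧] B :=
  Formal.lift (word x' X')

/-- The free generators. -/
def gx (i : Fin 3) : Formal (FreeAlgebra ℝ (Fin 3 ⊕ Fin 3)) :=
  Formal.const (FreeAlgebra.ι ℝ (Sum.inl i))

/-- The free generators. -/
def gX (i : Fin 3) : Formal (FreeAlgebra ℝ (Fin 3 ⊕ Fin 3)) :=
  Formal.const (FreeAlgebra.ι ℝ (Sum.inr i))

@[simp] theorem eval_gx (x' X' : Fin 3 → B) (i : Fin 3) : eval x' X' (gx i) = x' i := by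
  simp [eval, gx]

@[simp] theorem eval_gX (x' X' : Fin 3 → B) (i : Fin 3) : eval x' X' (gX i) = X' i := by
  simp [eval, gX]

theorem eval_surjective : Function.Surjective (eval (x lam mu) (X lam mu)) :=
  Formal.lift_surjective exists_eq_word_add

omit [IsScalarTower ℝ ℝ⟦X⟧ B] in
-- Under these normalizations a deformed right-hand side reduces modulo z to the linear expression
-- of the classical bracket.
theorem zEvalDiv_mul_zEval_eq {φ ψ : ℝ⟦X⟧} (hφ : PowerSeries.coeff 1 φ = 1)
    (hψ : PowerSeries.coeff 0 ψ = 1) (p q : B) : ∃ t,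
    zEvalDiv φ p * zEval ψ q = p + (PowerSeries.X : ℝ⟦X⟧) • t := by
  obtain ⟨s, hs⟩ := zEvalDiv_eq φ p
  obtain ⟨t, ht⟩ := zEval_eq ψ q
  rw [hs, ht, hφ, hψ, map_one, one_smul]
  generalize PowerSeries.coeff 1 ψ • q = q'
  refine ⟨s * (1 + (PowerSeries.X : ℝ⟦X⟧) • q' + (PowerSeries.X : ℝ⟦X⟧) ^ 2 • t) +
    p * (q' + (PowerSeries.X : ℝ⟦X⟧) • t), ?_⟩
  simp only [add_mul, mul_add, smul_mul_assoc, mul_smul_comm, mul_one, smul_add, smul_smul,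
    pow_two, mul_assoc]
  abel

/-- The right hand sides of the relations, in terms of free generators. -/
def rhsRe (lam mu : ℝˣ) : Formal (FreeAlgebra ℝ (Fin 3 ⊕ Fin 3)) :=
  zEvalDiv sinhSeries ((lam / mu : ℝ) • gx 0 + (mu : ℝ) • gX 0) *
    zEval (PowerSeries.cos ℝ) ((lam : ℝ) • gx 0 - gX 0)

/-- The right hand sides of the relations, in terms of free generators. -/
def rhsIm (lam mu : ℝˣ) : Formal (FreeAlgebra ℝ (Fin 3 ⊕ Fin 3)) :=
  zEvalDiv (PowerSeries.sin ℝ) ((lam : ℝ) • gx 0 - gX 0) *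
    zEval coshSeries ((lam / mu : ℝ) • gx 0 + (mu : ℝ) • gX 0)

theorem eval_rhs {x' X' : Fin 3 → B} (h : QuantumDoubleRelations lam mu x' X') :
    DoubleRelations lam mu x' X' (eval x' X' (rhsRe lam mu)) (eval x' X' (rhsIm lam mu)) := by
  rw [quantumDoubleRelations_iff] at h
  simpa [rhsRe, rhsIm, map_zEval, map_zEvalDiv, map_smul_real] using h

variable {x' X' : Fin 3 → B}

variable (lam mu x' X') in
/-- The joint evaluation in the quantum double and in `B`. -/
def jointEval : Formal (FreeAlgebra ℝ (Fin 3 ⊕ Fin 3)) →ₐ[ℝ⟦X⟧] QDouble lam mu × B :=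
  (eval (x lam mu) (X lam mu)).prod (eval x' X')

variable (lam mu x' X') in
/-- The joint evaluation modulo `z`. -/
def jointEvalMod : Formal (FreeAlgebra ℝ (Fin 3 ⊕ Fin 3)) →ₐ[ℝ⟦X⟧]
    ZQuot (jointEval lam mu x' X').range 1 :=
  (ZQuot.mk 1).comp (jointEval lam mu x' X').rangeRestrict

theorem jointEvalMod_X_smul (r : Formal (FreeAlgebra ℝ (Fin 3 ⊕ Fin 3))) :
    jointEvalMod lam mu x' X' ((PowerSeries.X : ℝ⟦X⟧) • r) = 0 := by
  refine Ideal.Quotient.eq_zero_iff_mem.2 ⟨(jointEval lam mu x' X').rangeRestrict r, ?_⟩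
  rw [pow_one]
  exact map_smul (jointEval lam mu x' X').rangeRestrict _ _

/-- The reduction is taken modulo z times the image itself, not modulo z(A × B). The higher-order
corrections come from elements s and t of the completed free algebra, so they do lie in z times the
image and disappear. -/
theorem doubleRelations_mod (h : QuantumDoubleRelations lam mu x' X') :
    DoubleRelations lam mu (fun i => jointEvalMod lam mu x' X' (gx i))
      (fun i => jointEvalMod lam mu x' X' (gX i))
      ((lam / mu : ℝ) • jointEvalMod lam mu x' X' (gx 0) +
        (mu : ℝ) • jointEvalMod lam mu x' X' (gX 0))
      ((lam : ℝ) • jointEvalMod lam mu x' X' (gx 0) - jointEvalMod lam mu x' X' (gX 0)) := by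
  obtain ⟨s, hs⟩ : ∃ s, rhsRe lam mu = (lam / mu : ℝ) • gx 0 + (mu : ℝ) • gX 0 +
      (PowerSeries.X : ℝ⟦X⟧) • s :=
    zEvalDiv_mul_zEval_eq (by simp [sinhSeries]) (by simp [PowerSeries.cos]) _ _
  obtain ⟨t, ht⟩ : ∃ t, rhsIm lam mu = (lam : ℝ) • gx 0 - gX 0 + (PowerSeries.X : ℝ⟦X⟧) • t :=
    zEvalDiv_mul_zEval_eq (by simp [PowerSeries.sin]) (by simp [coshSeries]) _ _
  have h1 := (eval_rhs (relations lam mu)).prod (eval_rhs h)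
  have h1' : DoubleRelations lam mu (fun i => jointEval lam mu x' X' (gx i))
      (fun i => jointEval lam mu x' X' (gX i)) (jointEval lam mu x' X' (rhsRe lam mu))
      (jointEval lam mu x' X' (rhsIm lam mu)) := by
    simpa [jointEval] using h1
  have h2 := DoubleRelations.of_injective
    (f := (jointEval lam mu x' X').range.val.restrictScalars ℝ)
    (x := fun i => (jointEval lam mu x' X').rangeRestrict (gx i))
    (X := fun i => (jointEval lam mu x' X').rangeRestrict (gX i))
    (p := (jointEval lam mu x' X').rangeRestrict (rhsRe lam mu))
    (q := (jointEval lam mu x' X').rangeRestrict (rhsIm lam mu)) Subtype.val_injective h1'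
  have h3 := h2.map ((ZQuot.mk 1).restrictScalars ℝ)
  have e1 := congrArg (jointEvalMod lam mu x' X') hs
  have e2 := congrArg (jointEvalMod lam mu x' X') ht
  rw [map_add, map_add, jointEvalMod_X_smul, add_zero, map_smul_real, map_smul_real] at e1
  rw [map_add, map_sub, jointEvalMod_X_smul, add_zero, map_smul_real] at e2
  rw [← e1, ← e2]
  exact h3

/-- Since the quotient is by z times the joint image, a single s serves both evaluations. -/
theorem exists_of_jointEvalMod_eq_zero {r : Formal (FreeAlgebra ℝ (Fin 3 ⊕ Fin 3))}
    (h : jointEvalMod lam mu x' X' r = 0) : ∃ s, eval (x lam mu) (X lam mu) r =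
      (PowerSeries.X : ℝ⟦X⟧) • eval (x lam mu) (X lam mu) s ∧
      eval x' X' r = (PowerSeries.X : ℝ⟦X⟧) • eval x' X' s := by
  obtain ⟨⟨_, s, rfl⟩, hs⟩ := mem_zIdeal.1 (Ideal.Quotient.eq_zero_iff_mem.1 h)
  rw [pow_one] at hs
  have := congrArg Subtype.val hs
  exact ⟨s, congrArg Prod.fst this, congrArg Prod.snd this⟩

/-- The classical relations modulo z give a homomorphism from U(D). Both sides kill multiples of z
and agree on the free generators. Hence the joint reduction of r depends only on the classical limit
of its value in the quantum double. -/
theorem jointEvalMod_eq (h : QuantumDoubleRelations lam mu x' X')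
    (r : Formal (FreeAlgebra ℝ (Fin 3 ⊕ Fin 3))) : jointEvalMod lam mu x' X' r =
    UniversalEnvelopingAlgebra.lift ℝ (S3Double.lieHom lam mu (doubleRelations_mod h))
      (Formal.constCoeff (eval (x lam mu) (X lam mu) r)) := by
  obtain ⟨r', hr'⟩ := Formal.exists_eq_const_add r
  rw [hr', map_add, map_add, map_add, map_add, jointEvalMod_X_smul, map_smul,
    Formal.constCoeff_X_smul, map_zero, add_zero, add_zero]
  refine DFunLike.congr_fun (f := ((jointEvalMod lam mu x' X').restrictScalars ℝ).comp Formal.const)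
    (g := (UniversalEnvelopingAlgebra.lift ℝ (S3Double.lieHom lam mu (doubleRelations_mod h))).comp
      (Formal.constCoeff.comp (((eval (x lam mu) (X lam mu)).restrictScalars ℝ).comp Formal.const)))
    (word_ext (fun i => ?_) fun i => ?_) _
  · change jointEvalMod lam mu x' X' (gx i) = UniversalEnvelopingAlgebra.lift ℝ _
      (Formal.constCoeff (eval (x lam mu) (X lam mu) (gx i)))
    rw [eval_gx, ← γ_x, constCoeff_γ, UniversalEnvelopingAlgebra.lift_ι_apply]
    exact (S3Double.lieHom_x lam mu (doubleRelations_mod h) i).symm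
  · change jointEvalMod lam mu x' X' (gX i) = UniversalEnvelopingAlgebra.lift ℝ _
      (Formal.constCoeff (eval (x lam mu) (X lam mu) (gX i)))
    rw [eval_gX, ← γ_X, constCoeff_γ, UniversalEnvelopingAlgebra.lift_ι_apply]
    exact (S3Double.lieHom_X lam mu (doubleRelations_mod h) i).symm

/-- If r vanishes in the quantum double, its joint reduction vanishes, so both values of r are z
times the values of some s. The quantum double has no z-torsion, so s vanishes there too and the
argument repeats. The value in B is divisible by every zⁿ and hence zero. -/
theorem eval_eq_zero (h : QuantumDoubleRelations lam mu x' X')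
    {r : Formal (FreeAlgebra ℝ (Fin 3 ⊕ Fin 3))} (hr : eval (x lam mu) (X lam mu) r = 0) :
    eval x' X' r = 0 := by
  refine eq_zero_of_forall_zpow fun n => ?_
  suffices hs : ∃ s, eval (x lam mu) (X lam mu) s = 0 ∧
      eval x' X' r = (PowerSeries.X : ℝ⟦X⟧) ^ n • eval x' X' s by
    obtain ⟨s, -, hs⟩ := hs
    exact ⟨_, hs⟩
  induction n with
  | zero => exact ⟨r, hr, by rw [pow_zero, one_smul]⟩
  | succ n ih =>
    obtain ⟨s, hs, hs'⟩ := ih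
    obtain ⟨t, ht, ht'⟩ := exists_of_jointEvalMod_eq_zero (r := s) (x' := x') (X' := X')
      (lam := lam) (mu := mu) (by rw [jointEvalMod_eq h, hs, map_zero, map_zero])
    refine ⟨t, Formal.eq_zero_of_X_smul (ht.symm.trans hs), ?_⟩
    rw [hs', ht', smul_smul, pow_succ]

/-- The quantum double is the quotient of the completed free algebra by the kernel of its
evaluation, and this kernel dies in B. -/
theorem exists_lift (h : QuantumDoubleRelations lam mu x' X') :
    ∃ φ : QDouble lam mu →ₐ[ℝ⟦X⟧] B,
      (∀ i, φ (x lam mu i) = x' i) ∧ ∀ i, φ (X lam mu i) = X' i := by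
  let e := Ideal.quotientKerAlgEquivOfSurjective (eval_surjective (lam := lam) (mu := mu))
  have h0 : ∀ r ∈ RingHom.ker (eval (x lam mu) (X lam mu)), eval x' X' r = 0 :=
    fun r hr => eval_eq_zero h hr
  let φ : QDouble lam mu →ₐ[ℝ⟦X⟧] B := (Ideal.Quotient.liftₐ _ (eval x' X') h0).comp e.symm.toAlgHom
  have hφ : ∀ r, φ (eval (x lam mu) (X lam mu) r) = eval x' X' r := fun r =>
    congrArg (Ideal.Quotient.liftₐ _ (eval x' X') h0)
      (Ideal.quotientKerAlgEquivOfSurjective_symm_apply eval_surjective r)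
  exact ⟨φ, fun i => by simpa using hφ (gx i), fun i => by simpa using hφ (gX i)⟩

end Lift

end QDouble

end

noncomputable section

/-! ### The coproduct -/

theorem Cx.map_conj {A B : Type*} [Ring A] [Algebra ℝ⟦X⟧ A] [Ring B] [Algebra ℝ⟦X⟧ B]
    (f : A →ₐ[ℝ⟦X⟧] B) (w : Cx A) : Cx.map f (Cx.conj w) = Cx.conj (Cx.map f w) := by
  ext <;> simp

section SkewPrim

open Cx

variable {A B B' : Type*} [Ring A] [Algebra ℝ⟦X⟧ A] [Algebra ℝ A] [IsScalarTower ℝ ℝ⟦X⟧ A]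
  [IsAdicComplete (Ideal.span {(PowerSeries.X : ℝ⟦X⟧)}) A]
  [Ring B] [Algebra ℝ⟦X⟧ B] [Algebra ℝ B] [IsScalarTower ℝ ℝ⟦X⟧ B]
  [IsAdicComplete (Ideal.span {(PowerSeries.X : ℝ⟦X⟧)}) B]
  [Ring B'] [Algebra ℝ⟦X⟧ B'] [Algebra ℝ B'] [IsScalarTower ℝ ℝ⟦X⟧ B']
  [IsAdicComplete (Ideal.span {(PowerSeries.X : ℝ⟦X⟧)}) B']

/-- The element `e^{-zcy} ⊗ w + w ⊗ e^{zcy}`, for `a ⊗ b = f a * g b`. -/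
def skewPrim (f g : A →ₐ[ℝ⟦X⟧] B) (c : ℂ) (y : A) (w : Cx A) : Cx B :=
  zexp (-(c • Cx.map f (of y))) * Cx.map g w + Cx.map f w * zexp (c • Cx.map g (of y))

omit [Algebra ℝ A] [IsScalarTower ℝ ℝ⟦X⟧ A]
  [IsAdicComplete (Ideal.span {(PowerSeries.X : ℝ⟦X⟧)}) A] in
theorem map_skewPrim (h : B →ₐ[ℝ⟦X⟧] B') (f g : A →ₐ[ℝ⟦X⟧] B) (c : ℂ) (y : A) (w : Cx A) :
    Cx.map h (skewPrim f g c y w) = skewPrim (h.comp f) (h.comp g) c y w := by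
  simp only [skewPrim, map_add, map_mul, map_zEval, map_neg, Cx.map_csmul]
  rfl

omit [Algebra ℝ A] [IsScalarTower ℝ ℝ⟦X⟧ A]
  [IsAdicComplete (Ideal.span {(PowerSeries.X : ℝ⟦X⟧)}) A] in
theorem conj_skewPrim (f g : A →ₐ[ℝ⟦X⟧] B) (c : ℂ) (y : A) (w : Cx A) :
    Cx.conj (skewPrim f g c y w) = skewPrim f g (conj c) y (Cx.conj w) := by
  simp only [skewPrim, map_add, map_mul, conj_zEval, map_neg, Cx.map_conj, Cx.conj_smul]
  simp [map_of]

/-- For c = p − iq the two complex exponentials split into damped cosines and sines; the components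
then give the stated coproducts. -/
theorem skewPrim_eq (f g : A →ₐ[ℝ⟦X⟧] B) (p q : ℝ) (y : A) (w : Cx A) :
    skewPrim f g ⟨p, -q⟩ y w =
      Cx.map f ⟨zEval (PowerSeries.exp ℝ) (-p • y) * zEval (PowerSeries.cos ℝ) (q • y),
        zEval (PowerSeries.exp ℝ) (-p • y) * zEval (PowerSeries.sin ℝ) (q • y)⟩ * Cx.map g w +
      Cx.map f w * Cx.map g ⟨zEval (PowerSeries.exp ℝ) (p • y) * zEval (PowerSeries.cos ℝ) (q • y),
        -(zEval (PowerSeries.exp ℝ) (p • y) * zEval (PowerSeries.sin ℝ) (q • y))⟩ := by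
  have hc : ∀ r s : ℝ, Commute (r • y) (s • y) := fun r s =>
    ((Commute.refl y).smul_left r).smul_right s
  rw [← zexp_of_add_I_smul (hc _ _), ← zexp_of_sub_I_smul (hc _ _), map_zEval, map_zEval, skewPrim,
    ← Cx.map_csmul, ← Cx.map_csmul, ← map_neg]
  congr 4 <;> ext <;> simp

theorem skewPrim_re (f g : A →ₐ[ℝ⟦X⟧] B) (p q : ℝ) (y : A) (w : Cx A) :
    (skewPrim f g ⟨p, -q⟩ y w).re =
      f (zEval (PowerSeries.exp ℝ) (-p • y) * zEval (PowerSeries.cos ℝ) (q • y)) * g w.re +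
      f w.re * g (zEval (PowerSeries.exp ℝ) (p • y) * zEval (PowerSeries.cos ℝ) (q • y)) -
      f (zEval (PowerSeries.exp ℝ) (-p • y) * zEval (PowerSeries.sin ℝ) (q • y)) * g w.im +
      f w.im * g (zEval (PowerSeries.exp ℝ) (p • y) * zEval (PowerSeries.sin ℝ) (q • y)) := by
  rw [skewPrim_eq]
  simp only [add_re, mul_re, map_re, map_im, map_neg, mul_neg]
  abel

theorem skewPrim_im (f g : A →ₐ[ℝ⟦X⟧] B) (p q : ℝ) (y : A) (w : Cx A) :
    (skewPrim f g ⟨p, -q⟩ y w).im =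
      f (zEval (PowerSeries.exp ℝ) (-p • y) * zEval (PowerSeries.cos ℝ) (q • y)) * g w.im +
      f w.im * g (zEval (PowerSeries.exp ℝ) (p • y) * zEval (PowerSeries.cos ℝ) (q • y)) +
      f (zEval (PowerSeries.exp ℝ) (-p • y) * zEval (PowerSeries.sin ℝ) (q • y)) * g w.re -
      f w.re * g (zEval (PowerSeries.exp ℝ) (p • y) * zEval (PowerSeries.sin ℝ) (q • y)) := by
  rw [skewPrim_eq]
  simp only [add_im, mul_im, map_re, map_im, map_neg, mul_neg]
  abel

/-- The relations are satisfied by the coproducts of the generators. -/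
theorem QuantumDoubleRelations.comul {lam mu : ℝˣ} {x X : Fin 3 → A}
    (h : QuantumDoubleRelations lam mu x X) {f g : A →ₐ[ℝ⟦X⟧] B}
    (hfg : ∀ p q : A, Commute (f p) (g q)) :
    QuantumDoubleRelations lam mu
      ![g (x 0) + f (x 0), (skewPrim f g (wtX lam mu) (x 0) ⟨x 1, x 2⟩).re,
        (skewPrim f g (wtX lam mu) (x 0) ⟨x 1, x 2⟩).im]
      ![g (X 0) + f (X 0), (skewPrim f g (conj (wtx mu)) (X 0) ⟨X 1, X 2⟩).re,
        (skewPrim f g (conj (wtx mu)) (X 0) ⟨X 1, X 2⟩).im] := by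
  rw [quantumDoubleRelations_iff_cx] at h ⊢
  have hfg' : ∀ p q : Cx A, Commute (Cx.map f p) (Cx.map g q) := fun p q => by
    have := fun r s => (hfg r s).eq
    refine Cx.ext ?_ ?_ <;> simp [this, add_comm]
  have key : CxRelations (wtX lam mu) (wtx mu) (of (g (x 0) + f (x 0))) (of (g (X 0) + f (X 0)))
      (skewPrim f g (wtX lam mu) (x 0) ⟨x 1, x 2⟩)
      (Cx.conj (skewPrim f g (wtX lam mu) (x 0) ⟨x 1, x 2⟩))
      (skewPrim f g (conj (wtx mu)) (X 0) ⟨X 1, X 2⟩)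
      (Cx.conj (skewPrim f g (conj (wtx mu)) (X 0) ⟨X 1, X 2⟩))
      ((2 : ℂ) • zsdiv (wtX lam mu • of (g (x 0) + f (x 0)) +
        wtx mu • of (g (X 0) + f (X 0)))) := by
    rw [conj_skewPrim, conj_skewPrim, Complex.conj_conj]
    simp only [map_add, ← map_of]
    exact h.comul (Cx.map_csmul f) (Cx.map_csmul g) hfg' (wtX_mul_conj_add lam mu) h.conj
  exact key

end SkewPrim

/-! ### Completeness of tensor products of truncations -/

section Levels

variable {A : Type*} [Ring A] [Algebra ℝ⟦X⟧ A] (n : ℕ)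

theorem ZQuot.zpow_smul (a : ZQuot A n) : (PowerSeries.X : ℝ⟦X⟧) ^ n • a = 0 := by
  obtain ⟨a, rfl⟩ := Ideal.Quotient.mk_surjective a
  exact Ideal.Quotient.eq_zero_iff_mem.2 ⟨a, rfl⟩

theorem zpow_smul_tmul {M N : Type*} [AddCommGroup M] [Module ℝ⟦X⟧ M] [AddCommGroup N] [Module ℝ⟦X⟧ N]
    (h : ∀ a : M, (PowerSeries.X : ℝ⟦X⟧) ^ n • a = 0) (t : M ⊗[ℝ⟦X⟧] N) :
    (PowerSeries.X : ℝ⟦X⟧) ^ n • t = 0 := by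
  induction t with
  | zero => rw [smul_zero]
  | add s t hs ht => rw [smul_add, hs, ht, add_zero]
  | tmul a b => rw [TensorProduct.smul_tmul', h, TensorProduct.zero_tmul]

instance {M : Type*} [Ring M] [Algebra ℝ⟦X⟧ M] :
    IsAdicComplete (Ideal.span {(PowerSeries.X : ℝ⟦X⟧)}) (ZQuot A n ⊗[ℝ⟦X⟧] M) :=
  isAdicComplete_of_zpow_smul_eq_zero (zpow_smul_tmul n (ZQuot.zpow_smul n))

end Levels

namespace QDouble

variable (lam mu : ℝˣ)

/-- The map `a ↦ a ⊗ 1` to `(A / zⁿ A) ⊗ (A / zⁿ A)`. -/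
def inl (n : ℕ) :
    QDouble lam mu →ₐ[ℝ⟦X⟧] ZQuot (QDouble lam mu) n ⊗[ℝ⟦X⟧] ZQuot (QDouble lam mu) n :=
  Algebra.TensorProduct.includeLeft.comp (ZQuot.mk n)

/-- The map `a ↦ 1 ⊗ a` to `(A / zⁿ A) ⊗ (A / zⁿ A)`. -/
def inr (n : ℕ) :
    QDouble lam mu →ₐ[ℝ⟦X⟧] ZQuot (QDouble lam mu) n ⊗[ℝ⟦X⟧] ZQuot (QDouble lam mu) n :=
  Algebra.TensorProduct.includeRight.comp (ZQuot.mk n)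

theorem inl_mul_inr (n : ℕ) (p q : QDouble lam mu) :
    inl lam mu n p * inr lam mu n q = ZQuot.mk n p ⊗ₜ ZQuot.mk n q := by
  simp [inl, inr]

theorem commute_inl_inr (n : ℕ) (p q : QDouble lam mu) :
    Commute (inl lam mu n p) (inr lam mu n q) := by
  simp [Commute, SemiconjBy, inl, inr]

/-- The tensor square of a truncation is killed by zⁿ, hence complete, and the proposed coproducts
satisfy the relations in it. -/
theorem exists_comul (n : ℕ) : ∃ φ : QDouble lam mu →ₐ[ℝ⟦X⟧]
    ZQuot (QDouble lam mu) n ⊗[ℝ⟦X⟧] ZQuot (QDouble lam mu) n,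
    φ (x lam mu 0) = inr lam mu n (x lam mu 0) + inl lam mu n (x lam mu 0) ∧
    Cx.map φ ⟨x lam mu 1, x lam mu 2⟩ = skewPrim (inl lam mu n) (inr lam mu n) (wtX lam mu)
      (x lam mu 0) ⟨x lam mu 1, x lam mu 2⟩ ∧
    φ (X lam mu 0) = inr lam mu n (X lam mu 0) + inl lam mu n (X lam mu 0) ∧
    Cx.map φ ⟨X lam mu 1, X lam mu 2⟩ = skewPrim (inl lam mu n) (inr lam mu n) (conj (wtx mu))
      (X lam mu 0) ⟨X lam mu 1, X lam mu 2⟩ := by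
  obtain ⟨φ, hx, hX⟩ := exists_lift ((relations lam mu).comul (commute_inl_inr lam mu n))
  exact ⟨φ, hx 0, Cx.ext (hx 1) (hx 2), hX 0, Cx.ext (hX 1) (hX 2)⟩

/-- The coproduct modulo `zⁿ`. -/
def comulLevel (n : ℕ) : QDouble lam mu →ₐ[ℝ⟦X⟧]
    ZQuot (QDouble lam mu) n ⊗[ℝ⟦X⟧] ZQuot (QDouble lam mu) n := (exists_comul lam mu n).choose

theorem comulLevel_x0 (n : ℕ) : comulLevel lam mu n (x lam mu 0) =
    inr lam mu n (x lam mu 0) + inl lam mu n (x lam mu 0) := (exists_comul lam mu n).choose_spec.1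

theorem comulLevel_x (n : ℕ) : Cx.map (comulLevel lam mu n) ⟨x lam mu 1, x lam mu 2⟩ =
    skewPrim (inl lam mu n) (inr lam mu n) (wtX lam mu) (x lam mu 0) ⟨x lam mu 1, x lam mu 2⟩ :=
  (exists_comul lam mu n).choose_spec.2.1

theorem comulLevel_X0 (n : ℕ) : comulLevel lam mu n (X lam mu 0) =
    inr lam mu n (X lam mu 0) + inl lam mu n (X lam mu 0) :=
  (exists_comul lam mu n).choose_spec.2.2.1

theorem comulLevel_X (n : ℕ) : Cx.map (comulLevel lam mu n) ⟨X lam mu 1, X lam mu 2⟩ =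
    skewPrim (inl lam mu n) (inr lam mu n) (conj (wtx mu)) (X lam mu 0)
      ⟨X lam mu 1, X lam mu 2⟩ := (exists_comul lam mu n).choose_spec.2.2.2

variable {lam mu} in
/-- Homomorphisms from the quantum double are determined by the images of `x⁰`, `x¹ + i x²`, `X₀`
and `X₁ + i X₂`. -/
theorem hom_ext_cx {B : Type*} [Ring B] [Algebra ℝ⟦X⟧ B]
    [IsHausdorff (Ideal.span {(PowerSeries.X : ℝ⟦X⟧)}) B] {f g : QDouble lam mu →ₐ[ℝ⟦X⟧] B}
    (h0 : f (x lam mu 0) = g (x lam mu 0))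
    (h1 : Cx.map f ⟨x lam mu 1, x lam mu 2⟩ = Cx.map g ⟨x lam mu 1, x lam mu 2⟩)
    (k0 : f (X lam mu 0) = g (X lam mu 0))
    (k1 : Cx.map f ⟨X lam mu 1, X lam mu 2⟩ = Cx.map g ⟨X lam mu 1, X lam mu 2⟩) : f = g := by
  refine hom_ext (fun i => ?_) fun i => ?_
  · fin_cases i
    exacts [h0, congrArg Cx.re h1, congrArg Cx.im h1]
  · fin_cases i
    exacts [k0, congrArg Cx.re k1, congrArg Cx.im k1]

/-- The maps at the various levels come from separate existence statements; compatibility follows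
since both sides agree on generators. -/
theorem comulLevel_trans (n : ℕ) :
    (Algebra.TensorProduct.map (ZQuot.trans (QDouble lam mu) n)
      (ZQuot.trans (QDouble lam mu) n)).comp (comulLevel lam mu (n + 1)) = comulLevel lam mu n := by
  set T := Algebra.TensorProduct.map (ZQuot.trans (QDouble lam mu) n)
      (ZQuot.trans (QDouble lam mu) n)
  have hl : T.comp (inl lam mu (n + 1)) = inl lam mu n := by
    ext a
    exact (Algebra.TensorProduct.map_tmul ..).trans (by rw [map_one]; rfl)
  have hr : T.comp (inr lam mu (n + 1)) = inr lam mu n := by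
    ext a
    exact (Algebra.TensorProduct.map_tmul ..).trans (by rw [map_one]; rfl)
  have hl' : ∀ a, T (inl lam mu (n + 1) a) = inl lam mu n a := fun a => DFunLike.congr_fun hl a
  have hr' : ∀ a, T (inr lam mu (n + 1) a) = inr lam mu n a := fun a => DFunLike.congr_fun hr a
  refine hom_ext_cx ?_ ?_ ?_ ?_
  · rw [AlgHom.comp_apply, comulLevel_x0, comulLevel_x0, map_add, hl', hr']
  · change Cx.map T (Cx.map (comulLevel lam mu (n + 1)) _) = _
    rw [comulLevel_x, comulLevel_x, map_skewPrim, hl, hr]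
  · rw [AlgHom.comp_apply, comulLevel_X0, comulLevel_X0, map_add, hl', hr']
  · change Cx.map T (Cx.map (comulLevel lam mu (n + 1)) _) = _
    rw [comulLevel_X, comulLevel_X, map_skewPrim, hl, hr]

/-- The coproduct of the quantum double. -/
def comul : QDouble lam mu →ₐ[ℝ⟦X⟧] CTensor (QDouble lam mu) :=
  (AlgHom.pi (comulLevel lam mu)).codRestrict (CTensor (QDouble lam mu)) fun a n =>
    DFunLike.congr_fun (comulLevel_trans lam mu n) a

theorem coproducts :
    QuantumDoubleCoproducts lam mu (comul lam mu) (x lam mu) (X lam mu) := by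
  have hb : conj (wtx mu) = ⟨mu, -1⟩ := Complex.ext (by simp [wtx]) (by simp [wtx])
  constructor
  · refine Subtype.ext (funext fun n => (comulLevel_x0 lam mu n).trans ?_)
    rfl
  · refine Subtype.ext (funext fun n => (congrArg Cx.re (comulLevel_x lam mu n)).trans ?_)
    rw [wtX, skewPrim_re]
    simp only [inl_mul_inr]
    rfl
  · refine Subtype.ext (funext fun n => (congrArg Cx.im (comulLevel_x lam mu n)).trans ?_)
    rw [wtX, skewPrim_im]
    simp only [inl_mul_inr]
    rfl
  · refine Subtype.ext (funext fun n => (comulLevel_X0 lam mu n).trans ?_)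
    rfl
  · refine Subtype.ext (funext fun n => (congrArg Cx.re (comulLevel_X lam mu n)).trans ?_)
    rw [hb, skewPrim_re, one_smul]
    simp only [inl_mul_inr]
    rfl
  · refine Subtype.ext (funext fun n => (congrArg Cx.im (comulLevel_X lam mu n)).trans ?_)
    rw [hb, skewPrim_im, one_smul]
    simp only [inl_mul_inr]
    rfl

end QDouble

end

noncomputable section

/-! ### Coassociativity and the counit -/

section SkewPrim

open Cx

variable {A B : Type*} [Ring A] [Algebra ℝ⟦X⟧ A] [Ring B] [Algebra ℝ⟦X⟧ B] [Algebra ℝ B]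
  [IsAdicComplete (Ideal.span {(PowerSeries.X : ℝ⟦X⟧)}) B]

/-- The exponentials are group-like because y is primitive. Both iterated coproducts equal e⁻ ⊗ e⁻ ⊗
w + e⁻ ⊗ w ⊗ e⁺ + w ⊗ e⁺ ⊗ e⁺. -/
theorem skewPrim_coassoc {j₁ j₂ j₃ α β : A →ₐ[ℝ⟦X⟧] B} {c : ℂ} {y : A} {w : Cx A}
    (h₁₂ : Commute (j₁ y) (j₂ y)) (h₂₃ : Commute (j₂ y) (j₃ y))
    (hα : α y = j₂ y + j₁ y) (hα' : Cx.map α w = skewPrim j₁ j₂ c y w)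
    (hβ : β y = j₃ y + j₂ y) (hβ' : Cx.map β w = skewPrim j₂ j₃ c y w) :
    skewPrim α j₃ c y w = skewPrim j₁ β c y w := by
  have e₁ : zexp (-(c • of (α y))) = zexp (-(c • of (j₁ y))) * zexp (-(c • of (j₂ y))) := by
    rw [← zexp_add ((((h₁₂.map of).smul_left c).smul_right c).neg_left.neg_right), hα, map_add]
    congr 1
    module
  have e₂ : zexp (c • of (β y)) = zexp (c • of (j₂ y)) * zexp (c • of (j₃ y)) := by
    rw [← zexp_add (((h₂₃.map of).smul_left c).smul_right c), hβ, map_add]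
    congr 1
    module
  rw [skewPrim, skewPrim, hα', hβ', skewPrim, skewPrim]
  simp only [map_of, e₁, e₂]
  noncomm_ring

theorem skewPrim_of_left {f g : A →ₐ[ℝ⟦X⟧] B} {c : ℂ} {y : A} {w : Cx A} (hy : f y = 0)
    (hw : Cx.map f w = 0) : skewPrim f g c y w = Cx.map g w := by
  rw [skewPrim, hw, map_of, hy, map_zero, smul_zero, neg_zero, zexp_zero, one_mul, zero_mul,
    add_zero]

theorem skewPrim_of_right {f g : A →ₐ[ℝ⟦X⟧] B} {c : ℂ} {y : A} {w : Cx A} (hy : g y = 0)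
    (hw : Cx.map g w = 0) : skewPrim f g c y w = Cx.map f w := by
  rw [skewPrim, hw, map_of g, hy, map_zero, smul_zero, zexp_zero, mul_one, mul_zero, zero_add]

end SkewPrim

namespace QDouble

variable (lam mu : ℝˣ)

/-- Here L and R play the roles of Δ ⊗ id and id ⊗ Δ, while s and t embed the first two and the last
two of three tensor factors; `hst` says that they share the middle one. -/
theorem coassoc_of_comp {C : Type*} [Ring C] [Algebra ℝ⟦X⟧ C] [Algebra ℝ C]
    [IsScalarTower ℝ ℝ⟦X⟧ C] [IsAdicComplete (Ideal.span {(PowerSeries.X : ℝ⟦X⟧)}) C] {n : ℕ}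
    {L R s t : ZQuot (QDouble lam mu) n ⊗[ℝ⟦X⟧] ZQuot (QDouble lam mu) n →ₐ[ℝ⟦X⟧] C}
    (hL₁ : L.comp (inl lam mu n) = s.comp (comulLevel lam mu n))
    (hL₂ : L.comp (inr lam mu n) = t.comp (inr lam mu n))
    (hR₁ : R.comp (inl lam mu n) = s.comp (inl lam mu n))
    (hR₂ : R.comp (inr lam mu n) = t.comp (comulLevel lam mu n))
    (hst : t.comp (inl lam mu n) = s.comp (inr lam mu n)) :
    L.comp (comulLevel lam mu n) = R.comp (comulLevel lam mu n) := by
  have h₁₂ : ∀ p, Commute (s.comp (inl lam mu n) p) (s.comp (inr lam mu n) p) :=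
    fun p => (commute_inl_inr lam mu n p p).map s
  have h₂₃ : ∀ p, Commute (s.comp (inr lam mu n) p) (t.comp (inr lam mu n) p) := fun p => by
    rw [← hst]
    exact (commute_inl_inr lam mu n p p).map t
  have key₀ : ∀ y, comulLevel lam mu n y = inr lam mu n y + inl lam mu n y →
      s.comp (comulLevel lam mu n) y = s.comp (inr lam mu n) y + s.comp (inl lam mu n) y ∧
      t.comp (comulLevel lam mu n) y = t.comp (inr lam mu n) y + s.comp (inr lam mu n) y := by
    intro y hy
    refine ⟨(congrArg s hy).trans (map_add ..), ?_⟩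
    rw [← hst]
    exact (congrArg t hy).trans (map_add ..)
  have prim : ∀ y, comulLevel lam mu n y = inr lam mu n y + inl lam mu n y →
      L.comp (comulLevel lam mu n) y = R.comp (comulLevel lam mu n) y := by
    intro y hy
    have e : ∀ M : ZQuot (QDouble lam mu) n ⊗[ℝ⟦X⟧] ZQuot (QDouble lam mu) n →ₐ[ℝ⟦X⟧] C,
        M.comp (comulLevel lam mu n) y = M.comp (inr lam mu n) y + M.comp (inl lam mu n) y :=
      fun M => (congrArg M hy).trans (map_add ..)
    rw [e, e, hL₁, hL₂, hR₁, hR₂, (key₀ y hy).1, (key₀ y hy).2, add_assoc]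
  have skew : ∀ c y w, comulLevel lam mu n y = inr lam mu n y + inl lam mu n y →
      Cx.map (comulLevel lam mu n) w = skewPrim (inl lam mu n) (inr lam mu n) c y w →
      Cx.map (L.comp (comulLevel lam mu n)) w = Cx.map (R.comp (comulLevel lam mu n)) w := by
    intro c y w hy hw
    have e : ∀ M : ZQuot (QDouble lam mu) n ⊗[ℝ⟦X⟧] ZQuot (QDouble lam mu) n →ₐ[ℝ⟦X⟧] C,
        Cx.map (M.comp (comulLevel lam mu n)) w =
          skewPrim (M.comp (inl lam mu n)) (M.comp (inr lam mu n)) c y w :=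
      fun M => (congrArg (Cx.map M) hw).trans (map_skewPrim ..)
    rw [e, e, hL₁, hL₂, hR₁, hR₂]
    refine skewPrim_coassoc (h₁₂ y) (h₂₃ y) (key₀ y hy).1 (e s) (key₀ y hy).2 ?_
    rw [← hst]
    exact e t
  exact hom_ext_cx (prim _ (comulLevel_x0 lam mu n))
    (skew _ _ _ (comulLevel_x0 lam mu n) (comulLevel_x lam mu n))
    (prim _ (comulLevel_X0 lam mu n))
    (skew _ _ _ (comulLevel_X0 lam mu n) (comulLevel_X lam mu n))

theorem coassoc (n : ℕ) (a : QDouble lam mu) :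
    Algebra.TensorProduct.assoc ℝ⟦X⟧ ℝ⟦X⟧ ℝ⟦X⟧ (ZQuot (QDouble lam mu) n)
      (ZQuot (QDouble lam mu) n) (ZQuot (QDouble lam mu) n)
      (Algebra.TensorProduct.map (CTensor.level (comul lam mu) n)
        (AlgHom.id ℝ⟦X⟧ (ZQuot (QDouble lam mu) n)) ((comul lam mu a).1 n)) =
    Algebra.TensorProduct.map (AlgHom.id ℝ⟦X⟧ (ZQuot (QDouble lam mu) n))
      (CTensor.level (comul lam mu) n) ((comul lam mu a).1 n) :=
  DFunLike.congr_fun (coassoc_of_comp lam mu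
    (L := (Algebra.TensorProduct.assoc ℝ⟦X⟧ ℝ⟦X⟧ ℝ⟦X⟧ (ZQuot (QDouble lam mu) n)
      (ZQuot (QDouble lam mu) n) (ZQuot (QDouble lam mu) n)).toAlgHom.comp
      (Algebra.TensorProduct.map (CTensor.level (comul lam mu) n)
        (AlgHom.id ℝ⟦X⟧ (ZQuot (QDouble lam mu) n))))
    (R := Algebra.TensorProduct.map (AlgHom.id ℝ⟦X⟧ (ZQuot (QDouble lam mu) n))
      (CTensor.level (comul lam mu) n))
    (s := (Algebra.TensorProduct.assoc ℝ⟦X⟧ ℝ⟦X⟧ ℝ⟦X⟧ (ZQuot (QDouble lam mu) n)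
      (ZQuot (QDouble lam mu) n) (ZQuot (QDouble lam mu) n)).toAlgHom.comp
      Algebra.TensorProduct.includeLeft)
    (t := Algebra.TensorProduct.includeRight)
    (AlgHom.ext fun _ => congrArg (Algebra.TensorProduct.assoc ℝ⟦X⟧ ℝ⟦X⟧ ℝ⟦X⟧ _ _ _)
      (Algebra.TensorProduct.map_tmul ..))
    (AlgHom.ext fun _ => (congrArg (Algebra.TensorProduct.assoc ℝ⟦X⟧ ℝ⟦X⟧ ℝ⟦X⟧ _ _ _)
      (Algebra.TensorProduct.map_tmul ..)).trans (by rw [map_one]; rfl))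
    (AlgHom.ext fun _ => (Algebra.TensorProduct.map_tmul ..).trans (by rw [map_one]; rfl))
    (AlgHom.ext fun _ => Algebra.TensorProduct.map_tmul ..)
    (AlgHom.ext fun _ => rfl)) a

end QDouble

theorem zEvalDiv_zero {B : Type*} [Ring B] [Algebra ℝ⟦X⟧ B] [Algebra ℝ B]
    [IsAdicComplete (Ideal.span {(PowerSeries.X : ℝ⟦X⟧)}) B] (φ : ℝ⟦X⟧) :
    zEvalDiv φ (0 : B) = 0 := by
  simpa [zEvalDiv] using zSum_zero (B := B)

/-- All right-hand sides vanish at the origin, so the zero solution exists; it yields the counit. -/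
theorem quantumDoubleRelations_zero (lam mu : ℝˣ) {B : Type*} [Ring B] [Algebra ℝ⟦X⟧ B]
    [Algebra ℝ B] [IsAdicComplete (Ideal.span {(PowerSeries.X : ℝ⟦X⟧)}) B] :
    QuantumDoubleRelations lam mu (0 : Fin 3 → B) 0 := by
  constructor <;> simp [zEvalDiv_zero, Ring.lie_def]

/-- The isomorphism between `ℝ⟦z⟧` and the formal power series over the algebra `ℝ`. -/
def Formal.realEquiv : Formal ℝ →ₐ[ℝ⟦X⟧] ℝ⟦X⟧ :=
  { (Formal.toPS (R := ℝ)).toRingHom with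
    commutes' := fun c => (Formal.toPS_algebraMap c).trans (by ext; simp) }

namespace QDouble

variable (lam mu : ℝˣ)

theorem exists_counit : ∃ ε : QDouble lam mu →ₐ[ℝ⟦X⟧] ℝ⟦X⟧,
    (∀ i, ε (x lam mu i) = 0) ∧ ∀ i, ε (X lam mu i) = 0 := by
  obtain ⟨φ, hx, hX⟩ := exists_lift (quantumDoubleRelations_zero lam mu (B := Formal ℝ))
  exact ⟨Formal.realEquiv.comp φ, fun i => (congrArg Formal.realEquiv (hx i)).trans (map_zero _),
    fun i => (congrArg Formal.realEquiv (hX i)).trans (map_zero _)⟩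

/-- The counit of the quantum double. -/
def counit : QDouble lam mu →ₐ[ℝ⟦X⟧] ℝ⟦X⟧ := (exists_counit lam mu).choose

theorem counit_x (i : Fin 3) : counit lam mu (x lam mu i) = 0 :=
  (exists_counit lam mu).choose_spec.1 i

theorem counit_X (i : Fin 3) : counit lam mu (X lam mu i) = 0 :=
  (exists_counit lam mu).choose_spec.2 i

theorem counit_left (n : ℕ) (a : QDouble lam mu) :
    Algebra.TensorProduct.map (ZQuot.map (counit lam mu) n)
      (AlgHom.id ℝ⟦X⟧ (ZQuot (QDouble lam mu) n)) ((comul lam mu a).1 n) =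
      1 ⊗ₜ[ℝ⟦X⟧] ZQuot.mk n a := by
  set T := Algebra.TensorProduct.map (ZQuot.map (counit lam mu) n)
      (AlgHom.id ℝ⟦X⟧ (ZQuot (QDouble lam mu) n)) with hT
  let j : QDouble lam mu →ₐ[ℝ⟦X⟧] ZQuot ℝ⟦X⟧ n ⊗[ℝ⟦X⟧] ZQuot (QDouble lam mu) n :=
    Algebra.TensorProduct.includeRight.comp (ZQuot.mk n)
  have hr : T.comp (inr lam mu n) = j := AlgHom.ext fun a =>
    (Algebra.TensorProduct.map_tmul ..).trans (by rw [map_one]; rfl)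
  have hl : ∀ a, counit lam mu a = 0 → T.comp (inl lam mu n) a = 0 := fun a ha => by
    have h0 : ZQuot.map (counit lam mu) n (ZQuot.mk n a) = 0 :=
      (congrArg (ZQuot.mk n) ha).trans (map_zero _)
    exact (Algebra.TensorProduct.map_tmul ..).trans ((congrArg (· ⊗ₜ _) h0).trans
      (TensorProduct.zero_tmul ..))
  have hr' : ∀ a, T (inr lam mu n a) = j a := DFunLike.congr_fun hr
  suffices h : T.comp (comulLevel lam mu n) = j from DFunLike.congr_fun h a
  refine hom_ext_cx ?_ ?_ ?_ ?_
  · rw [AlgHom.comp_apply, comulLevel_x0, map_add, hr']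
    exact (congrArg _ (hl _ (counit_x lam mu 0))).trans (add_zero _)
  · refine (congrArg (Cx.map T) (comulLevel_x lam mu n)).trans ?_
    rw [map_skewPrim, hr, skewPrim_of_left (hl _ (counit_x lam mu 0))]
    exact Cx.ext (hl _ (counit_x lam mu 1)) (hl _ (counit_x lam mu 2))
  · rw [AlgHom.comp_apply, comulLevel_X0, map_add, hr']
    exact (congrArg _ (hl _ (counit_X lam mu 0))).trans (add_zero _)
  · refine (congrArg (Cx.map T) (comulLevel_X lam mu n)).trans ?_
    rw [map_skewPrim, hr, skewPrim_of_left (hl _ (counit_X lam mu 0))]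
    exact Cx.ext (hl _ (counit_X lam mu 1)) (hl _ (counit_X lam mu 2))

theorem counit_right (n : ℕ) (a : QDouble lam mu) :
    Algebra.TensorProduct.map (AlgHom.id ℝ⟦X⟧ (ZQuot (QDouble lam mu) n))
      (ZQuot.map (counit lam mu) n) ((comul lam mu a).1 n) = ZQuot.mk n a ⊗ₜ[ℝ⟦X⟧] 1 := by
  set T := Algebra.TensorProduct.map (AlgHom.id ℝ⟦X⟧ (ZQuot (QDouble lam mu) n))
    (ZQuot.map (counit lam mu) n) with hT
  let j : QDouble lam mu →ₐ[ℝ⟦X⟧] ZQuot (QDouble lam mu) n ⊗[ℝ⟦X⟧] ZQuot ℝ⟦X⟧ n :=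
    Algebra.TensorProduct.includeLeft.comp (ZQuot.mk n)
  have hl : T.comp (inl lam mu n) = j := AlgHom.ext fun a =>
    (Algebra.TensorProduct.map_tmul ..).trans (by rw [map_one]; rfl)
  have hr : ∀ a, counit lam mu a = 0 → T.comp (inr lam mu n) a = 0 := fun a ha => by
    have h0 : ZQuot.map (counit lam mu) n (ZQuot.mk n a) = 0 :=
      (congrArg (ZQuot.mk n) ha).trans (map_zero _)
    exact (Algebra.TensorProduct.map_tmul ..).trans ((congrArg (_ ⊗ₜ ·) h0).trans
      (TensorProduct.tmul_zero ..))
  have hl' : ∀ a, T (inl lam mu n a) = j a := DFunLike.congr_fun hl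
  suffices h : T.comp (comulLevel lam mu n) = j from DFunLike.congr_fun h a
  refine hom_ext_cx ?_ ?_ ?_ ?_
  · rw [AlgHom.comp_apply, comulLevel_x0, map_add, hl']
    exact (congrArg (· + _) (hr _ (counit_x lam mu 0))).trans (zero_add _)
  · refine (congrArg (Cx.map T) (comulLevel_x lam mu n)).trans ?_
    rw [map_skewPrim, hl, skewPrim_of_right (hr _ (counit_x lam mu 0))]
    exact Cx.ext (hr _ (counit_x lam mu 1)) (hr _ (counit_x lam mu 2))
  · rw [AlgHom.comp_apply, comulLevel_X0, map_add, hl']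
    exact (congrArg (· + _) (hr _ (counit_X lam mu 0))).trans (zero_add _)
  · refine (congrArg (Cx.map T) (comulLevel_X lam mu n)).trans ?_
    rw [map_skewPrim, hl, skewPrim_of_right (hr _ (counit_X lam mu 0))]
    exact Cx.ext (hr _ (counit_X lam mu 1)) (hr _ (counit_X lam mu 2))

end QDouble

end

noncomputable section

/-! ### The antipode -/

section Opposite

open MulOpposite

variable {A : Type*} [Ring A] [Algebra ℝ⟦X⟧ A]

instance [IsAdicComplete (Ideal.span {(PowerSeries.X : ℝ⟦X⟧)}) A] :
    IsAdicComplete (Ideal.span {(PowerSeries.X : ℝ⟦X⟧)}) Aᵐᵒᵖ := by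
  refine isAdicComplete_of_hasZSum (fun a ha => ?_) fun c => ?_
  · refine unop_injective (eq_zero_of_forall_zpow fun n => ?_)
    obtain ⟨b, hb⟩ := ha n
    exact ⟨unop b, congrArg unop hb⟩
  · have := (hasZSum_zSum fun k => unop (c k)).map (opLinearEquiv ℝ⟦X⟧ (M := A)).toLinearMap
    exact ⟨_, this⟩

omit [Algebra ℝ⟦X⟧ A] in
theorem DoubleRelations.op_neg {lam mu : ℝˣ} [Algebra ℝ A] {x X : Fin 3 → A} {p q : A}
    (h : DoubleRelations lam mu x X p q) :
    DoubleRelations lam mu (fun i => op (-x i)) (fun i => op (-X i)) (op (-p)) (op (-q)) := by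
  constructor <;> apply unop_injective <;>
    simp only [unop_sub, unop_mul, unop_op, neg_mul_neg, unop_smul, unop_add, unop_neg, unop_zero]
  · linear_combination (norm := module) -h.x0_x1
  · linear_combination (norm := module) -h.x0_x2
  · linear_combination (norm := module) -h.x1_x2
  · linear_combination (norm := module) -h.X0_X1
  · linear_combination (norm := module) -h.X0_X2
  · linear_combination (norm := module) -h.X1_X2
  · linear_combination (norm := module) -h.x0_X0
  · linear_combination (norm := module) -h.x0_X1
  · linear_combination (norm := module) -h.x0_X2
  · linear_combination (norm := module) -h.x1_X0
  · linear_combination (norm := module) -h.x2_X0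
  · linear_combination (norm := module) -h.x1_X1
  · linear_combination (norm := module) -h.x1_X2
  · linear_combination (norm := module) -h.x2_X1
  · linear_combination (norm := module) -h.x2_X2

variable [Algebra ℝ A] [IsAdicComplete (Ideal.span {(PowerSeries.X : ℝ⟦X⟧)}) A]

theorem zEval_op (φ : ℝ⟦X⟧) (y : A) : zEval φ (op y) = op (zEval φ y) :=
  (map_zSum (opLinearEquiv ℝ⟦X⟧ (M := A)).toLinearMap _).symm

theorem zEvalDiv_op (φ : ℝ⟦X⟧) (y : A) : zEvalDiv φ (op y) = op (zEvalDiv φ y) :=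
  (map_zSum (opLinearEquiv ℝ⟦X⟧ (M := A)).toLinearMap _).symm

theorem commute_zEvalDiv {x y : A} (h : Commute x y) (ψ : ℝ⟦X⟧) : Commute x (zEvalDiv ψ y) := by
  rw [← zsum_fEvalDiv]
  refine commute_zsum fun k => ?_
  rw [coeff_fEvalDiv]
  exact (h.pow_right _).smul_right _

/-- Passing to the opposite algebra and negating generators negates every commutator. The linear
right-hand sides change sign, and so do sinh · cos and sin · cosh, being odd times even. Their
factors commute, so the reversed multiplication is harmless. -/
theorem QuantumDoubleRelations.op_neg {lam mu : ℝˣ} {x X : Fin 3 → A}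
    (h : QuantumDoubleRelations lam mu x X) :
    QuantumDoubleRelations lam mu (fun i => op (-x i)) (fun i => op (-X i)) := by
  rw [quantumDoubleRelations_iff] at h ⊢
  have e₁ : (lam / mu : ℝ) • op (-x 0) + (mu : ℝ) • op (-X 0) =
      op (-((lam / mu : ℝ) • x 0 + (mu : ℝ) • X 0)) := by
    apply unop_injective
    simp only [unop_op, unop_smul, unop_add]
    module
  have e₂ : (lam : ℝ) • op (-x 0) - op (-X 0) = op (-((lam : ℝ) • x 0 - X 0)) := by
    apply unop_injective
    simp only [unop_op, unop_smul, unop_sub]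
    module
  have hxX : Commute (x 0) (X 0) := sub_eq_zero.1 h.x0_X0
  have hPQ : Commute ((lam / mu : ℝ) • x 0 + (mu : ℝ) • X 0) ((lam : ℝ) • x 0 - X 0) :=
    Commute.add_left
      ((((Commute.refl _).smul_left _).smul_right _).sub_right (hxX.smul_left _))
      (((hxX.symm.smul_left _).smul_right _).sub_right ((Commute.refl _).smul_left _))
  have c : ∀ (φ ψ : ℝ⟦X⟧) {p q : A}, Commute p q → zEval ψ q * zEvalDiv φ p =
      zEvalDiv φ p * zEval ψ q := fun φ ψ p q hpq =>
    (commute_zEval (commute_zEvalDiv hpq.symm φ).symm ψ).eq.symm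
  have n₁ : ∀ n, Even n → PowerSeries.coeff n sinhSeries = 0 := fun n hn => by
    simp [sinhSeries, hn]
  have n₂ : ∀ n, Even n → PowerSeries.coeff n (PowerSeries.sin ℝ) = 0 := fun n hn => by
    simp [PowerSeries.sin, hn]
  have n₃ : ∀ n, ¬Even n → PowerSeries.coeff n (PowerSeries.cos ℝ) = 0 := fun n hn => by
    simp [PowerSeries.cos, hn]
  have n₄ : ∀ n, ¬Even n → PowerSeries.coeff n coshSeries = 0 := fun n hn => by
    simp [coshSeries, hn]
  rw [e₁, e₂, zEvalDiv_op, zEval_op, zEvalDiv_op, zEval_op, ← op_mul, ← op_mul,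
    zEvalDiv_neg_of_odd n₁, zEvalDiv_neg_of_odd n₂, zEval_neg_of_even n₃, zEval_neg_of_even n₄,
    mul_neg, mul_neg, c _ _ hPQ, c _ _ hPQ.symm]
  exact h.op_neg

end Opposite

/-! ### The antipode identity on complexified generators -/

section CxLinear

variable {A B : Type*} [Ring A] [Algebra ℝ⟦X⟧ A] [Ring B] [Algebra ℝ⟦X⟧ B]

/-- The complexification of a linear map. -/
def Cx.mapLin (f : A →ₗ[ℝ⟦X⟧] B) : Cx A →ₗ[ℝ⟦X⟧] Cx B where
  toFun w := ⟨f w.re, f w.im⟩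
  map_add' _ _ := Cx.ext (map_add ..) (map_add ..)
  map_smul' _ _ := Cx.ext (map_smul ..) (map_smul ..)

@[simp] theorem Cx.mapLin_re (f : A →ₗ[ℝ⟦X⟧] B) (w : Cx A) : (Cx.mapLin f w).re = f w.re := rfl
@[simp] theorem Cx.mapLin_im (f : A →ₗ[ℝ⟦X⟧] B) (w : Cx A) : (Cx.mapLin f w).im = f w.im := rfl

variable [Algebra ℝ A] [IsScalarTower ℝ ℝ⟦X⟧ A]

theorem Cx.mapLin_smul_of (f : A →ₗ[ℝ⟦X⟧] A) (c : ℂ) (y : A) :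
    Cx.mapLin f (c • Cx.of y) = c • Cx.of (f y) := by
  have h : ∀ r : ℝ, f (r • y) = r • f y := fun r => by
    rw [← algebraMap_smul ℝ⟦X⟧ r y, map_smul, algebraMap_smul]
  ext <;> simp [h]

variable [IsAdicComplete (Ideal.span {(PowerSeries.X : ℝ⟦X⟧)}) A]

theorem Cx.mapLin_zexp (S : A →ₗ[ℝ⟦X⟧] A) {y : A} (h : ∀ k, S (y ^ k) = (-y) ^ k) (c : ℂ) :
    Cx.mapLin S (zexp (c • Cx.of y)) = zexp (-(c • Cx.of y)) := by
  refine (map_zSum (Cx.mapLin S) _).trans (congrArg zSum (funext fun k => ?_))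
  rw [← smul_neg, ← map_neg, smul_pow, smul_pow, ← map_pow, ← map_pow, ← Complex.coe_smul,
    ← Complex.coe_smul, smul_smul, smul_smul, Cx.mapLin_smul_of, h]

variable (S : A →ₗ[ℝ⟦X⟧] A) {y : A} (hy : ∀ k, S (y ^ k) = (-y) ^ k) {c κ β : ℂ} {w : Cx A}
  (hw : Cx.mapLin S w = -(zexp (κ • (1 : Cx A)) * w))
  (hβ : Cx.of y * w - w * Cx.of y = β • w) (hκ : c * β = κ)

include hy hw hβ hκ

/-- The antipode inverts e^{−zcy}, so the claim is e^{zcy} w = e^{zκ} w e^{zcy}. This holds because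
w has weight β under y and cβ = κ. -/
theorem antipode_skewPrim_left : Cx.mapLin S (zexp (-(c • Cx.of y))) * w +
    Cx.mapLin S w * zexp (c • Cx.of y) = 0 := by
  rw [← neg_smul, Cx.mapLin_zexp S hy, hw, neg_smul, neg_neg, zexp_smul_mul hβ, hκ, neg_mul,
    mul_assoc, add_neg_cancel]

theorem antipode_skewPrim_right : zexp (-(c • Cx.of y)) * Cx.mapLin S w +
    w * Cx.mapLin S (zexp (c • Cx.of y)) = 0 := by
  have h1 := zexp_smul_mul hβ (-c)
  have h2 := (commute_zexp_smul_one κ (zexp ((-c) • Cx.of y))).eq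
  have h3 := zexp_mul_zexp_neg (κ • (1 : Cx A))
  rw [Cx.mapLin_zexp S hy, hw, mul_neg, ← neg_smul, ← mul_assoc, h2, mul_assoc, h1, neg_mul c, hκ,
    neg_smul κ, ← mul_assoc, h3, one_mul, neg_add_cancel]

end CxLinear

/-! ### Multiplicativity of the antipode identities -/

section Levels

variable {A : Type*} [Ring A] [Algebra ℝ⟦X⟧ A] {n : ℕ} {S : A →ₗ[ℝ⟦X⟧] A}
  (hS : ∀ a b, S (a * b) = S b * S a)

include hS

theorem ZQuot.mapLinear_mul (a b : ZQuot A n) :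
    ZQuot.mapLinear S n (a * b) = ZQuot.mapLinear S n b * ZQuot.mapLinear S n a := by
  obtain ⟨a, rfl⟩ := Ideal.Quotient.mk_surjective a
  obtain ⟨b, rfl⟩ := Ideal.Quotient.mk_surjective b
  exact congrArg (ZQuot.mk n) (hS a b)

/-- Antimultiplicativity places the convolution of s between S(p) and q; since it is a scalar, it
can be pulled out. -/
theorem antipode_left_mul {s t : ZQuot A n ⊗[ℝ⟦X⟧] ZQuot A n} {c : ℝ⟦X⟧}
    (hs : LinearMap.mul' ℝ⟦X⟧ _ (TensorProduct.map (ZQuot.mapLinear S n) LinearMap.id s) =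
      algebraMap _ _ c) :
    LinearMap.mul' ℝ⟦X⟧ _ (TensorProduct.map (ZQuot.mapLinear S n) LinearMap.id (s * t)) =
      c • LinearMap.mul' ℝ⟦X⟧ _ (TensorProduct.map (ZQuot.mapLinear S n) LinearMap.id t) := by
  induction t with
  | zero => simp
  | add t t' ht ht' => rw [mul_add, map_add, map_add, ht, ht', map_add, map_add, smul_add]
  | tmul p q =>
    have key : ∀ s : ZQuot A n ⊗[ℝ⟦X⟧] ZQuot A n,
        LinearMap.mul' ℝ⟦X⟧ _ (TensorProduct.map (ZQuot.mapLinear S n) LinearMap.id (s * p ⊗ₜ q)) =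
        ZQuot.mapLinear S n p * LinearMap.mul' ℝ⟦X⟧ _
          (TensorProduct.map (ZQuot.mapLinear S n) LinearMap.id s) * q := fun s => by
      induction s with
      | zero => simp
      | add s s' hs hs' => rw [add_mul, map_add, map_add, hs, hs', map_add, map_add, mul_add, add_mul]
      | tmul a b =>
        simp only [Algebra.TensorProduct.tmul_mul_tmul, TensorProduct.map_tmul,
          LinearMap.mul'_apply, LinearMap.id_apply, ZQuot.mapLinear_mul hS, mul_assoc]
    rw [key, hs, ← Algebra.commutes, mul_assoc, ← Algebra.smul_def]
    simp

theorem antipode_right_mul {s t : ZQuot A n ⊗[ℝ⟦X⟧] ZQuot A n} {c : ℝ⟦X⟧}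
    (ht : LinearMap.mul' ℝ⟦X⟧ _ (TensorProduct.map LinearMap.id (ZQuot.mapLinear S n) t) =
      algebraMap _ _ c) :
    LinearMap.mul' ℝ⟦X⟧ _ (TensorProduct.map LinearMap.id (ZQuot.mapLinear S n) (s * t)) =
      c • LinearMap.mul' ℝ⟦X⟧ _ (TensorProduct.map LinearMap.id (ZQuot.mapLinear S n) s) := by
  induction s with
  | zero => simp
  | add s s' hs hs' => rw [add_mul, map_add, map_add, hs, hs', map_add, map_add, smul_add]
  | tmul p q =>
    have key : ∀ t : ZQuot A n ⊗[ℝ⟦X⟧] ZQuot A n,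
        LinearMap.mul' ℝ⟦X⟧ _ (TensorProduct.map LinearMap.id (ZQuot.mapLinear S n) (p ⊗ₜ q * t)) =
        p * LinearMap.mul' ℝ⟦X⟧ _
          (TensorProduct.map LinearMap.id (ZQuot.mapLinear S n) t) * ZQuot.mapLinear S n q := fun t => by
      induction t with
      | zero => simp
      | add t t' ht ht' => rw [mul_add, map_add, map_add, ht, ht', map_add, map_add, mul_add, add_mul]
      | tmul a b =>
        simp only [Algebra.TensorProduct.tmul_mul_tmul, TensorProduct.map_tmul,
          LinearMap.mul'_apply, LinearMap.id_apply, ZQuot.mapLinear_mul hS, mul_assoc]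
    rw [key, ht, ← Algebra.commutes, mul_assoc, ← Algebra.smul_def]
    simp

end Levels

namespace QDouble

open MulOpposite

variable (lam mu : ℝˣ)

/-- The anti-automorphism that changes the signs of the generators. -/
def sgn : QDouble lam mu →ₐ[ℝ⟦X⟧] (QDouble lam mu)ᵐᵒᵖ :=
  (exists_lift (relations lam mu).op_neg).choose

theorem sgn_x (i : Fin 3) : sgn lam mu (x lam mu i) = op (-x lam mu i) :=
  (exists_lift (relations lam mu).op_neg).choose_spec.1 i

theorem sgn_X (i : Fin 3) : sgn lam mu (X lam mu i) = op (-X lam mu i) :=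
  (exists_lift (relations lam mu).op_neg).choose_spec.2 i

/-- The Cartan element whose exponential implements the square root of the square of the
antipode. -/
def cartan : QDouble lam mu := (lam / mu : ℝ) • x lam mu 0 + (mu : ℝ) • X lam mu 0

/-- The antipode of the quantum double. -/
def antipode : QDouble lam mu →ₗ[ℝ⟦X⟧] QDouble lam mu where
  -- The sign change alone sends u to −u, while the coproduct requires −e^{zab} u. Conjugation by
  -- the exponential of the Cartan element supplies the missing scalar.
  toFun a := zexp (cartan lam mu) * unop (sgn lam mu a) * zexp (-cartan lam mu)
  map_add' a b := by rw [map_add, unop_add, mul_add, add_mul]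
  map_smul' c a := by
    rw [map_smul, unop_smul, mul_smul_comm, smul_mul_assoc, RingHom.id_apply]

theorem antipode_apply (a : QDouble lam mu) : antipode lam mu a =
    zexp (cartan lam mu) * unop (sgn lam mu a) * zexp (-cartan lam mu) := rfl

theorem antipode_mul (a b : QDouble lam mu) :
    antipode lam mu (a * b) = antipode lam mu b * antipode lam mu a := by
  simp only [antipode_apply, map_mul, unop_mul, mul_assoc]
  rw [← mul_assoc (zexp (-cartan lam mu)) (zexp (cartan lam mu)), zexp_neg_mul_zexp, one_mul]

theorem antipode_one : antipode lam mu 1 = 1 := by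
  rw [antipode_apply, map_one, unop_one, mul_one, zexp_mul_zexp_neg]

theorem antipode_pow_of_commute {y : QDouble lam mu} (hy : sgn lam mu y = op (-y))
    (h : Commute (cartan lam mu) y) (k : ℕ) : antipode lam mu (y ^ k) = (-y) ^ k := by
  have := (commute_zEval (h.neg_right.pow_right k).symm (PowerSeries.exp ℝ)).eq
  rw [antipode_apply, map_pow, hy, ← op_pow, unop_op, ← this, mul_assoc, zexp_mul_zexp_neg, mul_one]

theorem commute_x0_X0 : Commute (x lam mu 0) (X lam mu 0) :=
  sub_eq_zero.1 ((quantumDoubleRelations_iff lam mu _ _).1 (relations lam mu)).x0_X0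

theorem commute_cartan_x0 : Commute (cartan lam mu) (x lam mu 0) :=
  ((Commute.refl _).smul_left _).add_left ((commute_x0_X0 lam mu).symm.smul_left _)

theorem commute_cartan_X0 : Commute (cartan lam mu) (X lam mu 0) :=
  ((commute_x0_X0 lam mu).smul_left _).add_left ((Commute.refl _).smul_left _)

theorem mapLin_antipode {w : Cx (QDouble lam mu)} {κ : ℂ}
    (hr : sgn lam mu w.re = op (-w.re)) (hi : sgn lam mu w.im = op (-w.im))
    (h : Cx.of (cartan lam mu) * w - w * Cx.of (cartan lam mu) = κ • w) :
    Cx.mapLin (antipode lam mu) w = -(zexp (κ • (1 : Cx (QDouble lam mu))) * w) := by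
  have e : Cx.mapLin (antipode lam mu) w =
      -(zexp (Cx.of (cartan lam mu)) * w * zexp (-Cx.of (cartan lam mu))) := by
    rw [← Cx.of_zEval, ← map_neg, ← Cx.of_zEval]
    ext <;> simp [antipode_apply, hr, hi]
  have h1 := zexp_smul_mul h 1
  rw [one_smul, one_mul] at h1
  rw [e, h1, mul_assoc, mul_assoc, zexp_mul_zexp_neg, mul_one]

theorem cartan_lie {w : Cx (QDouble lam mu)} {r s : ℂ}
    (h₁ : Cx.of (x lam mu 0) * w - w * Cx.of (x lam mu 0) = r • w)
    (h₂ : Cx.of (X lam mu 0) * w - w * Cx.of (X lam mu 0) = s • w) :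
    Cx.of (cartan lam mu) * w - w * Cx.of (cartan lam mu) =
      ((lam / mu : ℝ) * r + (mu : ℝ) * s) • w := by
  rw [add_smul, mul_smul, mul_smul, ← h₁, ← h₂, cartan, map_add, Cx.of_smul, Cx.of_smul,
    Complex.coe_smul, Complex.coe_smul]
  simp only [add_mul, mul_add, smul_mul_assoc, mul_smul_comm, smul_sub]
  abel

/-- The Cartan element is chosen so that its weight on u is ab, the exponent demanded by the
coproduct of u. Its coefficients are real, so conjugation gives the matching identity for v. -/
theorem wt_identity : ((lam / mu : ℝ) : ℂ) * wtx mu + (mu : ℝ) * wtX lam mu =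
    wtX lam mu * wtx mu := by
  have := mu.ne_zero
  apply Complex.ext <;> simp [wtX, wtx] <;> field_simp

theorem relations_cx :
    CxRelations (wtX lam mu) (wtx mu) (Cx.of (x lam mu 0)) (Cx.of (X lam mu 0))
      ⟨x lam mu 1, x lam mu 2⟩ (Cx.conj ⟨x lam mu 1, x lam mu 2⟩) ⟨X lam mu 1, X lam mu 2⟩
      (Cx.conj ⟨X lam mu 1, X lam mu 2⟩)
      ((2 : ℂ) • zsdiv (wtX lam mu • Cx.of (x lam mu 0) + wtx mu • Cx.of (X lam mu 0))) :=
  (quantumDoubleRelations_iff_cx lam mu _ _).1 (relations lam mu)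

theorem mapLin_antipode_x : Cx.mapLin (antipode lam mu) ⟨x lam mu 1, x lam mu 2⟩ =
    -(zexp ((wtX lam mu * wtx mu) • (1 : Cx (QDouble lam mu))) * ⟨x lam mu 1, x lam mu 2⟩) := by
  refine mapLin_antipode lam mu (sgn_x lam mu 1) (sgn_x lam mu 2) ?_
  rw [cartan_lie lam mu (relations_cx lam mu).x_u (relations_cx lam mu).X_u, wt_identity]

theorem mapLin_antipode_X : Cx.mapLin (antipode lam mu) ⟨X lam mu 1, X lam mu 2⟩ =
    -(zexp ((conj (wtx mu) * -conj (wtX lam mu)) • (1 : Cx (QDouble lam mu))) *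
      ⟨X lam mu 1, X lam mu 2⟩) := by
  refine mapLin_antipode lam mu (sgn_X lam mu 1) (sgn_X lam mu 2) ?_
  rw [cartan_lie lam mu (relations_cx lam mu).x_v (relations_cx lam mu).X_v]
  have := congrArg conj (wt_identity lam mu)
  rw [map_add, map_mul, map_mul, map_mul, Complex.conj_ofReal, Complex.conj_ofReal] at this
  congr 1
  linear_combination -this

section Axioms

variable {lam mu} {n : ℕ}
  {L : ZQuot (QDouble lam mu) n ⊗[ℝ⟦X⟧] ZQuot (QDouble lam mu) n →ₗ[ℝ⟦X⟧] ZQuot (QDouble lam mu) n}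
  {f g : QDouble lam mu →ₗ[ℝ⟦X⟧] QDouble lam mu}
  (hL : ∀ p q, L (inl lam mu n p * inr lam mu n q) = ZQuot.mk n (f p * g q))

include hL

theorem mapLin_mul (p q : Cx (QDouble lam mu)) :
    Cx.mapLin L (Cx.map (inl lam mu n) p * Cx.map (inr lam mu n) q) =
      Cx.map (ZQuot.mk n) (Cx.mapLin f p * Cx.mapLin g q) := by
  refine Cx.ext ?_ ?_ <;> simp only [Cx.mapLin_re, Cx.mapLin_im, Cx.mul_re, Cx.mul_im, Cx.map_re,
    Cx.map_im, map_add, map_sub, hL]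

theorem mapLin_skewPrim (c : ℂ) (y : QDouble lam mu) (w : Cx (QDouble lam mu)) :
    Cx.mapLin L (skewPrim (inl lam mu n) (inr lam mu n) c y w) =
      Cx.map (ZQuot.mk n) (Cx.mapLin f (zexp (-(c • Cx.of y))) * Cx.mapLin g w +
        Cx.mapLin f w * Cx.mapLin g (zexp (c • Cx.of y))) := by
  rw [map_add (Cx.map (ZQuot.mk n)), ← mapLin_mul hL, ← mapLin_mul hL, map_zEval, map_zEval, map_neg,
    Cx.map_csmul, Cx.map_csmul, ← map_add]
  rfl

/-- With L = m ∘ (f ⊗ g) this covers both antipode axioms. The elements satisfying the axiom form a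
subalgebra, closed under products by `hmul`, which contains the generators and everything divisible
by zⁿ. -/
theorem antipode_axiom (h1 : f 1 = 1) (h1' : g 1 = 1)
    (hx : f (x lam mu 0) + g (x lam mu 0) = 0) (hX : f (X lam mu 0) + g (X lam mu 0) = 0)
    (hx' : Cx.mapLin f (zexp (-(wtX lam mu • Cx.of (x lam mu 0)))) *
      Cx.mapLin g ⟨x lam mu 1, x lam mu 2⟩ + Cx.mapLin f ⟨x lam mu 1, x lam mu 2⟩ *
      Cx.mapLin g (zexp (wtX lam mu • Cx.of (x lam mu 0))) = 0)
    (hX' : Cx.mapLin f (zexp (-(conj (wtx mu) • Cx.of (X lam mu 0)))) *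
      Cx.mapLin g ⟨X lam mu 1, X lam mu 2⟩ + Cx.mapLin f ⟨X lam mu 1, X lam mu 2⟩ *
      Cx.mapLin g (zexp (conj (wtx mu) • Cx.of (X lam mu 0))) = 0)
    (hmul : ∀ a b, L (comulLevel lam mu n a) = algebraMap _ _ (counit lam mu a) →
      L (comulLevel lam mu n b) = algebraMap _ _ (counit lam mu b) →
      L (comulLevel lam mu n (a * b)) = algebraMap _ _ (counit lam mu (a * b)))
    (a : QDouble lam mu) :
    L (comulLevel lam mu n a) = algebraMap _ _ (counit lam mu a) := by
  have h0 : ∀ c : ℝ⟦X⟧, L (algebraMap _ _ c) = algebraMap _ _ c := fun c => by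
    have := hL 1 1
    rw [map_one (inl lam mu n), map_one (inr lam mu n), mul_one, h1, h1', mul_one,
      map_one (ZQuot.mk n)] at this
    rw [Algebra.algebraMap_eq_smul_one, map_smul, this, Algebra.algebraMap_eq_smul_one]
  let T : Subalgebra ℝ⟦X⟧ (QDouble lam mu) :=
    { carrier := {a | L (comulLevel lam mu n a) = algebraMap _ _ (counit lam mu a)}
      mul_mem' := fun ha hb => hmul _ _ ha hb
      add_mem' := fun {a b} ha hb => by
        rw [Set.mem_ofPred_eq, map_add, map_add, ha, hb, ← map_add, ← map_add]
      algebraMap_mem' := fun c => by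
        rw [Set.mem_ofPred_eq, AlgHom.commutes, AlgHom.commutes, h0]
        rfl }
  have prim : ∀ y, comulLevel lam mu n y = inr lam mu n y + inl lam mu n y →
      f y + g y = 0 → counit lam mu y = 0 → y ∈ T := fun y hy hfg hε => by
    have e₁ := hL 1 y
    have e₂ := hL y 1
    rw [map_one, one_mul, h1, one_mul] at e₁
    rw [map_one, mul_one, h1', mul_one] at e₂
    change L (comulLevel lam mu n y) = algebraMap _ _ (counit lam mu y)
    rw [hy, map_add, e₁, e₂, ← map_add, add_comm, hfg, hε, map_zero, map_zero]
  have hx₁ := mapLin_skewPrim hL (wtX lam mu) (x lam mu 0) ⟨x lam mu 1, x lam mu 2⟩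
  have hX₁ := mapLin_skewPrim hL (conj (wtx mu)) (X lam mu 0) ⟨X lam mu 1, X lam mu 2⟩
  rw [← comulLevel_x, hx', map_zero] at hx₁
  rw [← comulLevel_X, hX', map_zero] at hX₁
  have gen : ∀ y, L (comulLevel lam mu n y) = 0 → counit lam mu y = 0 → y ∈ T := fun y h hε => by
    change L (comulLevel lam mu n y) = algebraMap _ _ (counit lam mu y)
    rw [h, hε, map_zero]
  refine mem_of_generators T (fun i => ?_) (fun i => ?_) (n := n) (fun a => ?_) a
  · fin_cases i
    · exact prim _ (comulLevel_x0 lam mu n) hx (counit_x lam mu 0)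
    · exact gen _ (congrArg Cx.re hx₁) (counit_x lam mu 1)
    · exact gen _ (congrArg Cx.im hx₁) (counit_x lam mu 2)
  · fin_cases i
    · exact prim _ (comulLevel_X0 lam mu n) hX (counit_X lam mu 0)
    · exact gen _ (congrArg Cx.re hX₁) (counit_X lam mu 1)
    · exact gen _ (congrArg Cx.im hX₁) (counit_X lam mu 2)
  -- At level n both sides are multiples of zⁿ in the truncation, hence zero.
  · change L (comulLevel lam mu n _) = algebraMap _ _ (counit lam mu _)
    rw [map_smul, map_smul, map_smul, ZQuot.zpow_smul, smul_eq_mul, map_mul, ← Algebra.smul_def,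
      ZQuot.zpow_smul]

end Axioms

theorem antipode_pow_x0 (k : ℕ) : antipode lam mu (x lam mu 0 ^ k) = (-x lam mu 0) ^ k :=
  antipode_pow_of_commute lam mu (sgn_x lam mu 0) (commute_cartan_x0 lam mu) k

theorem antipode_pow_X0 (k : ℕ) : antipode lam mu (X lam mu 0 ^ k) = (-X lam mu 0) ^ k :=
  antipode_pow_of_commute lam mu (sgn_X lam mu 0) (commute_cartan_X0 lam mu) k

theorem antipode_x0 : antipode lam mu (x lam mu 0) = -x lam mu 0 := by
  simpa using antipode_pow_x0 lam mu 1

theorem antipode_X0 : antipode lam mu (X lam mu 0) = -X lam mu 0 := by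
  simpa using antipode_pow_X0 lam mu 1

theorem antipode_left (n : ℕ) (a : QDouble lam mu) :
    LinearMap.mul' ℝ⟦X⟧ (ZQuot (QDouble lam mu) n)
      (TensorProduct.map (ZQuot.mapLinear (antipode lam mu) n) LinearMap.id
        ((comul lam mu a).1 n)) = algebraMap ℝ⟦X⟧ _ (counit lam mu a) := by
  refine antipode_axiom
    (L := LinearMap.mul' ℝ⟦X⟧ (ZQuot (QDouble lam mu) n) ∘ₗ
      TensorProduct.map (ZQuot.mapLinear (antipode lam mu) n) LinearMap.id)
    (f := antipode lam mu) (g := LinearMap.id) (fun p q => ?_) (antipode_one lam mu) rfl ?_ ?_ ?_ ?_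
    (fun a b ha hb => ?_) a
  · rw [inl_mul_inr]
    rfl
  · rw [antipode_x0]
    exact neg_add_cancel _
  · rw [antipode_X0]
    exact neg_add_cancel _
  · exact antipode_skewPrim_left (antipode lam mu) (antipode_pow_x0 lam mu)
      (mapLin_antipode_x lam mu) (relations_cx lam mu).x_u rfl
  · exact antipode_skewPrim_left (antipode lam mu) (antipode_pow_X0 lam mu)
      (mapLin_antipode_X lam mu) (relations_cx lam mu).X_v rfl
  · rw [map_mul (comulLevel lam mu n), map_mul (counit lam mu), map_mul (algebraMap _ _),
      ← hb, ← Algebra.smul_def]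
    exact antipode_left_mul (antipode_mul lam mu) ha

theorem antipode_right (n : ℕ) (a : QDouble lam mu) :
    LinearMap.mul' ℝ⟦X⟧ (ZQuot (QDouble lam mu) n)
      (TensorProduct.map LinearMap.id (ZQuot.mapLinear (antipode lam mu) n)
        ((comul lam mu a).1 n)) = algebraMap ℝ⟦X⟧ _ (counit lam mu a) := by
  refine antipode_axiom
    (L := LinearMap.mul' ℝ⟦X⟧ (ZQuot (QDouble lam mu) n) ∘ₗ
      TensorProduct.map LinearMap.id (ZQuot.mapLinear (antipode lam mu) n))
    (f := LinearMap.id) (g := antipode lam mu) (fun p q => ?_) rfl (antipode_one lam mu) ?_ ?_ ?_ ?_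
    (fun a b ha hb => ?_) a
  · rw [inl_mul_inr]
    rfl
  · rw [antipode_x0]
    exact add_neg_cancel _
  · rw [antipode_X0]
    exact add_neg_cancel _
  · exact antipode_skewPrim_right (antipode lam mu) (antipode_pow_x0 lam mu)
      (mapLin_antipode_x lam mu) (relations_cx lam mu).x_u rfl
  · exact antipode_skewPrim_right (antipode lam mu) (antipode_pow_X0 lam mu)
      (mapLin_antipode_X lam mu) (relations_cx lam mu).X_v rfl
  · rw [map_mul (comulLevel lam mu n), map_mul (counit lam mu), map_mul (algebraMap _ _),
      ← ha, ← Algebra.commutes, ← Algebra.smul_def]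
    exact antipode_right_mul (antipode_mul lam mu) hb

/-- The topological Hopf algebra structure of the quantum double. -/
def hopf : ZHopf (QDouble lam mu) where
  comul := comul lam mu
  counit := counit lam mu
  antipode := antipode lam mu
  coassoc := coassoc lam mu
  counit_left := counit_left lam mu
  counit_right := counit_right lam mu
  antipode_left := antipode_left lam mu
  antipode_right := antipode_right lam mu

end QDouble

end

noncomputable section

/-! ### The first order of the coproduct -/

set_option linter.unusedSimpArgs false

namespace S3Double

variable (lam mu : ℝˣ)

theorem cobracket_apply (Y : S3Double lam mu) : cobracket lam mu Y =
    ∑ i, (⁅Y, x lam mu i⁆ ⊗ₜ[ℝ] X lam mu i + x lam mu i ⊗ₜ[ℝ] ⁅Y, X lam mu i⁆) := by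
  change ⁅Y, rMatrix lam mu⁆ = _
  simp only [rMatrix, lie_sum, TensorProduct.LieModule.lie_tmul_right]

theorem cobracket_x0 : cobracket lam mu (x lam mu 0) = 0 := by
  rw [cobracket_apply, Fin.sum_univ_three, lie_self, x0_x1, x0_x2, x0_X0, x0_X1, x0_X2]
  simp only [TensorProduct.add_tmul, TensorProduct.tmul_sub,
    TensorProduct.sub_tmul, TensorProduct.tmul_smul, ← TensorProduct.smul_tmul',
    TensorProduct.zero_tmul, TensorProduct.tmul_zero]
  module

theorem cobracket_X0 : cobracket lam mu (X lam mu 0) = 0 := by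
  rw [cobracket_apply, Fin.sum_univ_three, lie_self, X0_X1, X0_X2, ← lie_skew _ (x lam mu 0),
    ← lie_skew _ (x lam mu 1), ← lie_skew _ (x lam mu 2), x0_X0, x1_X0, x2_X0]
  simp only [TensorProduct.tmul_add, TensorProduct.add_tmul, TensorProduct.tmul_sub,
    TensorProduct.sub_tmul, TensorProduct.tmul_smul, ← TensorProduct.smul_tmul',
    TensorProduct.zero_tmul, TensorProduct.tmul_zero, TensorProduct.neg_tmul, neg_zero]
  module

theorem cobracket_x1 : cobracket lam mu (x lam mu 1) =
    x lam mu 1 ⊗ₜ ((lam / mu : ℝ) • x lam mu 0) - ((lam / mu : ℝ) • x lam mu 0) ⊗ₜ x lam mu 1 +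
    x lam mu 2 ⊗ₜ ((lam : ℝ) • x lam mu 0) - ((lam : ℝ) • x lam mu 0) ⊗ₜ x lam mu 2 := by
  rw [cobracket_apply, Fin.sum_univ_three, lie_self, ← lie_skew _ (x lam mu 0), x0_x1, x1_x2, x1_X0,
    x1_X1, x1_X2]
  simp only [TensorProduct.tmul_add, TensorProduct.add_tmul, TensorProduct.tmul_sub,
    TensorProduct.sub_tmul, TensorProduct.tmul_smul, ← TensorProduct.smul_tmul',
    TensorProduct.zero_tmul, TensorProduct.tmul_zero, TensorProduct.neg_tmul]
  module

theorem cobracket_x2 : cobracket lam mu (x lam mu 2) =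
    x lam mu 2 ⊗ₜ ((lam / mu : ℝ) • x lam mu 0) - ((lam / mu : ℝ) • x lam mu 0) ⊗ₜ x lam mu 2 +
    ((lam : ℝ) • x lam mu 0) ⊗ₜ x lam mu 1 - x lam mu 1 ⊗ₜ ((lam : ℝ) • x lam mu 0) := by
  rw [cobracket_apply, Fin.sum_univ_three, lie_self, ← lie_skew _ (x lam mu 0),
    ← lie_skew _ (x lam mu 1), x0_x2, x1_x2, x2_X0, x2_X1, x2_X2]
  simp only [TensorProduct.tmul_add, TensorProduct.add_tmul, TensorProduct.tmul_sub,
    TensorProduct.sub_tmul, TensorProduct.tmul_smul, ← TensorProduct.smul_tmul',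
    TensorProduct.zero_tmul, TensorProduct.tmul_zero, TensorProduct.neg_tmul,
    TensorProduct.tmul_neg, neg_zero]
  module

theorem cobracket_X1 : cobracket lam mu (X lam mu 1) =
    X lam mu 1 ⊗ₜ ((mu : ℝ) • X lam mu 0) - ((mu : ℝ) • X lam mu 0) ⊗ₜ X lam mu 1 +
    X lam mu 2 ⊗ₜ X lam mu 0 - X lam mu 0 ⊗ₜ X lam mu 2 := by
  rw [cobracket_apply, Fin.sum_univ_three, lie_self, ← lie_skew _ (x lam mu 0),
    ← lie_skew _ (x lam mu 1), ← lie_skew _ (x lam mu 2), ← lie_skew _ (X lam mu 0),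
    x0_X1, X0_X1, x1_X1, x2_X1, X1_X2]
  simp only [TensorProduct.tmul_add, TensorProduct.add_tmul, TensorProduct.tmul_sub,
    TensorProduct.sub_tmul, TensorProduct.tmul_smul, ← TensorProduct.smul_tmul',
    TensorProduct.zero_tmul, TensorProduct.tmul_zero, TensorProduct.neg_tmul,
    TensorProduct.tmul_neg, neg_zero]
  module

theorem cobracket_X2 : cobracket lam mu (X lam mu 2) =
    X lam mu 2 ⊗ₜ ((mu : ℝ) • X lam mu 0) - ((mu : ℝ) • X lam mu 0) ⊗ₜ X lam mu 2 +
    X lam mu 0 ⊗ₜ X lam mu 1 - X lam mu 1 ⊗ₜ X lam mu 0 := by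
  rw [cobracket_apply, Fin.sum_univ_three, lie_self, ← lie_skew _ (x lam mu 0),
    ← lie_skew _ (x lam mu 1), ← lie_skew _ (x lam mu 2), ← lie_skew _ (X lam mu 0),
    ← lie_skew _ (X lam mu 1), x0_X2, X0_X2, x1_X2, x2_X2, X1_X2]
  simp only [TensorProduct.tmul_add, TensorProduct.add_tmul, TensorProduct.tmul_sub,
    TensorProduct.sub_tmul, TensorProduct.tmul_smul, ← TensorProduct.smul_tmul',
    TensorProduct.zero_tmul, TensorProduct.tmul_zero, TensorProduct.neg_tmul,
    TensorProduct.tmul_neg, neg_zero]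
  module

end S3Double

/-! ### Expansion of the coproducts modulo z² -/

section Expansion

theorem expand_aux {R M : Type*} [CommRing R] [AddCommGroup M] [Module R M] (z : R)
    (a b c d e f g h k l : M) :
    a + z • -b + z ^ 2 • c + (d + z • e + z ^ 2 • f) - (z • g + z ^ 2 • h) +
      (z • k + z ^ 2 • l) =
    a + d + z • (e - b + k - g) + z ^ 2 • (c + f - h + l) := by
  module

theorem expand_aux' {R M : Type*} [CommRing R] [AddCommGroup M] [Module R M] (z : R)
    (a b c d e f g h k l : M) :
    a + z • -b + z ^ 2 • c + (d + z • e + z ^ 2 • f) + (z • g + z ^ 2 • h) -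
      (z • k + z ^ 2 • l) =
    a + d + z • (e - b + g - k) + z ^ 2 • (c + f + h - l) := by
  module

variable {A : Type*} [Ring A] [Algebra ℝ⟦X⟧ A]

theorem CTensor.add_tmul (a b c : A) : (a + b) ⊗ᶻ c = a ⊗ᶻ c + b ⊗ᶻ c :=
  Subtype.ext (funext fun n => by simp [CTensor.tmul, TensorProduct.add_tmul])

theorem CTensor.tmul_add (a b c : A) : a ⊗ᶻ (b + c) = a ⊗ᶻ b + a ⊗ᶻ c :=
  Subtype.ext (funext fun n => by simp [CTensor.tmul, TensorProduct.tmul_add])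

theorem CTensor.neg_tmul (a b : A) : (-a) ⊗ᶻ b = -(a ⊗ᶻ b) :=
  Subtype.ext (funext fun n => by simp [CTensor.tmul, TensorProduct.neg_tmul])

theorem CTensor.smul_tmul (c : ℝ⟦X⟧) (a b : A) : (c • a) ⊗ᶻ b = c • a ⊗ᶻ b :=
  Subtype.ext (funext fun n => by simp [CTensor.tmul, TensorProduct.smul_tmul'])

theorem CTensor.tmul_smul (c : ℝ⟦X⟧) (a b : A) : a ⊗ᶻ (c • b) = c • a ⊗ᶻ b :=
  Subtype.ext (funext fun n => by simp [CTensor.tmul])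

theorem CTensor.expand_skew {Cm Cp Sm Sp P Q v w : A} {cm cp sm sp : A}
    (hCm : Cm = 1 + (PowerSeries.X : ℝ⟦X⟧) • -P + (PowerSeries.X : ℝ⟦X⟧) ^ 2 • cm)
    (hCp : Cp = 1 + (PowerSeries.X : ℝ⟦X⟧) • P + (PowerSeries.X : ℝ⟦X⟧) ^ 2 • cp)
    (hSm : Sm = (PowerSeries.X : ℝ⟦X⟧) • Q + (PowerSeries.X : ℝ⟦X⟧) ^ 2 • sm)
    (hSp : Sp = (PowerSeries.X : ℝ⟦X⟧) • Q + (PowerSeries.X : ℝ⟦X⟧) ^ 2 • sp) :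
    Cm ⊗ᶻ v + v ⊗ᶻ Cp - Sm ⊗ᶻ w + w ⊗ᶻ Sp = 1 ⊗ᶻ v + v ⊗ᶻ 1 +
      (PowerSeries.X : ℝ⟦X⟧) • (v ⊗ᶻ P - P ⊗ᶻ v + w ⊗ᶻ Q - Q ⊗ᶻ w) +
      (PowerSeries.X : ℝ⟦X⟧) ^ 2 • (cm ⊗ᶻ v + v ⊗ᶻ cp - sm ⊗ᶻ w + w ⊗ᶻ sp) := by
  rw [hCm, hCp, hSm, hSp]
  simp only [CTensor.add_tmul, CTensor.tmul_add, CTensor.smul_tmul, CTensor.tmul_smul,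
    CTensor.neg_tmul]
  exact expand_aux (R := ℝ⟦X⟧) (M := CTensor A) ..

theorem CTensor.expand_skew' {Cm Cp Sm Sp P Q v w : A} {cm cp sm sp : A}
    (hCm : Cm = 1 + (PowerSeries.X : ℝ⟦X⟧) • -P + (PowerSeries.X : ℝ⟦X⟧) ^ 2 • cm)
    (hCp : Cp = 1 + (PowerSeries.X : ℝ⟦X⟧) • P + (PowerSeries.X : ℝ⟦X⟧) ^ 2 • cp)
    (hSm : Sm = (PowerSeries.X : ℝ⟦X⟧) • Q + (PowerSeries.X : ℝ⟦X⟧) ^ 2 • sm)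
    (hSp : Sp = (PowerSeries.X : ℝ⟦X⟧) • Q + (PowerSeries.X : ℝ⟦X⟧) ^ 2 • sp) :
    Cm ⊗ᶻ v + v ⊗ᶻ Cp + Sm ⊗ᶻ w - w ⊗ᶻ Sp = 1 ⊗ᶻ v + v ⊗ᶻ 1 +
      (PowerSeries.X : ℝ⟦X⟧) • (v ⊗ᶻ P - P ⊗ᶻ v + Q ⊗ᶻ w - w ⊗ᶻ Q) +
      (PowerSeries.X : ℝ⟦X⟧) ^ 2 • (cm ⊗ᶻ v + v ⊗ᶻ cp + sm ⊗ᶻ w - w ⊗ᶻ sp) := by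
  rw [hCm, hCp, hSm, hSp]
  simp only [CTensor.add_tmul, CTensor.tmul_add, CTensor.smul_tmul, CTensor.tmul_smul,
    CTensor.neg_tmul]
  exact expand_aux' (R := ℝ⟦X⟧) (M := CTensor A) ..

variable [Algebra ℝ A] [IsAdicComplete (Ideal.span {(PowerSeries.X : ℝ⟦X⟧)}) A]

theorem zexp_mul_zcos_eq (p q : A) : ∃ t : A, zexp p * zEval (PowerSeries.cos ℝ) q =
    1 + (PowerSeries.X : ℝ⟦X⟧) • p + (PowerSeries.X : ℝ⟦X⟧) ^ 2 • t := by
  obtain ⟨s, hs⟩ := zEval_eq (PowerSeries.exp ℝ) p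
  obtain ⟨t, ht⟩ := zEval_eq (PowerSeries.cos ℝ) q
  refine ⟨s * zEval (PowerSeries.cos ℝ) q + (1 + (PowerSeries.X : ℝ⟦X⟧) • p) * t, ?_⟩
  rw [hs, add_mul, smul_mul_assoc, smul_add, add_comm (_ • (s * _)), ← add_assoc]
  congr 1
  rw [ht]
  simp [PowerSeries.cos, PowerSeries.coeff_exp, mul_add]

theorem zexp_mul_zsin_eq (p q : A) : ∃ t : A, zexp p * zEval (PowerSeries.sin ℝ) q =
    (PowerSeries.X : ℝ⟦X⟧) • q + (PowerSeries.X : ℝ⟦X⟧) ^ 2 • t := by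
  obtain ⟨s, hs⟩ := zEval_eq (PowerSeries.exp ℝ) p
  obtain ⟨t, ht⟩ := zEval_eq (PowerSeries.sin ℝ) q
  refine ⟨(p + (PowerSeries.X : ℝ⟦X⟧) • s) * q + zexp p * t, ?_⟩
  rw [ht, mul_add, mul_smul_comm (_ ^ 2), smul_add, ← add_assoc]
  congr 1
  rw [hs]
  simp [PowerSeries.sin, PowerSeries.coeff_exp, add_mul, smul_smul, pow_succ, mul_assoc]
  abel

end Expansion

/-! ### The first-order condition as a linear condition on the Lie algebra -/

section FirstOrder

variable {L : Type*} [AddCommGroup L] [Module ℝ L] {A : Type*} [Ring A] [Algebra ℝ⟦X⟧ A]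
  [Algebra ℝ A] [IsScalarTower ℝ ℝ⟦X⟧ A]

theorem CTensor.lift_tmul (γ : L →ₗ[ℝ] A) (Y Z : L) :
    CTensor.lift γ (Y ⊗ₜ[ℝ] Z) = γ Y ⊗ᶻ γ Z := rfl

theorem CTensor.lift_smul (γ : L →ₗ[ℝ] A) (r : ℝ) (s : L ⊗[ℝ] L) :
    CTensor.lift γ (r • s) = (algebraMap ℝ ℝ⟦X⟧ r) • CTensor.lift γ s := by
  induction s with
  | zero => rw [smul_zero, map_zero, smul_zero]
  | add s t hs ht => rw [smul_add, map_add, map_add, hs, ht, smul_add]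
  | tmul Y Z =>
    rw [TensorProduct.smul_tmul', CTensor.lift_tmul, CTensor.lift_tmul, map_smul,
      ← algebraMap_smul ℝ⟦X⟧ r (γ Y), CTensor.smul_tmul]

theorem firstOrder_add_aux {R M : Type*} [CommRing R] [AddCommGroup M] [Module R M] (z : R)
    (a b c d a' b' c' d' : M) :
    a + b + z • c + z ^ 2 • d + (a' + b' + z • c' + z ^ 2 • d') =
      a + a' + (b + b') + z • (c + c') + z ^ 2 • (d + d') := by
  module

theorem firstOrder_smul_aux {R M : Type*} [CommRing R] [AddCommGroup M] [Module R M] (z r : R)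
    (a b c d : M) :
    r • (a + b + z • c + z ^ 2 • d) = r • a + r • b + z • r • c + z ^ 2 • r • d := by
  module

/-- The elements `Y` with `Δ(Y) = 1 ⊗ Y + Y ⊗ 1 + z δ(Y) + O(z²)`. -/
def firstOrderSubmodule (Δ : A →ₐ[ℝ⟦X⟧] CTensor A) (γ : L →ₗ[ℝ] A) (δ : L →ₗ[ℝ] L ⊗[ℝ] L) :
    Submodule ℝ L where
  carrier := {Y | ∃ t : CTensor A, Δ (γ Y) = 1 ⊗ᶻ γ Y + γ Y ⊗ᶻ 1 +
    (PowerSeries.X : ℝ⟦X⟧) • CTensor.lift γ (δ Y) + (PowerSeries.X : ℝ⟦X⟧) ^ 2 • t}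
  zero_mem' := ⟨0, by
    have h : (0 : A) = (0 : ℝ⟦X⟧) • (0 : A) := (smul_zero _).symm
    rw [map_zero, map_zero, map_zero, map_zero, h, CTensor.smul_tmul, CTensor.tmul_smul,
      zero_smul, zero_smul, smul_zero, smul_zero, add_zero, add_zero, add_zero]⟩
  add_mem' := by
    rintro Y Z ⟨s, hs⟩ ⟨t, ht⟩
    refine ⟨s + t, ?_⟩
    rw [map_add, map_add, hs, ht, map_add, map_add, CTensor.add_tmul, CTensor.tmul_add]
    exact firstOrder_add_aux (R := ℝ⟦X⟧) (M := CTensor A) ..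
  smul_mem' := by
    rintro r Y ⟨t, ht⟩
    refine ⟨algebraMap ℝ ℝ⟦X⟧ r • t, ?_⟩
    rw [map_smul, ← algebraMap_smul ℝ⟦X⟧ r (γ Y), map_smul, ht, map_smul,
      CTensor.lift_smul, CTensor.smul_tmul, CTensor.tmul_smul]
    exact firstOrder_smul_aux (R := ℝ⟦X⟧) (M := CTensor A) ..

theorem mem_firstOrderSubmodule_of_primitive {Δ : A →ₐ[ℝ⟦X⟧] CTensor A} {γ : L →ₗ[ℝ] A}
    {δ : L →ₗ[ℝ] L ⊗[ℝ] L} {Y : L} (hδ : δ Y = 0) (hΔ : Δ (γ Y) = 1 ⊗ᶻ γ Y + γ Y ⊗ᶻ 1) :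
    Y ∈ firstOrderSubmodule Δ γ δ :=
  ⟨0, by rw [hΔ, hδ, map_zero, smul_zero, smul_zero, add_zero, add_zero]⟩

variable [IsAdicComplete (Ideal.span {(PowerSeries.X : ℝ⟦X⟧)}) A]

/-- Only the expansions e^{∓zP} cos zQ = 1 ∓ zP + O(z²) and e^{∓zP} sin zQ = zQ + O(z²) matter. -/
theorem mem_firstOrderSubmodule {Δ : A →ₐ[ℝ⟦X⟧] CTensor A} {γ : L →ₗ[ℝ] A}
    {δ : L →ₗ[ℝ] L ⊗[ℝ] L} {Y W P Q : L}
    (hδ : δ Y = Y ⊗ₜ P - P ⊗ₜ Y + W ⊗ₜ Q - Q ⊗ₜ W)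
    (hΔ : Δ (γ Y) = (zexp (-γ P) * zEval (PowerSeries.cos ℝ) (γ Q)) ⊗ᶻ γ Y +
      γ Y ⊗ᶻ (zexp (γ P) * zEval (PowerSeries.cos ℝ) (γ Q)) -
      (zexp (-γ P) * zEval (PowerSeries.sin ℝ) (γ Q)) ⊗ᶻ γ W +
      γ W ⊗ᶻ (zexp (γ P) * zEval (PowerSeries.sin ℝ) (γ Q))) :
    Y ∈ firstOrderSubmodule Δ γ δ := by
  obtain ⟨cm, hcm⟩ := zexp_mul_zcos_eq (-γ P) (γ Q)
  obtain ⟨cp, hcp⟩ := zexp_mul_zcos_eq (γ P) (γ Q)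
  obtain ⟨sm, hsm⟩ := zexp_mul_zsin_eq (-γ P) (γ Q)
  obtain ⟨sp, hsp⟩ := zexp_mul_zsin_eq (γ P) (γ Q)
  refine ⟨cm ⊗ᶻ γ Y + γ Y ⊗ᶻ cp - sm ⊗ᶻ γ W + γ W ⊗ᶻ sp, ?_⟩
  rw [hΔ, hδ]
  simp only [map_add, map_sub, CTensor.lift_tmul]
  exact CTensor.expand_skew hcm hcp hsm hsp

theorem mem_firstOrderSubmodule' {Δ : A →ₐ[ℝ⟦X⟧] CTensor A} {γ : L →ₗ[ℝ] A}
    {δ : L →ₗ[ℝ] L ⊗[ℝ] L} {Y W P Q : L}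
    (hδ : δ Y = Y ⊗ₜ P - P ⊗ₜ Y + Q ⊗ₜ W - W ⊗ₜ Q)
    (hΔ : Δ (γ Y) = (zexp (-γ P) * zEval (PowerSeries.cos ℝ) (γ Q)) ⊗ᶻ γ Y +
      γ Y ⊗ᶻ (zexp (γ P) * zEval (PowerSeries.cos ℝ) (γ Q)) +
      (zexp (-γ P) * zEval (PowerSeries.sin ℝ) (γ Q)) ⊗ᶻ γ W -
      γ W ⊗ᶻ (zexp (γ P) * zEval (PowerSeries.sin ℝ) (γ Q))) :
    Y ∈ firstOrderSubmodule Δ γ δ := by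
  obtain ⟨cm, hcm⟩ := zexp_mul_zcos_eq (-γ P) (γ Q)
  obtain ⟨cp, hcp⟩ := zexp_mul_zcos_eq (γ P) (γ Q)
  obtain ⟨sm, hsm⟩ := zexp_mul_zsin_eq (-γ P) (γ Q)
  obtain ⟨sp, hsp⟩ := zexp_mul_zsin_eq (γ P) (γ Q)
  refine ⟨cm ⊗ᶻ γ Y + γ Y ⊗ᶻ cp + sm ⊗ᶻ γ W - γ W ⊗ᶻ sp, ?_⟩
  rw [hΔ, hδ]
  simp only [map_add, map_sub, CTensor.lift_tmul]
  exact CTensor.expand_skew' hcm hcp hsm hsp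

end FirstOrder

namespace QDouble

variable (lam mu : ℝˣ)

theorem smul_x (r : ℝ) (i : Fin 3) : r • x lam mu i = γ lam mu (r • S3Double.x lam mu i) := by
  rw [map_smul, γ_x]

theorem neg_smul_x (r : ℝ) (i : Fin 3) :
    -r • x lam mu i = -γ lam mu (r • S3Double.x lam mu i) := by
  rw [map_smul, γ_x, neg_smul]

theorem smul_X (r : ℝ) (i : Fin 3) : r • X lam mu i = γ lam mu (r • S3Double.X lam mu i) := by
  rw [map_smul, γ_X]

theorem neg_smul_X (r : ℝ) (i : Fin 3) :
    -r • X lam mu i = -γ lam mu (r • S3Double.X lam mu i) := by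
  rw [map_smul, γ_X, neg_smul]

theorem x_mem_firstOrderSubmodule (i : Fin 3) : S3Double.x lam mu i ∈
    firstOrderSubmodule (comul lam mu) (γ lam mu) (S3Double.cobracket lam mu) :=
  match i with
  | 0 => mem_firstOrderSubmodule_of_primitive (S3Double.cobracket_x0 lam mu) (by
      rw [γ_x]
      exact (coproducts lam mu).comul_x0)
  | 1 => mem_firstOrderSubmodule (S3Double.cobracket_x1 lam mu) (by
      rw [← neg_smul_x, ← smul_x, ← smul_x, γ_x, γ_x]
      exact (coproducts lam mu).comul_x1)
  | 2 => mem_firstOrderSubmodule' (S3Double.cobracket_x2 lam mu) (by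
      rw [← neg_smul_x, ← smul_x, ← smul_x, γ_x, γ_x]
      exact (coproducts lam mu).comul_x2)

theorem X_mem_firstOrderSubmodule (i : Fin 3) : S3Double.X lam mu i ∈
    firstOrderSubmodule (comul lam mu) (γ lam mu) (S3Double.cobracket lam mu) :=
  match i with
  | 0 => mem_firstOrderSubmodule_of_primitive (S3Double.cobracket_X0 lam mu) (by
      rw [γ_X]
      exact (coproducts lam mu).comul_X0)
  | 1 => mem_firstOrderSubmodule (S3Double.cobracket_X1 lam mu) (by
      rw [← neg_smul_X, ← smul_X, γ_X, γ_X, γ_X]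
      exact (coproducts lam mu).comul_X1)
  | 2 => mem_firstOrderSubmodule' (S3Double.cobracket_X2 lam mu) (by
      rw [← neg_smul_X, ← smul_X, γ_X, γ_X, γ_X]
      exact (coproducts lam mu).comul_X2)

theorem firstOrder (Y : S3Double lam mu) :
    Y ∈ firstOrderSubmodule (comul lam mu) (γ lam mu) (S3Double.cobracket lam mu) := by
  rw [S3Double.eq_sum lam mu Y]
  exact add_mem (sum_mem fun i _ => Submodule.smul_mem _ _ (x_mem_firstOrderSubmodule lam mu i))
    (sum_mem fun i _ => Submodule.smul_mem _ _ (X_mem_firstOrderSubmodule lam mu i))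

end QDouble

end

noncomputable section

set_option linter.unusedSimpArgs false

/-! ### The classical double: subalgebras, isomorphism with `so(1,3)`, self-duality -/

namespace SThree

theorem smul_ap (ρ t : ℝ) (u : SThree ρ) (i : Fin 3) : (t • u) i = t * u i := rfl

end SThree

namespace S3Double

variable (lam mu : ℝˣ)

/-- The element of the double with given components in `𝔤` and `𝔤*`. -/
def mk (a b : Fin 3 → ℝ) : S3Double lam mu := (a, b)

theorem mk_fst (a b : Fin 3 → ℝ) : (mk lam mu a b).1 = a := rfl
theorem mk_snd (a b : Fin 3 → ℝ) : (mk lam mu a b).2 = b := rfl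

/-- The Lie algebra `𝔰₃(μ)` in the double as the span of the `xⁱ`. -/
def ofFst : SThree (mu : ℝ) →ₗ⁅ℝ⁆ S3Double lam mu where
  toFun u := mk lam mu (fun i => u i) 0
  map_add' u v := by
    apply ext_ap <;> simp [fst_add_ap, snd_add_ap, SThree.add_ap, mk_fst, mk_snd]
  map_smul' t u := by
    apply ext_ap <;> simp [fst_smul_ap, snd_smul_ap, SThree.smul_ap, mk_fst, mk_snd]
  map_lie' {u v} := by
    apply ext_ap <;> simp [fst_lie_zero, fst_lie_one, fst_lie_two, snd_lie_zero, snd_lie_one,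
      snd_lie_two, SThree.lie_zero', SThree.lie_one', SThree.lie_two', mk_fst, mk_snd]

/-- The Lie algebra `𝔰₃(1/μ)` in the double as the span of the `X_i`. -/
def ofSnd : SThree (1 / (mu : ℝ)) →ₗ⁅ℝ⁆ S3Double lam mu where
  -- The basis vector e₀ goes to −X₀/λ, for which [−X₀/λ, X₁] = X₁/μ − X₂.
  toFun u := mk lam mu 0 ![-(u 0 / lam), u 1, u 2]
  map_add' u v := by
    apply ext_ap <;> simp [fst_add_ap, snd_add_ap, SThree.add_ap, mk_fst, mk_snd]
    ring
  map_smul' t u := by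
    apply ext_ap <;>
      simp [fst_smul_ap, snd_smul_ap, SThree.smul_ap, mul_div_assoc, mk_fst, mk_snd]
  map_lie' {u v} := by
    have hl := lam.ne_zero
    have hm := mu.ne_zero
    apply ext_ap <;> simp [fst_lie_zero, fst_lie_one, fst_lie_two, snd_lie_zero, snd_lie_one,
      snd_lie_two, SThree.lie_zero', SThree.lie_one', SThree.lie_two', mk_fst, mk_snd] <;>
      field_simp <;> ring

theorem ofFst_apply (u : SThree (mu : ℝ)) : ofFst lam mu u = mk lam mu (fun i => u i) 0 := rfl

theorem ofSnd_apply (u : SThree (1 / (mu : ℝ))) :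
    ofSnd lam mu u = mk lam mu 0 ![-(u 0 / lam), u 1, u 2] := rfl

theorem ofFst_injective : Function.Injective (ofFst lam mu) := fun _ _ h => congrArg Prod.fst h

theorem ofSnd_injective : Function.Injective (ofSnd lam mu) := fun u v h => by
  have h (i : Fin 3) := congrFun (congrArg Prod.snd h) i
  have h0 : -(u 0 / (lam : ℝ)) = -(v 0 / lam) := h 0
  exact SThree.ext_ap _ ((div_left_inj' lam.ne_zero).1 (neg_inj.1 h0)) (h 1) (h 2)

theorem range_ofFst : LinearMap.range (ofFst lam mu : SThree (mu : ℝ) →ₗ[ℝ] S3Double lam mu) =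
    Submodule.span ℝ (Set.range (x lam mu)) := by
  refine le_antisymm ?_ (Submodule.span_le.2 ?_)
  · rintro _ ⟨u, rfl⟩
    rw [LieHom.coe_toLinearMap, eq_sum lam mu (ofFst lam mu u)]
    refine add_mem (sum_mem fun i _ => Submodule.smul_mem _ _ (Submodule.subset_span ⟨i, rfl⟩)) ?_
    simp [ofFst_apply, mk_snd]
  · rintro _ ⟨i, rfl⟩
    exact ⟨(Pi.single i 1 : Fin 3 → ℝ), rfl⟩

theorem range_ofSnd :
    LinearMap.range (ofSnd lam mu : SThree (1 / (mu : ℝ)) →ₗ[ℝ] S3Double lam mu) =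
    Submodule.span ℝ (Set.range (X lam mu)) := by
  refine le_antisymm ?_ (Submodule.span_le.2 ?_)
  · rintro _ ⟨u, rfl⟩
    rw [LieHom.coe_toLinearMap, eq_sum lam mu (ofSnd lam mu u)]
    refine add_mem ?_ (sum_mem fun i _ => Submodule.smul_mem _ _ (Submodule.subset_span ⟨i, rfl⟩))
    simp [ofSnd_apply, mk_fst]
  · rintro _ ⟨i, rfl⟩
    refine ⟨(![-((X lam mu i).2 0 * lam), (X lam mu i).2 1, (X lam mu i).2 2] : Fin 3 → ℝ), ?_⟩
    refine ext_ap lam mu rfl rfl rfl ?_ rfl rfl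
    change -(-((X lam mu i).2 0 * (lam : ℝ)) / lam) = _
    rw [neg_div, neg_neg, mul_div_cancel_right₀ _ lam.ne_zero]

theorem mem_so'_iff {p q : Type*} [Fintype p] [Fintype q] [DecidableEq p] [DecidableEq q]
    {M : Matrix (p ⊕ q) (p ⊕ q) ℝ} : M ∈ LieAlgebra.Orthogonal.so' p q ℝ ↔
      (∀ i j, M (.inl j) (.inl i) = -M (.inl i) (.inl j)) ∧
      (∀ i j, M (.inr j) (.inl i) = M (.inl i) (.inr j)) ∧
      ∀ i j, M (.inr j) (.inr i) = -M (.inr i) (.inr j) := by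
  rw [LieAlgebra.Orthogonal.so', mem_skewAdjointMatricesLieSubalgebra,
    mem_skewAdjointMatricesSubmodule]
  change M.transpose * LieAlgebra.Orthogonal.indefiniteDiagonal p q ℝ =
    LieAlgebra.Orthogonal.indefiniteDiagonal p q ℝ * -M ↔ _
  simp only [LieAlgebra.Orthogonal.indefiniteDiagonal, ← Matrix.ext_iff, Matrix.mul_diagonal,
    Matrix.diagonal_mul, Sum.forall, Matrix.transpose_apply, Sum.elim_inl, Sum.elim_inr,
    Matrix.neg_apply, mul_one, one_mul, mul_neg, neg_mul, neg_neg, neg_eq_iff_eq_neg]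
  constructor
  · rintro ⟨h1, h2⟩
    exact ⟨fun i j => (h1 i).1 j, fun i => (h1 i).2, fun i => (h2 i).2⟩
  · rintro ⟨h1, h2, h3⟩
    exact ⟨fun i => ⟨h1 i, h2 i⟩, fun i => ⟨fun j => (h2 j i).symm, h3 i⟩⟩

/-- The matrix of `𝔰𝔬(1,3)` that corresponds to an element of the double. -/
def toMatrix (Y : S3Double lam mu) : Matrix (Fin 1 ⊕ Fin 3) (Fin 1 ⊕ Fin 3) ℝ :=
  -- In terms of the weights a and b, the coordinates satisfy k + ij = b Y⁰ + a Y₀ and n₁ + i n₂ =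
  -- ab (Y¹ − i Y²), with upper indices for 𝔤 and lower ones for 𝔤*; s is the imaginary part of ab
  -- and 2λ its real part. The Cartan part acts by a boost k and a rotation j, the n and m by two
  -- families of null rotations.
  let k : ℝ := mu * Y.1 0 + lam / mu * Y.2 0
  let j : ℝ := Y.1 0 - lam * Y.2 0
  let s : ℝ := lam * (1 - mu ^ 2) / mu
  let n₁ : ℝ := 2 * lam * Y.1 1 + s * Y.1 2
  let n₂ : ℝ := s * Y.1 1 - 2 * lam * Y.1 2
  let m₁ : ℝ := Y.2 1 / 2
  let m₂ : ℝ := Y.2 2 / 2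
  Matrix.fromBlocks 0 !![n₁ + m₁, n₂ - m₂, k] !![n₁ + m₁; n₂ - m₂; k]
    !![0, -j, m₁ - n₁; j, 0, -n₂ - m₂; n₁ - m₁, n₂ + m₂, 0]

/-- The element of the double that corresponds to a matrix of `𝔰𝔬(1,3)`. -/
def ofMatrix (M : Matrix (Fin 1 ⊕ Fin 3) (Fin 1 ⊕ Fin 3) ℝ) : S3Double lam mu :=
  let k : ℝ := M (.inl 0) (.inr 2)
  let j : ℝ := M (.inr 1) (.inr 0)
  let s : ℝ := lam * (1 - mu ^ 2) / mu
  let n₁ : ℝ := (M (.inl 0) (.inr 0) + M (.inr 2) (.inr 0)) / 2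
  let n₂ : ℝ := (M (.inl 0) (.inr 1) + M (.inr 2) (.inr 1)) / 2
  -- This is |ab|², needed to undo the multiplication by ab.
  let d : ℝ := (lam * (1 + mu ^ 2) / mu) ^ 2
  mk lam mu ![(mu * k + j) / (1 + mu ^ 2), (2 * lam * n₁ + s * n₂) / d,
      (s * n₁ - 2 * lam * n₂) / d]
    ![mu * (k - mu * j) / (lam * (1 + mu ^ 2)), M (.inl 0) (.inr 0) - M (.inr 2) (.inr 0),
      M (.inr 2) (.inr 1) - M (.inl 0) (.inr 1)]

theorem toMatrix_mem (Y : S3Double lam mu) :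
    toMatrix lam mu Y ∈ LieAlgebra.Orthogonal.so' (Fin 1) (Fin 3) ℝ := by
  refine mem_so'_iff.2 ⟨fun i j => ?_, fun i j => ?_, fun i j => ?_⟩
  · simp [toMatrix]
  · fin_cases i; fin_cases j <;> rfl
  · fin_cases i <;> fin_cases j <;> simp [toMatrix] <;> ring

theorem ofMatrix_toMatrix (Y : S3Double lam mu) : ofMatrix lam mu (toMatrix lam mu Y) = Y := by
  have hl := lam.ne_zero
  have hm := mu.ne_zero
  have hd : (1 + (mu : ℝ) ^ 2) ≠ 0 := by positivity
  apply ext_ap <;> simp [ofMatrix, toMatrix, mk_fst, mk_snd] <;> field_simp <;> ring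

theorem toMatrix_ofMatrix {M : Matrix (Fin 1 ⊕ Fin 3) (Fin 1 ⊕ Fin 3) ℝ}
    (hM : M ∈ LieAlgebra.Orthogonal.so' (Fin 1) (Fin 3) ℝ) :
    toMatrix lam mu (ofMatrix lam mu M) = M := by
  have hl := lam.ne_zero
  have hm := mu.ne_zero
  have hd : (1 + (mu : ℝ) ^ 2) ≠ 0 := by positivity
  obtain ⟨h1, h2, h3⟩ := mem_so'_iff.1 hM
  have h00 : M (.inl 0) (.inl 0) = 0 := by linarith [h1 0 0]
  have h (i : Fin 3) : M (.inr i) (.inr i) = 0 := by linarith [h3 i i]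
  rw [← Matrix.fromBlocks_toBlocks M, toMatrix]
  congr 1
  · ext i j
    rw [Subsingleton.elim i 0, Subsingleton.elim j 0]
    exact h00.symm
  · ext i j
    rw [Subsingleton.elim i 0]
    fin_cases j <;> simp [ofMatrix, mk_fst, mk_snd, Matrix.toBlocks₁₂] <;> field_simp <;> ring
  · ext i j
    rw [Subsingleton.elim j 0]
    fin_cases i <;> simp [ofMatrix, mk_fst, mk_snd, Matrix.toBlocks₁₂, Matrix.toBlocks₂₁, h2] <;>
      field_simp <;> ring
  · ext i j
    fin_cases i <;> fin_cases j <;>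
      simp [ofMatrix, mk_fst, mk_snd, Matrix.toBlocks₂₂, h, h3 0 1, h3 0 2, h3 1 2] <;>
      field_simp <;> ring

theorem toMatrix_lie (Y Z : S3Double lam mu) :
    toMatrix lam mu ⁅Y, Z⁆ = ⁅toMatrix lam mu Y, toMatrix lam mu Z⁆ := by
  have hm := mu.ne_zero
  rw [Ring.lie_def]
  ext (i | i) (j | j) <;> rw [Matrix.sub_apply, Matrix.mul_apply, Matrix.mul_apply] <;>
    rw [Fintype.sum_sum_type, Fintype.sum_sum_type]
  · fin_cases i; fin_cases j
    simp [toMatrix, Fin.sum_univ_three]; ring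
  · fin_cases i
    fin_cases j <;> simp [toMatrix, Fin.sum_univ_three, fst_lie_zero, fst_lie_one, fst_lie_two,
      snd_lie_zero, snd_lie_one, snd_lie_two] <;> field_simp <;> ring
  · fin_cases j
    fin_cases i <;> simp [toMatrix, Fin.sum_univ_three, fst_lie_zero, fst_lie_one, fst_lie_two,
      snd_lie_zero, snd_lie_one, snd_lie_two] <;> field_simp <;> ring
  · fin_cases i <;> fin_cases j <;> simp [toMatrix, Fin.sum_univ_three, fst_lie_zero, fst_lie_one,
      fst_lie_two, snd_lie_zero, snd_lie_one, snd_lie_two] <;> field_simp <;> ring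

/-- The double is isomorphic to `𝔰𝔬(1,3)`. -/
def equivSO : S3Double lam mu ≃ₗ⁅ℝ⁆ LieAlgebra.Orthogonal.so' (Fin 1) (Fin 3) ℝ where
  toFun Y := ⟨toMatrix lam mu Y, toMatrix_mem lam mu Y⟩
  map_add' Y Z := Subtype.ext (by
    change toMatrix lam mu (Y + Z) = toMatrix lam mu Y + toMatrix lam mu Z
    ext (i | i) (j | j) <;> fin_cases i <;> fin_cases j <;>
      simp [toMatrix, fst_add_ap, snd_add_ap] <;> ring)
  map_smul' t Y := Subtype.ext (by
    change toMatrix lam mu (t • Y) = t • toMatrix lam mu Y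
    ext (i | i) (j | j) <;> fin_cases i <;> fin_cases j <;>
      simp [toMatrix, fst_smul_ap, snd_smul_ap] <;> ring)
  map_lie' {Y Z} := Subtype.ext (toMatrix_lie lam mu Y Z)
  invFun M := ofMatrix lam mu M
  left_inv Y := ofMatrix_toMatrix lam mu Y
  right_inv M := Subtype.ext (toMatrix_ofMatrix lam mu M.2)

end S3Double

/-! ### Self-duality for `μ = 1` -/

/-- The diagonal linear automorphism of `ℝ³` with given nonzero entries. -/
def diagEquiv (a : Fin 3 → ℝˣ) : (Fin 3 → ℝ) ≃ₗ[ℝ] (Fin 3 → ℝ) :=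
  LinearEquiv.piCongrRight fun i => LinearEquiv.smulOfUnit (a i)

theorem diagEquiv_apply (a : Fin 3 → ℝˣ) (u : Fin 3 → ℝ) (i : Fin 3) :
    diagEquiv a u i = a i * u i := rfl

theorem diagEquiv_single (a : Fin 3 → ℝˣ) (i : Fin 3) :
    diagEquiv a (Pi.single i 1) = (a i : ℝ) • Pi.single i 1 := by
  ext j
  rcases eq_or_ne j i with rfl | h
  · simp [diagEquiv_apply]
  · simp [diagEquiv_apply, h]

theorem tensorCobracket_apply (t : Fin 3 → Fin 3 → Fin 3 → ℝ) (u : Fin 3 → ℝ) :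
    tensorCobracket t u = ∑ n, ∑ l, ∑ m, (t l m n * u n) •
      ((Pi.single l 1 : Fin 3 → ℝ) ⊗ₜ[ℝ] (Pi.single m 1 : Fin 3 → ℝ)) := by
  simp [tensorCobracket, mul_smul]

theorem isLieBialgebraIso_diagEquiv {f c f' c' : Fin 3 → Fin 3 → Fin 3 → ℝ} {a : Fin 3 → ℝˣ}
    (hf : ∀ i j k, a k * f i j k = f' i j k * a i * a j)
    (hc : ∀ i j k, c i j k * a i * a j = c' i j k * a k) :
    IsLieBialgebraIso f c f' c' (diagEquiv a) where
  map_bracket u v := by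
    ext k
    simp only [tensorBracket, diagEquiv_apply, Finset.mul_sum]
    refine Finset.sum_congr rfl fun i _ => Finset.sum_congr rfl fun j _ => ?_
    linear_combination u i * v j * hf i j k
  map_cobracket u := by
    simp only [tensorCobracket_apply, map_sum, map_smul, TensorProduct.map_tmul,
      LinearEquiv.coe_coe, diagEquiv_single, diagEquiv_apply, TensorProduct.smul_tmul',
      TensorProduct.tmul_smul, smul_smul]
    refine Finset.sum_congr rfl fun n _ => Finset.sum_congr rfl fun l _ =>
      Finset.sum_congr rfl fun m _ => ?_
    congr 2
    linear_combination u n * hc l m n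

/-- For μ = 1 the dual bracket is −λ times the bracket of 𝔤 in the same coordinates, so rescaling
the zeroth basis vector by −1/λ matches the brackets and, at the same time, the cobrackets. -/
theorem isLieBialgebraIso_dual (lam : ℝˣ) :
    IsLieBialgebraIso (fTensor 1) (cTensor lam 1) (cTensor lam 1) (fTensor 1)
      (diagEquiv ![-lam⁻¹, 1, 1]) := by
  apply isLieBialgebraIso_diagEquiv <;> intro i j k <;> fin_cases i <;> fin_cases j <;>
    fin_cases k <;> simp [fTensor, cTensor, spiralTensor]

end

/-! ### The quantization and its universal property -/

noncomputable section

namespace QDouble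

variable (lam mu : ℝˣ)

theorem isHopfQuantization :
    IsHopfQuantization (S3Double.cobracket lam mu) (hopf lam mu) (γ lam mu) where
  complete := inferInstance
  torsionFree _ := Formal.eq_zero_of_X_smul
  classicalLimit := ⟨Formal.constCoeff, fun r => ⟨Formal.const r, Formal.constCoeff_const r⟩,
    Formal.constCoeff_eq_zero_iff, constCoeff_γ lam mu⟩
  firstOrder := firstOrder lam mu

theorem existsUnique_lift {B : Type*} [Ring B] [Algebra ℝ⟦X⟧ B] [Algebra ℝ B]
    [IsScalarTower ℝ ℝ⟦X⟧ B] [IsAdicComplete (Ideal.span {(PowerSeries.X : ℝ⟦X⟧)}) B]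
    {x' X' : Fin 3 → B} (h : QuantumDoubleRelations lam mu x' X') :
    ∃! φ : QDouble lam mu →ₐ[ℝ⟦X⟧] B, ∀ i, φ (x lam mu i) = x' i ∧ φ (X lam mu i) = X' i := by
  obtain ⟨φ, hx, hX⟩ := exists_lift h
  refine ⟨φ, fun i => ⟨hx i, hX i⟩, fun ψ hψ => hom_ext ?_ ?_⟩
  · exact fun i => (hψ i).1.trans (hx i).symm
  · exact fun i => (hψ i).2.trans (hX i).symm

end QDouble

end

theorem mainTheorem8 (lam mu : ℝˣ) :
    -- the double contains `𝔰₃(μ)` and `𝔰₃(1/μ)` as the spans of the `xⁱ` and of the `X_i`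
    ((∃ i : SThree (mu : ℝ) →ₗ⁅ℝ⁆ S3Double lam mu, Function.Injective i ∧
        LinearMap.range (i : SThree (mu : ℝ) →ₗ[ℝ] S3Double lam mu) =
          Submodule.span ℝ (Set.range (S3Double.x lam mu))) ∧
      (∃ j : SThree (1 / (mu : ℝ)) →ₗ⁅ℝ⁆ S3Double lam mu, Function.Injective j ∧
        LinearMap.range (j : SThree (1 / (mu : ℝ)) →ₗ[ℝ] S3Double lam mu) =
          Submodule.span ℝ (Set.range (S3Double.X lam mu)))) ∧
    -- the double is isomorphic to `𝔰𝔬(1,3)`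
    Nonempty (S3Double lam mu ≃ₗ⁅ℝ⁆ LieAlgebra.Orthogonal.so' (Fin 1) (Fin 3) ℝ) ∧
    -- the Lie bialgebra is self-dual for `μ = 1`
    (mu = 1 → ∃ φ, IsLieBialgebraIso (fTensor mu) (cTensor lam mu) (cTensor lam mu) (fTensor mu) φ) ∧
    -- the double has the stated Hopf algebra quantization
    ∃ (A : Type) (_ : Ring A) (_ : Algebra ℝ⟦X⟧ A) (_ : Algebra ℝ A) (_ : IsScalarTower ℝ ℝ⟦X⟧ A)
      (H : ZHopf A) (γ : S3Double lam mu →ₗ[ℝ] A),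
      IsHopfQuantization (S3Double.cobracket lam mu) H γ ∧
      QuantumDoubleCoproducts lam mu H.comul
        (fun i => γ (S3Double.x lam mu i)) (fun i => γ (S3Double.X lam mu i)) ∧
      QuantumDoubleRelations lam mu
        (fun i => γ (S3Double.x lam mu i)) (fun i => γ (S3Double.X lam mu i)) ∧
      -- the commutation rules are defining relations of the complete algebra `A`
      ∀ (B : Type) [Ring B] [Algebra ℝ⟦X⟧ B] [Algebra ℝ B] [IsScalarTower ℝ ℝ⟦X⟧ B]
        [IsAdicComplete (Ideal.span {(PowerSeries.X : ℝ⟦X⟧)}) B] (x X : Fin 3 → B),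
        QuantumDoubleRelations lam mu x X →
        ∃! φ : A →ₐ[ℝ⟦X⟧] B, ∀ i, φ (γ (S3Double.x lam mu i)) = x i ∧
          φ (γ (S3Double.X lam mu i)) = X i := by
  refine ⟨⟨⟨S3Double.ofFst lam mu, S3Double.ofFst_injective lam mu, S3Double.range_ofFst lam mu⟩,
      ⟨S3Double.ofSnd lam mu, S3Double.ofSnd_injective lam mu, S3Double.range_ofSnd lam mu⟩⟩,
    ⟨S3Double.equivSO lam mu⟩, ?_, QDouble lam mu, inferInstance, inferInstance, inferInstance,
    inferInstance, QDouble.hopf lam mu, QDouble.γ lam mu, QDouble.isHopfQuantization lam mu, ?_⟩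
  · rintro rfl
    exact ⟨_, isLieBialgebraIso_dual lam⟩
  · simp only [QDouble.γ_x, QDouble.γ_X]
    exact ⟨QDouble.coproducts lam mu, QDouble.relations lam mu,
      fun B _ _ _ _ _ x X h => QDouble.existsUnique_lift lam mu h⟩
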